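/- Let $d\ge 1$, let $F$ be the free group on $x,y,z_1,\dots,z_d$, let $u\in\langle z_1,\dots,z_d\rangle$ and $r\in F$. Write $[x,y]=xyx^{-1}y^{-1}$ and ${}^{i}f=y^{i}fy^{-i}$ for $f\in F$, $i\in\mathbb Z$. Let $X_1=\{{}^{1}x\}\cup\{{}^{i}z_j : 1\le j\le d,\ i\ge 0\}$, which freely generates the subgroup $\langle X_1\rangle\le F$. Suppose that $\langle x,y,z_1,\dots,z_d\mid [x,y]u,\ r\rangle$ is a Hempel presentation, that is: (H1) $r\in\langle X_1\rangle$; (H2) in $\langle X_1\rangle$, $r$ is not conjugate to any element of the cyclic subgroup $\langle u^{-1}\cdot{}^{1}x\rangle$; (H3) $r$ is cyclically reduced with respect to $X_1$; (H4) the reduced word for $r$ with respect to $X_1$ involves some element of $\{{}^{0}z_1,\dots,{}^{0}z_d\}$. Then the following hold. (1) The set $R=\{[x,y]u,\,r\}$ is Cohen–Lyndon aspherical in $F$. That is, if $N$ is the normal closure of $R$ in $F$, $G=F/N$, and $G_q\le G$ denotes the image of the centralizer $\mathbf C_F(q)$ for $q\in R$, then (i) the group $N$ has a free basis consisting of $F$-conjugates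 of elements of $R$; and (ii) $N_{\mathrm{ab}}$, with the left $G$-action induced by left conjugation of $F$ on $N$, is naturally isomorphic as a $\mathbb ZG$-module to $\bigoplus_{q\in R}\mathbb Z[G/G_q]$, where natural means that the coset $G_q$ in the summand of $q$ corresponds to the class of $q$ in $N_{\mathrm{ab}}$. (2) The group $\langle x,y,z_1,\dots,z_d\mid [x,y]u,\ r\rangle$ is an HNN-extension of a one-relator group whose associated subgroups are Magnus subgroups. That is, there are a free group $E$, an element $s\in E$, two free bases $b_1,b_2$ of $E$ indexed by the same set, subgroups $A,B$ of the one-relator group $H=E/\langle\langle s\rangle\rangle$ and an isomorphism $\varphi\colon A\to B$, such that $A$ is a Magnus subgroup with respect to the presentation $\langle b_1\mid s\rangle$ of $H$, $B$ is a Magnus subgroup with respect to the presentation $\langle b_2\mid s\rangle$ of $H$, and the given group is isomorphic to the HNN-extension $\langle H,t\mid tat^{-1}=\varphi(a)\ (a\in A)\rangle$. Here a Magnus subgroup of $H$ with respect to $\langle b\mid s\rangle$ is a subgroup generated by the image of a subset $Y\subseteq b$ such that no conjugate of $s$ in $E$ lies in $\langle Y\rangle$ (for $s$ cyclically reduced with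 respect to $b$: $s$ is not a word on $Y^{\pm1}$). -/

import Mathlib

open scoped DirectSum MonoidAlgebra

/-! ### Cohen-Lyndon aspherical sets -/

section CohenLyndon

variable {F : Type*} [Group F]

/-- The action of a group `F` on the abelianization of a normal subgroup `N`, induced by left
conjugation `f • n = f n f⁻¹`. -/
def conjAbRep (N : Subgroup F) [N.Normal] : Representation ℤ F (Additive (Abelianization N)) where
  toFun f := (MonoidHom.toAdditive
    (Abelianization.map (MulAut.conjNormal f : N ≃* N).toMonoidHom)).toIntLinearMap
  map_one' := by
    ext a
    induction a using Additive.rec with | ofMul a => ?_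
    induction a using QuotientGroup.induction_on with | H n => ?_
    change Additive.ofMul (Abelianization.of (MulAut.conjNormal (1 : F) n)) = _
    rw [map_one]
    rfl
  map_mul' f g := by
    ext a
    induction a using Additive.rec with | ofMul a => ?_
    induction a using QuotientGroup.induction_on with | H n => ?_
    change Additive.ofMul (Abelianization.of (MulAut.conjNormal (f * g) n)) = _
    rw [map_mul]
    rfl

theorem conjAbRep_apply (N : Subgroup F) [N.Normal] (f : F) (n : N) :
    conjAbRep N f (Additive.ofMul (Abelianization.of n)) =
      Additive.ofMul (Abelianization.of (MulAut.conjNormal f n)) := rfl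

theorem conjAbRep_of_mem (N : Subgroup F) [N.Normal] (f : F) (hf : f ∈ N) :
    conjAbRep N f = 1 := by
  ext a
  induction a using Additive.rec with | ofMul a => ?_
  induction a using QuotientGroup.induction_on with | H n => ?_
  have h : (MulAut.conjNormal f n : N) = ⟨f, hf⟩ * n * ⟨f, hf⟩⁻¹ := by
    ext
    simp
  change Additive.ofMul (Abelianization.of (MulAut.conjNormal f n)) =
    Additive.ofMul (Abelianization.of n)
  refine congrArg Additive.ofMul ?_
  rw [h, map_mul, map_mul, map_inv, mul_comm, inv_mul_cancel_left]

/-- The relation module of `R ⊆ F`: the abelianization of the normal closure `⟨ᶠR⟩`, with the left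
action of `G = F ⧸ ⟨ᶠR⟩` induced by left conjugation. -/
def relationModule (R : Set F) :
    Representation ℤ (F ⧸ Subgroup.normalClosure R)
      (Additive (Abelianization (Subgroup.normalClosure R))) :=
  QuotientGroup.lift _ (conjAbRep (Subgroup.normalClosure R)) (conjAbRep_of_mem _)

/-- The subgroup `G_r` of `G = F ⧸ ⟨ᶠR⟩`: the image of the centralizer of `r` in `F`. In a free
group, the centralizer of `r ≠ 1` is the maximal cyclic subgroup generated by the root of `r`. -/
def rootSubgroup (R : Set F) (r : F) : Subgroup (F ⧸ Subgroup.normalClosure R) :=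
  (Subgroup.centralizer {r}).map (QuotientGroup.mk' (Subgroup.normalClosure R))

/-- The class in the relation module of an element `r ∈ R`. -/
def relatorClass (R : Set F) (r : R) : Additive (Abelianization (Subgroup.normalClosure R)) :=
  Additive.ofMul (Abelianization.of ⟨r, Subgroup.subset_normalClosure r.2⟩)

open Classical in
/-- `R` is Cohen-Lyndon aspherical in the free group `F`: the normal closure of `R` is free on a
set of conjugates of elements of `R`, and the relation module is naturally isomorphic, as a left
`G`-module, to `⨁ r ∈ R, ℤ[G ⧸ G_r]`. Natural means that the coset `G_r` in the summand
of `r` corresponds to the class of `r`. -/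
structure IsCohenLyndonAspherical (R : Set F) : Prop where
  exists_basis : ∃ (B : Set F) (b : FreeGroupBasis B (Subgroup.normalClosure R)),
    ∀ c : B, (b c : F) = c ∧ ∃ r ∈ R, ∃ f : F, (c : F) = f * r * f⁻¹
  exists_equiv : ∃ Φ : (Representation.directSum (k := ℤ) (fun r : R =>
      Representation.ofMulAction ℤ (F ⧸ Subgroup.normalClosure R)
        ((F ⧸ Subgroup.normalClosure R) ⧸ rootSubgroup R (r : F)))).Equiv (relationModule R),
    ∀ r : R, Φ (DirectSum.of
      (fun r : R => ℤ[(F ⧸ Subgroup.normalClosure R) ⧸ rootSubgroup R (r : F)]) r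
        (MonoidAlgebra.single ((1 : F ⧸ Subgroup.normalClosure R) :
          (F ⧸ Subgroup.normalClosure R) ⧸ rootSubgroup R (r : F)) 1)) = relatorClass R r

end CohenLyndon

/-! ### Magnus subgroups -/

/-- Let `b` be a free basis of the free group on `ι`, so that `⟨b ∣ s⟩` is a one-relator
presentation of `PresentedGroup {s}`. A Magnus subgroup with respect to this presentation is a
subgroup generated by (the image of) a subset `Y` of `b` such that no conjugate of `s` is a word on
`Y` and its inverses. When `s` is cyclically reduced with respect to `b`, this condition says that
`s` itself is not a word on `Y` and its inverses. -/
def IsMagnusSubgroup {ι : Type*} (s : FreeGroup ι) (b : FreeGroupBasis ι (FreeGroup ι))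
    (A : Subgroup (PresentedGroup {s})) : Prop :=
  ∃ Y : Set ι, (∀ g : FreeGroup ι, g * s * g⁻¹ ∉ Subgroup.closure (b '' Y)) ∧
    A = (Subgroup.closure (b '' Y)).map (PresentedGroup.mk {s})

/-! ### Hempel presentations -/

namespace Hempel

/-- The generators `x, y, z₁, …, z_d`. -/
inductive Gen (d : ℕ) : Type
  | x : Gen d
  | y : Gen d
  | z (j : Fin d) : Gen d

/-- Indices for the set `X₁`: `x₁` stands for `y x y⁻¹` and `z i j` for `yⁱ z_j y⁻ⁱ`. -/
inductive Idx (d : ℕ) : Type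
  | x₁ : Idx d
  | z (i : ℕ) (j : Fin d) : Idx d
  deriving DecidableEq

variable {d : ℕ}

/-- The element of the free group on `x, y, z₁, …, z_d` with a given index in `X₁`. -/
def elt : Idx d → FreeGroup (Gen d)
  | .x₁ => FreeGroup.of .y * FreeGroup.of .x * (FreeGroup.of .y)⁻¹
  | .z i j => FreeGroup.of .y ^ i * FreeGroup.of (.z j) * (FreeGroup.of .y ^ i)⁻¹

/-- Substitution of the elements of `X₁` into words on their indices. Since `X₁` freely generates
the subgroup `⟨X₁⟩`, an element of `⟨X₁⟩` is `subst w` for exactly one `w`, and the reduced word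
`w.toWord` is its expression with respect to `X₁`. -/
def subst : FreeGroup (Idx d) →* FreeGroup (Gen d) := FreeGroup.lift elt

/-- The inclusion of the free group on `z₁, …, z_d`. -/
def inclZ : FreeGroup (Fin d) →* FreeGroup (Gen d) := FreeGroup.map Gen.z

/-- The relator `[x,y]u`, where `[x,y] = x y x⁻¹ y⁻¹`. -/
def surfaceRel (u : FreeGroup (Fin d)) : FreeGroup (Gen d) :=
  FreeGroup.of .x * FreeGroup.of .y * (FreeGroup.of .x)⁻¹ * (FreeGroup.of .y)⁻¹ * inclZ u

/-- `r` is a Hempel relator for `⟨x, y, z₁, …, z_d ∣ [x,y]u⟩`. -/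
structure IsHempelRelator (u : FreeGroup (Fin d)) (r : FreeGroup (Gen d)) : Prop where
  /-- `r` belongs to the subgroup generated by `X₁` -/
  mem : r ∈ Subgroup.closure (Set.range (elt : Idx d → FreeGroup (Gen d)))
  /-- in `⟨X₁⟩`, `r` is not conjugate to any element of `⟨u⁻¹ · y x y⁻¹⟩` -/
  not_conj : ∀ g ∈ Subgroup.closure (Set.range (elt : Idx d → FreeGroup (Gen d))),
    g * r * g⁻¹ ∉ Subgroup.zpowers ((inclZ u)⁻¹ * elt .x₁)
  /-- with respect to `X₁`, `r` is cyclically reduced -/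
  cyclicallyReduced : ∀ w : FreeGroup (Idx d), subst w = r →
    FreeGroup.IsCyclicallyReduced w.toWord
  /-- with respect to `X₁`, `r` involves some `z_j` (conjugated by `y⁰`) -/
  involves : ∀ w : FreeGroup (Idx d), subst w = r → ∃ j e, (Idx.z 0 j, e) ∈ w.toWord

end Hempel

/-! Modulo `[x,y]u` one has `x = u⁻¹·¹x`, so conjugation by `y` carries `u⁻¹·¹x` to `¹x`; it also
carries `ⁱz_j` to `ⁱ⁺¹z_j`. Let `m` be the highest level of a `z`-letter in `r`, let `E` be free on
`¹x` and the `ⁱz_j` with `0 ≤ i ≤ m`, and let `H` be the quotient of `E` by `r`, read as a word `s`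
in `E`. The given group is then an HNN extension of `H` with stable letter `y`, as soon as `u⁻¹·¹x,
ⁱz_j (i < m)` and `¹x, ⁱz_j (1 ≤ i ≤ m)` are free generators of their spans in `H`. This is the
Freiheitssatz `hasFreiheitssatz`: the second family omits level 0, which occurs in `r` by (H4); the
first omits level `m` if `m > 0`, and for `m = 0` it is `u⁻¹·¹x` alone, which (H2) handles. This
gives (2).

For (1), the kernel of `F → G` acts on the Bass–Serre tree of the HNN extension. It is the free
product of conjugates of `ker (E → H)`, one for each vertex, and of a free group on conjugates of
the surface relator, one for each element of `G`. This is the content of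
`StableLetter.isCohenLyndonFamily_relators`: a Schreier argument gives generation (`Frame.ker_le`),
and a lift to a wreath product gives a left inverse, hence freeness (`Frame.exists_wreathLift`). The
kernel of `E → H` has a basis of conjugates of `s` by the Cohen–Lyndon theorem for one relator,
`isCohenLyndonFamily_of_ne_one`. Finally `IsCohenLyndonFamily.isCohenLyndonAspherical` reads the
relation module off the basis.

The Freiheitssatz and the one-relator Cohen–Lyndon theorem are both proved by Magnus induction,
using the same HNN mechanism. If a generator has exponent sum zero in the relator, it serves as
stable letter and rewriting shortens the word. Otherwise `twist` produces such a generator. For the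
Freiheitssatz injectivity of `twist` suffices; for Cohen–Lyndon the property has to be brought back
from a larger free group, by a retraction of normal closures
(`StableLetter.isCohenLyndonFamily_of_ι`). -/

/-! ### Sections of HNN extensions along normal forms -/

namespace HNNExtension

variable {E F H : Type*} [Group E] [Group F] [Group H] {A B : Subgroup H} {φ : A ≃* B}

open NormalWord in
/-- The left cosets of the base group of an HNN extension are the vertices of a tree. Any group `F`
mapping to the extension and containing lifts of the base group and of the stable letter then has
representatives of the vertices which, along each edge, differ only by the stable letter and
elements of the lift of the base group. -/
theorem exists_vertex_section (p : E →* H) (hp : Function.Surjective p) (i : E →* F) (s : F)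
    (π : F →* HNNExtension H A B φ) (hi : ∀ e, π (i e) = of (p e)) (hs : π s = t) :
    ∃ σ : HNNExtension H A B φ → F, σ 1 = 1 ∧ (∀ g h, σ (g * of h) = σ g) ∧
      (∀ g, ∃ h, g = π (σ g) * of h) ∧
      ∀ g, ∃ x y : E, ∃ b ∈ B, σ g * i x * s = σ (g * t) * i y ∧
        g = π (σ g) * of (p x) * of b := by
  obtain ⟨d⟩ := TransversalPair.nonempty H A B
  obtain ⟨l, hl⟩ := hp.hasRightInverse
  let T : List (ℤˣ × H) → F := fun L => (L.map fun x => s ^ (x.1 : ℤ) * i (l x.2)).prod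
  have hT : ∀ L, π (T L) = (L.map fun x => t ^ (x.1 : ℤ) * of x.2).prod := by
    intro L
    simp only [T, map_list_prod, List.map_map]
    congr 1
    refine List.map_congr_left fun x _ => ?_
    simp [hi, hs, hl x.2]
  -- Normal words carry their free base-group factor on the left, so passing to `g⁻¹` makes the tail
  -- an invariant of the left coset of `g`.
  let nf : HNNExtension H A B φ → NormalWord d := fun g => g⁻¹ • empty
  let σ : HNNExtension H A B φ → F := fun g => (T (nf g).toList)⁻¹
  have key : ∀ g, g = π (σ g) * of (nf g).head⁻¹ := by
    intro g
    have h : (nf g).prod φ = g⁻¹ := by simp [nf]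
    rw [ReducedWord.prod, ← hT] at h
    rw [← inv_inj, ← h]
    simp [σ]
  refine ⟨σ, ?_, ?_, fun g => ⟨_, key g⟩, fun g => ?_⟩
  · simp [σ, nf, T]
  · intro g h
    simp only [σ, nf, mul_inv_rev, mul_smul, ← map_inv, of_smul_eq_smul, group_smul_toList]
  · have ht : nf (g * t) = unitsSMul φ (-1) (nf g) := by
      rw [← t_pow_smul_eq_unitsSMul]
      simp [nf, mul_smul]
    have hk := key g
    have hσ : σ g = (T (nf g).toList)⁻¹ := rfl
    have hσt : σ (g * t) = (T (unitsSMul φ (-1) (nf g)).toList)⁻¹ := by rw [← ht]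
    rw [hσ] at hk ⊢
    rw [hσt]
    generalize nf g = w at hk ⊢
    -- Since `(g * t)⁻¹ = t⁻¹ * g⁻¹`, crossing the edge either deletes the first syllable of the
    -- normal form of `g⁻¹` (towards the root of the tree) or adds one (away from it).
    by_cases hc : Cancels (-1) w
    · rw [unitsSMul, dif_pos hc]
      cases w using consRecOn with
      | ofGroup => simp [Cancels] at hc
      | cons k u w h1 h2 ih =>
        clear ih
        have hu : u = 1 := by simpa using hc.2
        subst hu
        refine ⟨1, (l w.head)⁻¹, k⁻¹, inv_mem (by simpa using hc.1), ?_, ?_⟩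
        · simp [unitsSMulWithCancel, T, mul_assoc]
        · simpa using hk
    · rw [unitsSMul, dif_neg hc]
      set k := (unitsSMulGroup φ d (-1) w.head).2 with hkdef
      refine ⟨(l k)⁻¹, 1, (k : H) * w.head⁻¹, ?_, ?_, ?_⟩
      · have h2 := (d.compl (-1)).equiv_fst_mul_equiv_snd w.head
        have h3 : (k : H) = ((d.compl (-1)).equiv w.head).2 := by
          rw [hkdef, unitsSMulGroup_snd]
        have h4 : (k : H) * w.head⁻¹ = (((d.compl (-1)).equiv w.head).1 : H)⁻¹ := by
          rw [h3, mul_inv_eq_iff_eq_mul, eq_inv_mul_iff_mul_eq]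
          exact h2
        rw [h4]
        exact inv_mem ((d.compl (-1)).equiv w.head).1.2
      · simp [T, ← hkdef, mul_assoc]
      · rw [map_inv, map_inv, hl]
        conv_lhs => rw [hk]
        simp [mul_assoc]

end HNNExtension

/-! ### Wreath products -/

/-- The unrestricted wreath product of `Q` with the right regular representation of `G`. -/
@[ext]
structure RightWreath (Q G : Type*) where
  fn : G → Q
  pt : G

namespace RightWreath

variable {Q G Y : Type*} [Group Q] [Group G]

instance : Mul (RightWreath Q G) := ⟨fun a b => ⟨fun g => a.fn g * b.fn (g * a.pt), a.pt * b.pt⟩⟩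
instance : One (RightWreath Q G) := ⟨⟨fun _ => 1, 1⟩⟩
instance : Inv (RightWreath Q G) := ⟨fun a => ⟨fun g => (a.fn (g * a.pt⁻¹))⁻¹, a.pt⁻¹⟩⟩

@[simp] theorem mul_fn (a b : RightWreath Q G) (g : G) :
    (a * b).fn g = a.fn g * b.fn (g * a.pt) := rfl
@[simp] theorem mul_pt (a b : RightWreath Q G) : (a * b).pt = a.pt * b.pt := rfl
@[simp] theorem one_fn (g : G) : (1 : RightWreath Q G).fn g = 1 := rfl
@[simp] theorem one_pt : (1 : RightWreath Q G).pt = 1 := rfl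
@[simp] theorem inv_fn (a : RightWreath Q G) (g : G) :
    (a⁻¹).fn g = (a.fn (g * a.pt⁻¹))⁻¹ := rfl
@[simp] theorem inv_pt (a : RightWreath Q G) : (a⁻¹).pt = a.pt⁻¹ := rfl

instance : Group (RightWreath Q G) :=
  Group.ofLeftAxioms
    (fun a b c => by ext <;> simp [mul_assoc])
    (fun a => by ext <;> simp)
    (fun a => by ext <;> simp)

/-- The projection of the wreath product. -/
@[simps]
def proj : RightWreath Q G →* G where
  toFun := pt
  map_one' := rfl
  map_mul' _ _ := rfl

/-- Two lifts to the wreath product of conjugate embeddings of a free group into `G` are conjugate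
by a lift of the conjugating element, which may be prescribed on coset representatives. -/
theorem exists_intertwiner (κ κ' : FreeGroup Y →* G) (hκ : Function.Injective κ) (s : G)
    (hs : ∀ k, s * κ' k = κ k * s) (α β : FreeGroup Y →* RightWreath Q G)
    (hα : ∀ k, (α k).pt = κ' k) (hβ : ∀ k, (β k).pt = κ k) (rep : G → G)
    (hrep : ∀ g, ∃ k, g = rep g * κ k) (hrep' : ∀ g k, rep (g * κ k) = rep g)
    (τ₀ : G → Q) (hτ₀ : ∀ g k, τ₀ (g * κ k) = τ₀ g) :
    ∃ τ : G → Q, (∀ g, τ (rep g) = τ₀ g) ∧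
      ∀ k, (⟨τ, s⟩ : RightWreath Q G) * α k = β k * ⟨τ, s⟩ := by
  choose c hc using hrep
  -- The intertwining relation determines `τ` on a coset from its value at the representative;
  -- injectivity of `κ` makes the coordinate `c g` unique, so the formula is consistent.
  refine ⟨fun g => ((β (c g)).fn (rep g))⁻¹ * τ₀ g * (α (c g)).fn (rep g * s), fun g => ?_,
    fun k => ?_⟩
  · have h1 : rep (rep g) = rep g := by
      conv_rhs => rw [hc g, hrep']
    have h2 : c (rep g) = 1 := by
      have := hc (rep g)
      rw [h1] at this
      exact hκ (by simpa using this)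
    have h3 : τ₀ (rep g) = τ₀ g := by
      conv_rhs => rw [hc g, hτ₀]
    simp [h2, h3]
  · ext g
    · have h1 : c (g * κ k) = c g * k := by
        have h2 := hc (g * κ k)
        rw [hrep'] at h2
        apply hκ
        rw [map_mul]
        apply mul_left_cancel (a := rep g)
        rw [← h2, ← mul_assoc, ← hc g]
      have h4 : rep g * κ (c g) = g := (hc g).symm
      have h5 : rep g * s * κ' (c g) = g * s := by rw [mul_assoc, hs, ← mul_assoc, h4]
      simp only [mul_fn, hβ, h1, hrep', hτ₀, map_mul, hα, h4, h5]
      group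
    · simp [hα, hβ, hs]

end RightWreath

/-! ### Free groups with a stable letter -/

/-- A group `F` generated by a homomorphic image of `E` and a stable letter `s`, subject exactly to
the relations `s (a y) s⁻¹ = b y` for `y ∈ known`. -/
structure StableLetter (E F Y : Type) [Group E] [Group F] where
  ι : E →* F
  s : F
  a : Y → E
  b : Y → E
  known : Set Y
  conj_a : ∀ y ∈ known, s * ι (a y) * s⁻¹ = ι (b y)
  exists_lift : ∀ {W : Type} [Group W] (ε : E →* W) (w : W),
    (∀ y ∈ known, w * ε (a y) * w⁻¹ = ε (b y)) → ∃ Φ : F →* W, (∀ e, Φ (ι e) = ε e) ∧ Φ s = w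
  closure_eq_top : Subgroup.closure (Set.range ι ∪ {s}) = ⊤

/-- The isomorphism between the images of two embeddings of a group. -/
noncomputable def rangeEquivRange {K H : Type*} [Group K] [Group H] {α β : K →* H}
    (hα : Function.Injective α) (hβ : Function.Injective β) : α.range ≃* β.range :=
  (MonoidHom.ofInjective hα).symm.trans (MonoidHom.ofInjective hβ)

theorem rangeEquivRange_apply {K H : Type*} [Group K] [Group H] {α β : K →* H}
    (hα : Function.Injective α) (hβ : Function.Injective β) (k : K) :
    (rangeEquivRange hα hβ ⟨α k, k, rfl⟩ : H) = β k := by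
  have : (⟨α k, k, rfl⟩ : α.range) = MonoidHom.ofInjective hα k := rfl
  rw [this, rangeEquivRange, MulEquiv.trans_apply, MulEquiv.symm_apply_apply]
  rfl

/-- A family `rel` of elements of a group is a Cohen-Lyndon family if its normal closure is free on
conjugates of its members, one from each conjugacy class, under the normal closure, of conjugates of
members. -/
def IsCohenLyndonFamily {K F : Type} [Group F] (rel : K → F) : Prop :=
  ∃ (I : Type) (b : I → F) (l : I → K), Function.Injective (FreeGroup.lift b) ∧
    (FreeGroup.lift b).range = Subgroup.normalClosure (Set.range rel) ∧
    (∀ i, ∃ f, b i = f * rel (l i) * f⁻¹) ∧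
    ∀ k f, ∃ i, l i = k ∧ ∃ n ∈ Subgroup.normalClosure (Set.range rel),
      n * (f * rel k * f⁻¹) * n⁻¹ = b i

namespace StableLetter

variable {E F Y H : Type} [Group E] [Group F] [Group H] (D : StableLetter E F Y)

/-- The relator identifying the conjugate of `a y` by the stable letter with `b y`. -/
def relator (y : Y) : F := D.s * D.ι (D.a y) * D.s⁻¹ * (D.ι (D.b y))⁻¹

variable {p : E →* H} (hα : Function.Injective (FreeGroup.lift (p ∘ D.a)))
  (hβ : Function.Injective (FreeGroup.lift (p ∘ D.b)))

/-- The HNN extension of a quotient of the base in which all the `a y` are conjugate to the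
`b y`. -/
abbrev Quot := HNNExtension H _ _ (rangeEquivRange hα hβ)

theorem t_mul_of_lift (k : FreeGroup Y) :
    (HNNExtension.t * HNNExtension.of (FreeGroup.lift (p ∘ D.a) k) : D.Quot hα hβ) =
      HNNExtension.of (FreeGroup.lift (p ∘ D.b) k) * HNNExtension.t := by
  have := HNNExtension.t_mul_of (φ := rangeEquivRange hα hβ)
    ⟨FreeGroup.lift (p ∘ D.a) k, k, rfl⟩
  rwa [rangeEquivRange_apply] at this

/-- The known relations, which present `F`, are among those imposed in the HNN extension. -/
theorem exists_proj : ∃ π : F →* D.Quot hα hβ,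
    (∀ e, π (D.ι e) = HNNExtension.of (p e)) ∧ π D.s = HNNExtension.t := by
  refine D.exists_lift (HNNExtension.of.comp p) HNNExtension.t fun y _ => ?_
  have := D.t_mul_of_lift hα hβ (FreeGroup.of y)
  simp only [FreeGroup.lift_apply_of, Function.comp_apply] at this
  simp [this]

theorem hom_ext {W : Type*} [Group W] {Φ Ψ : F →* W} (h : ∀ e, Φ (D.ι e) = Ψ (D.ι e))
    (ht : Φ D.s = Ψ D.s) : Φ = Ψ := by
  refine MonoidHom.eq_of_eqOn_dense D.closure_eq_top ?_
  rintro _ (⟨e, rfl⟩ | rfl)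
  exacts [h e, ht]

/-- The projection to the HNN extension. -/
noncomputable def proj : F →* D.Quot hα hβ := (D.exists_proj hα hβ).choose

@[simp] theorem proj_ι (e : E) : D.proj hα hβ (D.ι e) = HNNExtension.of (p e) :=
  (D.exists_proj hα hβ).choose_spec.1 e

@[simp] theorem proj_s : D.proj hα hβ D.s = HNNExtension.t :=
  (D.exists_proj hα hβ).choose_spec.2

theorem proj_relator (y : Y) : D.proj hα hβ (D.relator y) = 1 := by
  have := D.t_mul_of_lift hα hβ (FreeGroup.of y)
  simp only [FreeGroup.lift_apply_of, Function.comp_apply] at this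
  simp [relator, this]

theorem proj_surjective (hp : Function.Surjective p) : Function.Surjective (D.proj hα hβ) := by
  rw [← MonoidHom.range_eq_top, eq_top_iff]
  intro g _
  induction g using HNNExtension.induction_on with
  | of g =>
    obtain ⟨e, rfl⟩ := hp g
    exact ⟨D.ι e, by simp⟩
  | t => exact ⟨D.s, by simp⟩
  | mul x y hx hy => exact mul_mem (hx trivial) (hy trivial)
  | inv x hx => exact inv_mem (hx trivial)

/-- Coset representatives adapted to the tree of the HNN extension. -/
structure Frame where
  σ : D.Quot hα hβ → F
  l : H → E
  c : D.Quot hα hβ → H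
  σ_one : σ 1 = 1
  l_one : l 1 = 1
  p_l : ∀ h, p (l h) = h
  σ_mul_of : ∀ g h, σ (g * HNNExtension.of h) = σ g
  eq_mul_of : ∀ g, g = D.proj hα hβ (σ g) * HNNExtension.of (c g)
  exists_edge : ∀ g, ∃ x y : E, ∃ k : FreeGroup Y,
    σ g * D.ι x * D.s = σ (g * HNNExtension.t) * D.ι y ∧
      g = D.proj hα hβ (σ g) * HNNExtension.of (p x) *
        HNNExtension.of (FreeGroup.lift (p ∘ D.b) k)

theorem nonempty_frame (hp : Function.Surjective p) : Nonempty (D.Frame hα hβ) := by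
  obtain ⟨σ, h1, h2, h3, h4⟩ := HNNExtension.exists_vertex_section p hp D.ι D.s (D.proj hα hβ)
    (D.proj_ι hα hβ) (D.proj_s hα hβ)
  choose c hc using h3
  obtain ⟨l, hl⟩ := hp.hasRightInverse
  classical
  refine ⟨⟨σ, Function.update l 1 1, c, h1, by simp, fun h => ?_, h2, hc, fun g => ?_⟩⟩
  · by_cases hh : h = 1
    · simp [hh]
    · simp [hh, hl h]
  · obtain ⟨x, y, _, ⟨k, rfl⟩, h5, h6⟩ := h4 g
    exact ⟨x, y, k, h5, h6⟩

namespace Frame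

open HNNExtension

variable {D hα hβ} (S : D.Frame hα hβ)

theorem c_eq_of_eq {g : D.Quot hα hβ} {h : H} (hg : g = D.proj hα hβ (S.σ g) * of h) :
    S.c g = h := by
  apply of_injective (φ := rangeEquivRange hα hβ)
  apply mul_left_cancel (a := D.proj hα hβ (S.σ g))
  rw [← hg, ← S.eq_mul_of]

theorem c_mul_of (g : D.Quot hα hβ) (h : H) : S.c (g * of h) = S.c g * h := by
  apply S.c_eq_of_eq
  rw [S.σ_mul_of, map_mul, ← mul_assoc, ← S.eq_mul_of]

theorem σ_proj_σ (g : D.Quot hα hβ) : S.σ (D.proj hα hβ (S.σ g)) = S.σ g := by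
  conv_rhs => rw [S.eq_mul_of g, S.σ_mul_of]

theorem c_proj_σ (g : D.Quot hα hβ) : S.c (D.proj hα hβ (S.σ g)) = 1 := by
  apply S.c_eq_of_eq
  simp [S.σ_proj_σ]

/-- The representative of an element of the HNN extension. -/
def lam (g : D.Quot hα hβ) : F := S.σ g * D.ι (S.l (S.c g))

theorem proj_lam (g : D.Quot hα hβ) : D.proj hα hβ (S.lam g) = g := by
  rw [lam, map_mul, proj_ι, S.p_l, ← S.eq_mul_of]

theorem c_one : S.c 1 = 1 := S.c_eq_of_eq (by simp [S.σ_one])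

theorem lam_one : S.lam 1 = 1 := by
  rw [lam, S.σ_one, S.c_one, S.l_one, map_one, one_mul]

/-- The representative of a coset of the image of the `b y`, adjacent to the stable letter. -/
theorem exists_edge_rep : ∃ (rep : D.Quot hα hβ → D.Quot hα hβ) (x y : D.Quot hα hβ → E),
    (∀ g k, rep (g * of (FreeGroup.lift (p ∘ D.b) k)) = rep g) ∧
    (∀ g k, x (g * of (FreeGroup.lift (p ∘ D.b) k)) = x g) ∧
    (∀ g k, y (g * of (FreeGroup.lift (p ∘ D.b) k)) = y g) ∧
    (∀ g, ∃ k, g = rep g * of (FreeGroup.lift (p ∘ D.b) k)) ∧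
    (∀ g, S.σ (rep g) = S.σ g) ∧ (∀ g, S.c (rep g) = p (x g)) ∧
    (∀ g, S.σ (rep g * t) = S.σ (g * t)) ∧ (∀ g, S.c (rep g * t) = p (y g)) ∧
    (∀ g, S.σ g * D.ι (x g) * D.s = S.σ (g * t) * D.ι (y g)) := by
  let B : Subgroup (D.Quot hα hβ) := (of.comp (FreeGroup.lift (p ∘ D.b))).range
  let e : D.Quot hα hβ → D.Quot hα hβ := fun g => (QuotientGroup.mk g : D.Quot hα hβ ⧸ B).out
  have he : ∀ g k, e (g * of (FreeGroup.lift (p ∘ D.b) k)) = e g := by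
    intro g k
    have : (QuotientGroup.mk (g * of (FreeGroup.lift (p ∘ D.b) k)) : D.Quot hα hβ ⧸ B) =
        QuotientGroup.mk g := QuotientGroup.mk_mul_of_mem g ⟨k, rfl⟩
    simp only [e, this]
  have he' : ∀ g, ∃ k, g = e g * of (FreeGroup.lift (p ∘ D.b) k) := by
    intro g
    have h1 : (QuotientGroup.mk (e g) : D.Quot hα hβ ⧸ B) = QuotientGroup.mk g :=
      QuotientGroup.out_eq' _
    obtain ⟨k, hk⟩ := QuotientGroup.eq.1 h1
    exact ⟨k, by
      simp only [MonoidHom.comp_apply] at hk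
      rw [hk]; group⟩
  choose x y k hxy hk using S.exists_edge
  have hσ : ∀ g k, S.σ (g * of (FreeGroup.lift (p ∘ D.b) k) * t) = S.σ (g * t) := by
    intro g k
    rw [mul_assoc, ← D.t_mul_of_lift hα hβ, ← mul_assoc, S.σ_mul_of]
  -- `e g` is an arbitrary representative of its coset. Moving it inside the coset, by the element
  -- `k` of the frame, lets it lie exactly on the lifted edge, without a correction from the
  -- associated subgroup.
  let rep : D.Quot hα hβ → D.Quot hα hβ := fun g =>
    D.proj hα hβ (S.σ (e g)) * of (p (x (e g)))
  have hrep : ∀ g, e g = rep g * of (FreeGroup.lift (p ∘ D.b) (k (e g))) := fun g => hk (e g)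
  have hrσ : ∀ g, S.σ (rep g) = S.σ (e g) := fun g => by
    conv_rhs => rw [hrep g, S.σ_mul_of]
  have hrσt : ∀ g, S.σ (rep g * t) = S.σ (e g * t) := fun g => by
    conv_rhs => rw [hrep g, hσ]
  have heσ : ∀ g, S.σ (e g) = S.σ g := fun g => by
    obtain ⟨j, hj⟩ := he' g
    conv_rhs => rw [hj, S.σ_mul_of]
  have heσt : ∀ g, S.σ (e g * t) = S.σ (g * t) := fun g => by
    obtain ⟨j, hj⟩ := he' g
    conv_rhs => rw [hj, hσ]
  refine ⟨rep, fun g => x (e g), fun g => y (e g), fun g k => ?_, fun g k => ?_, fun g k => ?_,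
    fun g => ?_, fun g => (hrσ g).trans (heσ g), fun g => ?_, fun g => (hrσt g).trans (heσt g),
    fun g => ?_, fun g => ?_⟩
  · simp only [rep, he]
  · simp only [he]
  · simp only [he]
  · obtain ⟨j, hj⟩ := he' g
    refine ⟨k (e g) * j, ?_⟩
    rw [map_mul, map_mul, ← mul_assoc, ← hrep, ← hj]
  · exact S.c_eq_of_eq (by rw [hrσ])
  · apply S.c_eq_of_eq
    rw [hrσt]
    have := congrArg (D.proj hα hβ) (hxy (e g))
    simpa only [map_mul, proj_ι, proj_s] using this
  · rw [← heσ g, ← heσt g]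
    exact hxy (e g)

end Frame

end StableLetter

/-! ### Wreath product lifts and generators of the kernel -/

namespace StableLetter

open HNNExtension

variable {E F Y H : Type} [Group E] [Group F] [Group H] {D : StableLetter E F Y} {p : E →* H}
  {hα : Function.Injective (FreeGroup.lift (p ∘ D.a))}
  {hβ : Function.Injective (FreeGroup.lift (p ∘ D.b))}

namespace Frame

variable (S : D.Frame hα hβ) {Q : Type} [Group Q]

/-- The element `l h * e * (l (h * p e))⁻¹` of the kernel of `p`. -/
def schreier (h : H) (e : E) : p.ker :=
  ⟨S.l h * e * (S.l (h * p e))⁻¹, by simp [MonoidHom.mem_ker, S.p_l]⟩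

/-- This cocycle rule is what makes `baseLift` multiplicative. -/
theorem schreier_mul (h : H) (e e' : E) :
    S.schreier h (e * e') = S.schreier h e * S.schreier (h * p e) e' := by
  ext
  simp only [schreier, map_mul, Subgroup.coe_mul, mul_assoc]
  group

theorem schreier_one_left (m : p.ker) : S.schreier 1 m = m := by
  ext
  have : p m = 1 := m.2
  simp [schreier, this, S.l_one]

theorem schreier_l (h : H) : S.schreier 1 (S.l h) = 1 := by
  ext
  simp [schreier, S.l_one, S.p_l]

/-- The lift of the base group to a wreath product determined by homomorphisms on the kernel. -/
noncomputable def baseLift (f : D.Quot hα hβ → p.ker →* Q) (hf : ∀ g h, f (g * of h) = f g) :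
    E →* RightWreath Q (D.Quot hα hβ) where
  toFun e := ⟨fun g => f g (S.schreier (S.c g) e), of (p e)⟩
  map_one' := by
    ext g
    · have : S.schreier (S.c g) 1 = 1 := by ext; simp [schreier]
      simp [this]
    · simp
  map_mul' e e' := by
    ext g
    · simp [schreier_mul, hf, S.c_mul_of]
    · simp

/-- Homomorphisms from the kernel of `p` to `Q`, one for each vertex, together with values on the
relators, determine a lift of the projection of `F` to a wreath product, which is normalized on the
vertex representatives. -/
theorem exists_wreathLift (f : D.Quot hα hβ → p.ker →* Q) (hf : ∀ g h, f (g * of h) = f g)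
    (q : D.Quot hα hβ → Y → Q) (hq : ∀ g, ∀ y ∈ D.known, q g y = 1) :
    ∃ Φ : F →* RightWreath Q (D.Quot hα hβ), (∀ x, (Φ x).pt = D.proj hα hβ x) ∧
      (∀ g, (Φ (S.σ g)).fn 1 = 1) ∧
      (∀ e g, (Φ (D.ι e)).fn g = f g (S.schreier (S.c g) e)) ∧
      ∀ y g, (Φ (D.relator y)).fn g = q g y := by
  obtain ⟨rep, x, y, hrep, hx, hy, hrep', h1, h2, h3, h4, h5⟩ := S.exists_edge_rep
  set ε := S.baseLift f hf with hε
  have hεfn : ∀ e g, (ε e).fn g = f g (S.schreier (S.c g) e) := fun _ _ => rfl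
  have hεpt : ∀ e, (ε e).pt = of (p e) := fun _ => rfl
  let κ : FreeGroup Y →* D.Quot hα hβ := of.comp (FreeGroup.lift (p ∘ D.b))
  let κ' : FreeGroup Y →* D.Quot hα hβ := of.comp (FreeGroup.lift (p ∘ D.a))
  let α : FreeGroup Y →* RightWreath Q (D.Quot hα hβ) := FreeGroup.lift fun z => ε (D.a z)
  -- The factor `q` is what remains after conjugating `a z` by the stable letter and cancelling `b
  -- z`, so it becomes the value of `Φ` on the relator of `z`.
  let β : FreeGroup Y →* RightWreath Q (D.Quot hα hβ) :=
    FreeGroup.lift fun z => ⟨fun g => q g z, 1⟩ * ε (D.b z)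
  have hα' : ∀ k, (α k).pt = κ' k := by
    intro k
    have : (RightWreath.proj).comp α = κ' := by
      ext z
      simp [α, κ', hεpt]
    exact DFunLike.congr_fun this k
  have hβ' : ∀ k, (β k).pt = κ k := by
    intro k
    have : (RightWreath.proj).comp β = κ := by
      ext z
      simp [β, κ, hεpt]
    exact DFunLike.congr_fun this k
  have hσ : ∀ g k, S.σ (g * κ k * t) = S.σ (g * t) := by
    intro g k
    change S.σ (g * of (FreeGroup.lift (p ∘ D.b) k) * t) = S.σ (g * t)
    rw [mul_assoc, ← D.t_mul_of_lift hα hβ, ← mul_assoc, S.σ_mul_of]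
  -- Solved from the edge equation `σ g * ι x * s = σ (g * t) * ι y`, so that triviality of `(Φ (σ
  -- g)).fn 1` passes along edges.
  let τ₀ : D.Quot hα hβ → Q := fun g => ((ε (x g)).fn (D.proj hα hβ (S.σ g)))⁻¹ *
    (ε (y g)).fn (D.proj hα hβ (S.σ (g * t)))
  obtain ⟨τ, hτ, hτ'⟩ := RightWreath.exists_intertwiner κ κ'
    ((of_injective (φ := rangeEquivRange hα hβ)).comp hβ) t (D.t_mul_of_lift hα hβ) α β hα' hβ' rep
    hrep' hrep τ₀ (by
      intro g k
      have := hσ g k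
      simp only [κ, MonoidHom.comp_apply] at this ⊢
      simp only [τ₀, this, hx, hy, S.σ_mul_of])
  have hrel : ∀ z, (⟨τ, t⟩ : RightWreath Q (D.Quot hα hβ)) * ε (D.a z) * ⟨τ, t⟩⁻¹ =
      ⟨fun g => q g z, 1⟩ * ε (D.b z) := by
    intro z
    rw [mul_inv_eq_iff_eq_mul]
    simpa [α, β] using hτ' (FreeGroup.of z)
  obtain ⟨Φ, hΦ, hΦs⟩ := D.exists_lift ε ⟨τ, t⟩ (by
    intro z hz
    rw [hrel]
    have : (⟨fun g => q g z, 1⟩ : RightWreath Q (D.Quot hα hβ)) = 1 := by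
      ext g
      · exact hq g z hz
      · rfl
    rw [this, one_mul])
  have hpt : ∀ x, (Φ x).pt = D.proj hα hβ x := by
    intro x
    have : RightWreath.proj.comp Φ = D.proj hα hβ := by
      apply D.hom_ext
      · intro e
        simp [hΦ, hεpt]
      · simp [hΦs]
    exact DFunLike.congr_fun this x
  refine ⟨Φ, hpt, ?_, fun e g => by rw [hΦ, hεfn], fun z g => ?_⟩
  -- `P` is unaffected by right multiplication by base elements and by `t`, and it holds at 1;
  -- connectedness of the tree gives it everywhere.
  · let P : D.Quot hα hβ → Prop := fun g => (Φ (S.σ g)).fn 1 = 1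
    have hP : ∀ k g, P (g * k) ↔ P g := by
      intro k
      induction k using HNNExtension.induction_on with
      | of h => intro g; simp only [P, S.σ_mul_of]
      | t =>
        intro g
        have h6 := congrArg (fun z => (Φ z).fn 1) (h5 g)
        have h7 : D.proj hα hβ (S.σ g) * of (p (x g)) = rep g := by
          conv_rhs => rw [S.eq_mul_of (rep g), h1, h2]
        simp only [map_mul, RightWreath.mul_fn, hpt, one_mul, hΦ, hΦs, hεpt,
          h7, hτ, τ₀, mul_assoc, mul_inv_cancel_left] at h6
        have h8 : (Φ (S.σ g)).fn 1 = (Φ (S.σ (g * t))).fn 1 := mul_right_cancel h6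
        simp only [P, h8]
      | mul a b ha hb => intro g; rw [← mul_assoc, hb, ha]
      | inv a ha => intro g; rw [← ha, inv_mul_cancel_right]
    intro g
    have := (hP g 1).2 (by simp [P, S.σ_one])
    rwa [one_mul] at this
  · have : Φ (D.relator z) = ⟨fun g => q g z, 1⟩ := by
      rw [relator, map_mul, map_mul, map_mul, map_inv, map_inv, hΦ, hΦ, hΦs, hrel,
        mul_inv_cancel_right]
    rw [this]

/-- A subgroup containing enough conjugates of the kernel of `p` and of the relators contains the
kernel of the projection. -/
theorem ker_le (L : Subgroup F)
    (h1 : ∀ g, ∀ m ∈ p.ker, S.σ g * D.ι m * (S.σ g)⁻¹ ∈ L)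
    (h2 : ∀ g y, S.lam g * D.relator y * (S.lam g)⁻¹ ∈ L) : (D.proj hα hβ).ker ≤ L := by
  obtain ⟨rep, x, y, hrep, hx, hy, hrep', h3, h4, h5, h6, h7⟩ := S.exists_edge_rep
  -- The Schreier generator attached to `g` and `k` lies in `L`. Once this holds for generators `k`
  -- of `F`, it holds for all `k`, and `g = 1` with `k` in the kernel gives the claim.
  let C : F → D.Quot hα hβ → Prop := fun k g =>
    S.lam g * k * (S.lam (g * D.proj hα hβ k))⁻¹ ∈ L
  have hι : ∀ e g, C (D.ι e) g := by
    intro e g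
    have := h1 g (S.schreier (S.c g) e) (S.schreier (S.c g) e).2
    simpa [C, lam, S.σ_mul_of, S.c_mul_of, schreier, mul_assoc] using this
  have ht_rep : ∀ g, C D.s (rep g) := by
    intro g
    have h8 : S.l (p (x g)) * (x g)⁻¹ ∈ p.ker := by simp [MonoidHom.mem_ker, S.p_l]
    have h9 : y g * (S.l (p (y g)))⁻¹ ∈ p.ker := by simp [MonoidHom.mem_ker, S.p_l]
    have h10 := mul_mem (h1 g _ h8) (h1 (g * t) _ h9)
    have h11 : S.σ g * D.ι (S.l (p (x g)) * (x g)⁻¹) * (S.σ g)⁻¹ *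
        (S.σ (g * t) * D.ι (y g * (S.l (p (y g)))⁻¹) * (S.σ (g * t))⁻¹) =
        S.σ g * D.ι (S.l (p (x g))) * D.s *
          (S.σ (g * t) * D.ι (S.l (p (y g))))⁻¹ := by
      have h12 : S.σ (g * t) * D.ι (y g) * (D.ι (S.l (p (y g))))⁻¹ * (S.σ (g * t))⁻¹ =
        S.σ g * D.ι (x g) * D.s * (D.ι (S.l (p (y g))))⁻¹ * (S.σ (g * t))⁻¹ := by rw [h7]
      simp only [map_mul, map_inv, mul_assoc, mul_inv_rev] at h12 ⊢
      rw [h12]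
      group
    rw [h11] at h10
    simpa only [C, lam, h3, h4, proj_s, h5, h6] using h10
  -- Modulo the relators, the Schreier generators of the stable letter agree along a coset of the
  -- associated subgroup, so the one at the representative settles the whole coset.
  have hstep : ∀ z g, C D.s (g * of (p (D.b z))) ↔ C D.s g := by
    intro z g
    have ha := hι (D.a z) (g * t)
    have hb := hι (D.b z) g
    have hr := h2 g z
    have hz : g * of (p (D.b z)) * t = g * t * of (p (D.a z)) := by
      have := D.t_mul_of_lift hα hβ (FreeGroup.of z)
      simp only [FreeGroup.lift_apply_of, Function.comp_apply] at this
      rw [mul_assoc, ← this, mul_assoc]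
    simp only [C, proj_ι, proj_s] at ha hb ⊢
    rw [hz]
    have h8 : S.lam (g * of (p (D.b z))) * D.s * (S.lam (g * t * of (p (D.a z))))⁻¹ =
        (S.lam g * D.ι (D.b z) * (S.lam (g * of (p (D.b z))))⁻¹)⁻¹ *
        (S.lam g * D.relator z * (S.lam g)⁻¹)⁻¹ *
        (S.lam g * D.s * (S.lam (g * t))⁻¹) *
        (S.lam (g * t) * D.ι (D.a z) * (S.lam (g * t * of (p (D.a z))))⁻¹) := by
      rw [relator]
      group
    rw [h8, L.mul_mem_cancel_right ha, L.mul_mem_cancel_left (mul_mem (inv_mem hb) (inv_mem hr))]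
  have hs : ∀ g, C D.s g := by
    have h8 : ∀ k g, C D.s (g * of (FreeGroup.lift (p ∘ D.b) k)) ↔ C D.s g := by
      intro k
      induction k using FreeGroup.induction_on with
      | C1 => intro g; simp
      | of z => intro g; simpa using hstep z g
      | inv_of z ih => intro g; rw [← ih, mul_assoc, ← map_mul, ← map_mul]; simp
      | mul a b ha hb => intro g; rw [map_mul, map_mul, ← mul_assoc, hb, ha]
    intro g
    obtain ⟨k, hk⟩ := hrep' g
    rw [hk, h8]
    exact ht_rep g
  have hall : ∀ k g, C k g := by
    intro k
    have hk : k ∈ Subgroup.closure (Set.range D.ι ∪ {D.s}) := by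
      rw [D.closure_eq_top]; trivial
    induction hk using Subgroup.closure_induction with
    | mem k hk =>
      rcases hk with ⟨e, rfl⟩ | rfl
      exacts [hι e, hs]
    | one => intro g; simp [C]
    | mul a b _ _ ha hb =>
      intro g
      have := mul_mem (ha g) (hb (g * D.proj hα hβ a))
      simp only [C, map_mul] at this ⊢
      convert this using 1
      group
    | inv a _ ha =>
      intro g
      have := inv_mem (ha (g * (D.proj hα hβ a)⁻¹))
      simp only [C, map_inv, inv_mul_cancel_right] at this ⊢
      convert this using 1
      group
  intro k hk
  have := hall k 1
  rw [MonoidHom.mem_ker] at hk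
  simpa [C, hk, S.lam_one] using this

end Frame

end StableLetter

/-! ### Cohen–Lyndon families pass from the base group to an HNN extension -/

namespace StableLetter

open HNNExtension

variable {E F Y H : Type} [Group E] [Group F] [Group H] (D : StableLetter E F Y) {p : E →* H}

/-- The relators of the HNN extension of a quotient of the base. -/
def relators {K : Type} (rel : K → E) : K ⊕ {y // y ∉ D.known} → F :=
  Sum.elim (fun k => D.ι (rel k)) fun y => D.relator y

theorem relator_of_mem_known {y : Y} (hy : y ∈ D.known) : D.relator y = 1 := by
  rw [relator, D.conj_a y hy, mul_inv_cancel]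

/-- A Cohen-Lyndon family in the base group of an HNN extension, together with the relators of the
extension, is a Cohen-Lyndon family. -/
theorem isCohenLyndonFamily_relators (hα : Function.Injective (FreeGroup.lift (p ∘ D.a)))
    (hβ : Function.Injective (FreeGroup.lift (p ∘ D.b))) {K : Type} {rel : K → E} (hp : Function.Surjective p)
    (hker : p.ker = Subgroup.normalClosure (Set.range rel)) (hrel : IsCohenLyndonFamily rel) :
    IsCohenLyndonFamily (D.relators rel) ∧
      (D.proj hα hβ).ker = Subgroup.normalClosure (Set.range (D.relators rel)) := by
  obtain ⟨S⟩ := D.nonempty_frame hα hβ hp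
  obtain ⟨I, b, l, hb, hbr, hbl, hbc⟩ := hrel
  rw [← hker] at hbr hbc
  -- A vertex is encoded by the image of its chosen representative.
  let V := {g : D.Quot hα hβ // D.proj hα hβ (S.σ g) = g}
  -- The basis of the kernel: a copy of the basis of `ker p` at each vertex, and one conjugate of
  -- each new relator for every element of the HNN extension.
  let J := (V × I) ⊕ (D.Quot hα hβ × {y // y ∉ D.known})
  let v : D.Quot hα hβ → V := fun g => ⟨D.proj hα hβ (S.σ g), by rw [S.σ_proj_σ]⟩
  have hv : ∀ x : V, v x = x := fun x => Subtype.ext x.2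
  let B : J → F := Sum.elim (fun x => S.σ x.1 * D.ι (b x.2) * (S.σ x.1)⁻¹)
    fun x => S.lam x.1 * D.relator x.2 * (S.lam x.1)⁻¹
  let lab : J → K ⊕ {y // y ∉ D.known} := Sum.map (fun x => l x.2) fun x => x.2
  have hbI : ∀ i, b i ∈ p.ker := fun i => hbr ▸ ⟨FreeGroup.of i, by simp⟩
  -- freeness
  let e : FreeGroup I ≃* p.ker :=
    (MonoidHom.ofInjective hb).trans (MulEquiv.subgroupCongr hbr)
  have he : ∀ i, e.symm ⟨b i, hbI i⟩ = FreeGroup.of i := by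
    intro i
    rw [MulEquiv.symm_apply_eq]
    ext
    exact FreeGroup.lift_apply_of.symm
  let f : D.Quot hα hβ → p.ker →* FreeGroup J := fun g =>
    (FreeGroup.map fun i => Sum.inl (v g, i)).comp e.symm.toMonoidHom
  have hf : ∀ g h, f (g * of h) = f g := by
    intro g h
    have : v (g * of h) = v g := Subtype.ext (by simp only [v, S.σ_mul_of])
    simp only [f, this]
  classical
  let q : D.Quot hα hβ → Y → FreeGroup J := fun g y =>
    if hy : y ∈ D.known then 1 else FreeGroup.of (Sum.inr (g, ⟨y, hy⟩))
  obtain ⟨Φ, hΦ1, hΦ2, hΦ3, hΦ4⟩ := S.exists_wreathLift f hf q fun g y hy => by simp [q, hy]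
  have hBker : ∀ j, B j ∈ (D.proj hα hβ).ker := by
    rintro (⟨x, i⟩ | ⟨g, y⟩)
    · have : p (b i) = 1 := hbI i
      simp [B, MonoidHom.mem_ker, this]
    · simp [B, MonoidHom.mem_ker, D.proj_relator]
  -- On the kernel the projection to the point is trivial, so evaluation of the wreath lift at 1 is
  -- multiplicative there. This map is the left inverse proving freeness.
  let ψ : (D.proj hα hβ).ker →* FreeGroup J :=
    { toFun := fun n => (Φ n).fn 1
      map_one' := by simp
      map_mul' := fun n n' => by
        have : D.proj hα hβ n = 1 := n.2
        simp [hΦ1, this] }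
  have hσ' : ∀ z : F, ∀ n : F, (Φ z).fn 1 = 1 →
      (Φ (z * n * z⁻¹)).fn 1 = (Φ n).fn (D.proj hα hβ z) *
        ((Φ z).fn (D.proj hα hβ z * D.proj hα hβ n * (D.proj hα hβ z)⁻¹))⁻¹ := by
    intro z n hz
    simp [hΦ1, hz]
  have hΦl : ∀ g, (Φ (S.lam g)).fn 1 = 1 := by
    intro g
    rw [Frame.lam, map_mul, RightWreath.mul_fn, hΦ2, hΦ3, hΦ1, one_mul, one_mul, S.c_proj_σ,
      S.schreier_l, map_one]
  have hψB : ∀ j, ψ ⟨B j, hBker j⟩ = FreeGroup.of j := by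
    rintro (⟨x, i⟩ | ⟨g, y⟩)
    · change (Φ (S.σ x * D.ι (b i) * (S.σ x)⁻¹)).fn 1 = _
      have h1 : p (b i) = 1 := hbI i
      rw [hσ' _ _ (hΦ2 _)]
      simp only [proj_ι, h1, map_one, mul_one, mul_inv_cancel, hΦ2, inv_one, hΦ3, S.c_proj_σ]
      have h2 := S.schreier_one_left ⟨b i, hbI i⟩
      change S.schreier 1 (b i) = _ at h2
      rw [h2]
      have h3 : v (D.proj hα hβ (S.σ x)) = x := by rw [x.2, hv]
      simp [f, he, h3]
    · change (Φ (S.lam g * D.relator y * (S.lam g)⁻¹)).fn 1 = _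
      rw [hσ' _ _ (hΦl _)]
      simp only [D.proj_relator, mul_one, mul_inv_cancel, hΦl, inv_one, hΦ4, S.proj_lam]
      simp [q, y.2]
  have hrange_le : (FreeGroup.lift B).range ≤ (D.proj hα hβ).ker := by
    rw [FreeGroup.range_lift_eq_closure, Subgroup.closure_le]
    rintro _ ⟨j, rfl⟩
    exact hBker j
  have hinj : Function.Injective (FreeGroup.lift B) := by
    let L : FreeGroup J →* (D.proj hα hβ).ker := FreeGroup.lift fun j => ⟨B j, hBker j⟩
    have hL : ∀ w, (L w : F) = FreeGroup.lift B w := by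
      intro w
      have : (D.proj hα hβ).ker.subtype.comp L = FreeGroup.lift B := by
        ext j
        simp [L]
      exact DFunLike.congr_fun this w
    have hψL : ∀ w, ψ (L w) = w := by
      intro w
      have : ψ.comp L = MonoidHom.id _ := by
        ext j
        simp [L, hψB]
      exact DFunLike.congr_fun this w
    intro w w' h
    rw [← hψL w, ← hψL w']
    congr 1
    ext
    rw [hL, hL, h]
  -- generation
  have hrange : (FreeGroup.lift B).range = (D.proj hα hβ).ker := by
    refine le_antisymm hrange_le (S.ker_le _ ?_ ?_)
    · intro g m hm
      rw [← hbr, FreeGroup.range_lift_eq_closure] at hm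
      have hg : S.σ g = S.σ (v g) := (S.σ_proj_σ g).symm
      induction hm using Subgroup.closure_induction with
      | mem m hm =>
        obtain ⟨i, rfl⟩ := hm
        exact ⟨FreeGroup.of (Sum.inl (v g, i)), by simp [B, hg]⟩
      | one => simp
      | mul a c _ _ ha hc =>
        have := mul_mem ha hc
        rw [map_mul]
        convert this using 1
        group
      | inv a _ ha =>
        have := inv_mem ha
        rw [map_inv]
        convert this using 1
        group
    · intro g y
      by_cases hy : y ∈ D.known
      · simp [D.relator_of_mem_known hy]
      · exact ⟨FreeGroup.of (Sum.inr (g, ⟨y, hy⟩)), by simp [B]⟩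
  have hBl : ∀ j, ∃ z, B j = z * D.relators rel (lab j) * z⁻¹ := by
    rintro (⟨x, i⟩ | ⟨g, y⟩)
    · obtain ⟨z, hz⟩ := hbl i
      refine ⟨S.σ x * D.ι z, ?_⟩
      simp [B, lab, relators, hz, mul_assoc]
    · exact ⟨S.lam g, by simp [B, lab, relators]⟩
  have hker' : (D.proj hα hβ).ker = Subgroup.normalClosure (Set.range (D.relators rel)) := by
    apply le_antisymm
    · rw [← hrange, FreeGroup.range_lift_eq_closure, Subgroup.closure_le]
      rintro _ ⟨j, rfl⟩
      obtain ⟨z, hz⟩ := hBl j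
      rw [hz]
      exact Subgroup.normalClosure_normal.conj_mem _
        (Subgroup.subset_normalClosure (Set.mem_range_self _)) z
    · apply Subgroup.normalClosure_le_normal
      rintro _ ⟨k | y, rfl⟩
      · have : p (rel k) = 1 := by
          have : rel k ∈ p.ker := hker ▸ Subgroup.subset_normalClosure (Set.mem_range_self _)
          exact this
        simp [relators, MonoidHom.mem_ker, this]
      · simp [relators, MonoidHom.mem_ker, D.proj_relator]
  refine ⟨⟨J, B, lab, hinj, hrange.trans hker', hBl, ?_⟩, hker'⟩
  rw [← hker']
  rintro (k | y) z
  · set g := D.proj hα hβ z with hg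
    obtain ⟨i, hi, n, hn, hni⟩ := hbc k (S.l (S.c g))
    -- Here `n` conjugates `l (c g) * rel k * (l (c g))⁻¹` to `b i` inside `ker p`; transporting by
    -- `σ g` and replacing `z` by the representative `σ g * ι (l (c g))` of the same element costs
    -- only a factor in the kernel.
    refine ⟨Sum.inl (v g, i), by simp [lab, hi],
      S.σ g * D.ι n * D.ι (S.l (S.c g)) * z⁻¹, ?_, ?_⟩
    · have h1 : p n = 1 := hn
      rw [MonoidHom.mem_ker]
      simp only [map_mul, proj_ι, h1, map_one, mul_one, map_inv, S.p_l, ← hg]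
      rw [← S.eq_mul_of, mul_inv_cancel]
    · have hgv : S.σ (v g) = S.σ g := S.σ_proj_σ g
      simp only [B, Sum.elim_inl, hgv, ← hni, map_mul, map_inv, relators]
      group
  · refine ⟨Sum.inr (D.proj hα hβ z, y), by simp [lab], S.lam (D.proj hα hβ z) * z⁻¹, ?_, ?_⟩
    · simp [MonoidHom.mem_ker, S.proj_lam]
    · simp only [B, Sum.elim_inr, relators]
      group

/-- The base group embeds in an HNN extension, modulo the relators. -/
theorem mem_of_ι_mem (hα : Function.Injective (FreeGroup.lift (p ∘ D.a)))
    (hβ : Function.Injective (FreeGroup.lift (p ∘ D.b))) {K : Type} {rel : K → E}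
    (hker : p.ker = Subgroup.normalClosure (Set.range rel)) {e : E}
    (he : D.ι e ∈ Subgroup.normalClosure (Set.range (D.relators rel))) :
    e ∈ Subgroup.normalClosure (Set.range rel) := by
  have h : Subgroup.normalClosure (Set.range (D.relators rel)) ≤ (D.proj hα hβ).ker := by
    apply Subgroup.normalClosure_le_normal
    rintro _ ⟨k | y, rfl⟩
    · have : p (rel k) = 1 := by
        have : rel k ∈ p.ker := hker ▸ Subgroup.subset_normalClosure (Set.mem_range_self _)
        exact this
      simp [relators, MonoidHom.mem_ker, this]
    · simp [relators, MonoidHom.mem_ker, D.proj_relator]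
  have h1 := h he
  rw [MonoidHom.mem_ker, proj_ι] at h1
  rw [← hker]
  exact of_injective (φ := rangeEquivRange hα hβ) (by rw [h1, map_one])

end StableLetter

/-! ### Cohen-Lyndon families are Cohen-Lyndon aspherical -/

section Aspherical

variable {F : Type} [Group F]

/-- The class of an element in the abelianization of a subgroup, written additively. -/
def abClass (N : Subgroup F) (n : N) : Additive (Abelianization N) :=
  Additive.ofMul (Abelianization.of n)

theorem abClass_mul (N : Subgroup F) (n m : N) :
    abClass N (n * m) = abClass N n + abClass N m := rfl

theorem abClass_inv (N : Subgroup F) (n : N) : abClass N n⁻¹ = -abClass N n := rfl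

theorem abClass_one (N : Subgroup F) : abClass N 1 = 0 := rfl

theorem abClass_conj (N : Subgroup F) (n m : N) : abClass N (n * m * n⁻¹) = abClass N m := by
  rw [abClass_mul, abClass_mul, abClass_inv]
  abel

theorem abClass_hom_ext {N : Subgroup F} {I M : Type*} [AddCommGroup M] (e : FreeGroup I ≃* N)
    {φ ψ : Additive (Abelianization N) →ₗ[ℤ] M}
    (h : ∀ i, φ (abClass N (e (FreeGroup.of i))) = ψ (abClass N (e (FreeGroup.of i)))) :
    φ = ψ := by
  have h1 : ∀ w, φ (abClass N (e w)) = ψ (abClass N (e w)) := by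
    intro w
    induction w using FreeGroup.induction_on with
    | C1 => simp [abClass_one]
    | of i => exact h i
    | inv_of i ih => simp only [map_inv, abClass_inv, map_neg, ih]
    | mul a b ha hb => simp only [map_mul, abClass_mul, map_add, ha, hb]
  refine LinearMap.ext fun a => ?_
  induction a using Additive.rec with | ofMul a => ?_
  induction a using QuotientGroup.induction_on with | H n => ?_
  have := h1 (e.symm n)
  rwa [e.apply_symm_apply] at this

/-- The class in the relation module of the conjugate of a relator by a coset representative. -/
noncomputable def cosetClass (R : Set F) (r : R)
    (x : (F ⧸ Subgroup.normalClosure R) ⧸ rootSubgroup R (r : F)) :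
    Additive (Abelianization (Subgroup.normalClosure R)) :=
  relationModule R x.out (relatorClass R r)

/-- Independence of the coset representative: an element of the centralizer of `r` fixes the class
of `r` under conjugation. -/
theorem cosetClass_mk (R : Set F) (r : R) (g : F ⧸ Subgroup.normalClosure R) :
    cosetClass R r (QuotientGroup.mk g) = relationModule R g (relatorClass R r) := by
  obtain ⟨h, hh⟩ := QuotientGroup.mk_out_eq_mul (rootSubgroup R (r : F)) g
  obtain ⟨z, hz, hzh⟩ := h.2
  rw [cosetClass, hh, map_mul, Module.End.mul_apply]
  congr 1
  rw [← hzh]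
  change abClass _ (MulAut.conjNormal z _) = abClass _ _
  congr 1
  ext
  have := Subgroup.mem_centralizer_iff.1 hz (r : F) rfl
  simp [← this]

-- Abelianizing turns the free basis `b` into a `ℤ`-basis of the relation module. The last clause of
-- `IsCohenLyndonFamily` matches this basis with the cosets of the root subgroups: conjugates of a
-- member that are conjugate under `N` have equal classes, and their conjugators then represent the
-- same coset.
open Classical in
theorem IsCohenLyndonFamily.isCohenLyndonAspherical {K : Type} {rel : K → F}
    (h : IsCohenLyndonFamily rel) : IsCohenLyndonAspherical (Set.range rel) := by
  obtain ⟨I, b, l, hb, hbr, hbl, hbc⟩ := h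
  set R := Set.range rel with hR
  set N := Subgroup.normalClosure R with hN
  let e : FreeGroup I ≃* N := (MonoidHom.ofInjective hb).trans (MulEquiv.subgroupCongr hbr)
  have he : ∀ i, (e (FreeGroup.of i) : F) = b i := fun i => FreeGroup.lift_apply_of
  have hbi : Function.Injective b := fun i j hij => by
    apply FreeGroup.of_injective
    apply hb
    simpa using hij
  choose f hf using hbl
  refine ⟨⟨Set.range b, (FreeGroupBasis.ofRepr e.symm).reindex (Equiv.ofInjective b hbi), ?_⟩, ?_⟩
  · rintro ⟨_, i, rfl⟩
    refine ⟨?_, rel (l i), ⟨_, rfl⟩, f i, hf i⟩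
    rw [FreeGroupBasis.reindex_apply]
    have : (Equiv.ofInjective b hbi).symm ⟨b i, i, rfl⟩ = i := by
      rw [Equiv.symm_apply_eq]; rfl
    rw [this]
    exact he i
  let T : R → Type := fun r => (F ⧸ N) ⧸ rootSubgroup R (r : F)
  let fwd : (⨁ r : R, ℤ[T r]) →ₗ[ℤ] Additive (Abelianization N) :=
    DirectSum.toModule ℤ R _ fun r => (Finsupp.linearCombination ℤ (cosetClass R r)).comp
      (MonoidAlgebra.coeffLinearEquiv ℤ).toLinearMap
  have hfwd : ∀ (r : R) (x : T r),
      fwd (DirectSum.of (fun r : R => ℤ[T r]) r (MonoidAlgebra.single x 1)) = cosetClass R r x := by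
    intro r x
    have := DirectSum.toModule_lof ℤ (φ := fun r => (Finsupp.linearCombination ℤ
      (cosetClass R r)).comp (MonoidAlgebra.coeffLinearEquiv (S := ℤ) (M := T r) ℤ).toLinearMap) r
      (MonoidAlgebra.single x (1 : ℤ))
    refine this.trans ?_
    simp
  let rr : I → R := fun i => ⟨rel (l i), l i, rfl⟩
  let gen : I → ⨁ r : R, ℤ[T r] := fun i => DirectSum.of (fun r : R => ℤ[T r]) (rr i)
    (MonoidAlgebra.single (QuotientGroup.mk (QuotientGroup.mk (f i))) 1)
  let bwd : Additive (Abelianization N) →ₗ[ℤ] (⨁ r : R, ℤ[T r]) :=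
    (MonoidHom.toAdditiveLeft (Abelianization.lift
      ((FreeGroup.lift fun i => Multiplicative.ofAdd (gen i)).comp
        e.symm.toMonoidHom))).toIntLinearMap
  have hbwd : ∀ i, bwd (abClass N (e (FreeGroup.of i))) = gen i := by
    intro i
    change Multiplicative.toAdd (FreeGroup.lift (fun i => Multiplicative.ofAdd (gen i))
      (e.symm (e (FreeGroup.of i)))) = _
    simp
  have hconj : ∀ (r : R) (g : F), cosetClass R r (QuotientGroup.mk (QuotientGroup.mk g)) =
      abClass N (MulAut.conjNormal g ⟨r, Subgroup.subset_normalClosure r.2⟩) := by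
    intro r g
    rw [cosetClass_mk]
    rfl
  have hgen : ∀ i, fwd (gen i) = abClass N (e (FreeGroup.of i)) := by
    intro i
    rw [hfwd, hconj]
    congr 1
    ext
    rw [he, hf i]
    simp [rr]
  have h1 : fwd.comp bwd = LinearMap.id := by
    apply abClass_hom_ext e
    intro i
    simp [hbwd, hgen]
  have h2 : bwd.comp fwd = LinearMap.id := by
    refine DirectSum.linearMap_ext ℤ fun r => ?_
    refine MonoidAlgebra.lhom_ext' fun x => LinearMap.ext_ring ?_
    change bwd (fwd (DirectSum.of (fun r : R => ℤ[T r]) r (MonoidAlgebra.single x 1))) =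
      DirectSum.of (fun r : R => ℤ[T r]) r (MonoidAlgebra.single x 1)
    rw [hfwd]
    obtain ⟨g, rfl⟩ := QuotientGroup.mk_surjective x
    obtain ⟨g, rfl⟩ := QuotientGroup.mk_surjective g
    obtain ⟨_, k, rfl⟩ := r
    rw [hconj]
    obtain ⟨i, rfl, n, hn, hni⟩ := hbc k g
    have h3 : abClass N (MulAut.conjNormal g
        ⟨rel (l i), Subgroup.subset_normalClosure ⟨l i, rfl⟩⟩) =
        abClass N (e (FreeGroup.of i)) := by
      rw [← abClass_conj N ⟨n, hn⟩]
      congr 1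
      ext
      rw [he, ← hni]
      simp
    rw [h3, hbwd]
    have h4 : (QuotientGroup.mk (QuotientGroup.mk (f i)) : T (rr i)) =
        QuotientGroup.mk (QuotientGroup.mk g) := by
      rw [eq_comm, QuotientGroup.eq]
      -- Both `n * g` and `f i` conjugate `rel (l i)` to `b i`, so their quotient centralizes it;
      -- the factor `n` disappears modulo `N`.
      refine ⟨(n * g)⁻¹ * f i, ?_, ?_⟩
      · rw [SetLike.mem_coe, Subgroup.mem_centralizer_iff]
        rintro _ rfl
        have h5 := hni.trans (hf i)
        have h6 : (n * g) * rel (l i) * (n * g)⁻¹ = f i * rel (l i) * (f i)⁻¹ := by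
          rw [← h5]; group
        have h7 : rel (l i) = (n * g)⁻¹ * (f i * rel (l i) * (f i)⁻¹) * (n * g) := by
          rw [← h6]; group
        conv_lhs => rw [show (rr i : F) = rel (l i) from rfl, h7]
        simp only [rr]
        group
      · refine QuotientGroup.eq.2 ?_
        have h8 := Subgroup.normalClosure_normal.conj_mem n hn (f i)⁻¹
        convert h8 using 1
        group
    simp only [gen, h4]
    rfl
  let Φ : (⨁ r : R, ℤ[T r]) ≃ₗ[ℤ] Additive (Abelianization N) :=
    LinearEquiv.ofLinearMap fwd bwd h1 h2
  refine ⟨Representation.Equiv.mk Φ ?_, ?_⟩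
  · intro g
    refine DirectSum.linearMap_ext ℤ fun r => ?_
    refine MonoidAlgebra.lhom_ext' fun x => LinearMap.ext_ring ?_
    obtain ⟨z, rfl⟩ := QuotientGroup.mk_surjective x
    have h5 : Representation.directSum (k := ℤ) (fun r : R => Representation.ofMulAction ℤ
        (F ⧸ N) (T r)) g (DirectSum.of (fun r : R => ℤ[T r]) r
          (MonoidAlgebra.single (QuotientGroup.mk z) 1)) =
        DirectSum.of (fun r : R => ℤ[T r]) r (MonoidAlgebra.single (QuotientGroup.mk (g * z)) 1) := by
      have := DirectSum.lmap_lof (R := ℤ) (fun r : R => Representation.ofMulAction ℤ (F ⧸ N) (T r) g) r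
        (MonoidAlgebra.single (QuotientGroup.mk z) 1)
      refine this.trans ?_
      rw [Representation.ofMulAction_single]
      rfl
    change fwd (Representation.directSum (k := ℤ) (fun r : R => Representation.ofMulAction ℤ
        (F ⧸ N) (T r)) g (DirectSum.of (fun r : R => ℤ[T r]) r
          (MonoidAlgebra.single (QuotientGroup.mk z) 1))) =
      relationModule R g (fwd (DirectSum.of (fun r : R => ℤ[T r]) r
          (MonoidAlgebra.single (QuotientGroup.mk z) 1)))
    rw [h5, hfwd, hfwd, cosetClass_mk, cosetClass_mk, map_mul]
    rfl
  · intro r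
    change fwd _ = _
    rw [hfwd, cosetClass_mk, map_one]
    rfl

end Aspherical

/-! ### Cohen–Lyndon families pass from an HNN extension down to the base group -/

/-- To prove a statement for the normal closure of an element it suffices to prove it for the
conjugates of the element and to show that it is inherited by products and inverses. -/
theorem Subgroup.normalClosure_range_induction {K G : Type*} [Group G] {rel : K → G} (P : G → Prop)
    (conj : ∀ k g, P (g * rel k * g⁻¹)) (one : P 1) (mul : ∀ a b, P a → P b → P (a * b))
    (inv : ∀ a, P a → P a⁻¹) {m : G} (hm : m ∈ Subgroup.normalClosure (Set.range rel)) : P m := by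
  refine Subgroup.closure_induction (p := fun x _ => P x) ?_ one (fun a b _ _ => mul a b)
    (fun a _ => inv a) hm
  intro x hx
  obtain ⟨_, ⟨k, rfl⟩, h⟩ := Group.mem_conjugatesOfSet_iff.1 hx
  obtain ⟨g, rfl⟩ := isConj_iff.1 h
  exact conj k g

/-- Let `ι : E →* F` be such that the normal closure of `r` is a retract of the normal closure of
`ι r`, which is generated by the former and by conjugates of `ι r` in the kernel of the retraction,
all others being conjugate under the normal closure to images of conjugates of `r`. If `ι r` is a
Cohen-Lyndon family, then so is `r`. -/
theorem IsCohenLyndonFamily.of_retraction {E F : Type} [Group E] [Group F] (ι : E →* F) {r : E}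
    (hr : r ≠ 1) {M : Subgroup E} {N : Subgroup F}
    (hM : M = Subgroup.normalClosure (Set.range fun _ : Unit => r))
    (hN : N = Subgroup.normalClosure (Set.range fun _ : Unit => ι r))
    (hιN : ∀ m ∈ M, ι m ∈ N) (hrM : ∀ e, e * r * e⁻¹ ∈ M) (hrN : ∀ z, z * ι r * z⁻¹ ∈ N)
    (ρ : N →* M) (hρι : ∀ m : M, ρ ⟨ι m, hιN m m.2⟩ = m) (Z : Set F)
    (hZ : ∀ z ∈ Z, ρ ⟨_, hrN z⟩ = 1)
    (hZ' : ∀ z, z ∉ Z → ∃ n ∈ N, ∃ e, z * ι r * z⁻¹ = n * ι (e * r * e⁻¹) * n⁻¹)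
    (hgen : ∀ L : Subgroup F, (∀ m ∈ M, ι m ∈ L) → (∀ z ∈ Z, z * ι r * z⁻¹ ∈ L) → N ≤ L)
    (h : IsCohenLyndonFamily fun _ : Unit => ι r) : IsCohenLyndonFamily fun _ : Unit => r := by
  classical
  obtain ⟨J, b, _, hb, hbr, hbl, hbc⟩ := h
  rw [← hN] at hbr hbc
  -- The basis elements of `N` that come from `E`, up to conjugation in `N`; the remaining ones are
  -- killed by `ρ`.
  let T : J → Prop := fun j => ∃ n ∈ N, ∃ e, b j = n * ι (e * r * e⁻¹) * n⁻¹
  have hbN : ∀ j, b j ∈ N := fun j => hbr ▸ ⟨FreeGroup.of j, by simp⟩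
  have hTρ : ∀ j, ¬ T j → ρ ⟨b j, hbN j⟩ = 1 := by
    intro j hj
    obtain ⟨z, hz⟩ := hbl j
    have h1 : (⟨b j, hbN j⟩ : N) = ⟨_, hrN z⟩ := Subtype.ext hz
    rw [h1]
    by_contra h2
    obtain ⟨n, hn, e, h3⟩ := hZ' z fun hz' => h2 (hZ z hz')
    exact hj ⟨n, hn, e, hz.trans h3⟩
  have hρconj : ∀ n (hn : n ∈ N) e (h' : n * ι (e * r * e⁻¹) * n⁻¹ ∈ N),
      (ρ ⟨_, h'⟩ : E) = (ρ ⟨n, hn⟩ : E) * (e * r * e⁻¹) * (ρ ⟨n, hn⟩ : E)⁻¹ := by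
    intro n hn e h'
    have h1 : (⟨_, h'⟩ : N) = ⟨n, hn⟩ * ⟨_, hιN _ (hrM e)⟩ * ⟨n, hn⟩⁻¹ := rfl
    rw [h1, map_mul, map_mul, map_inv]
    have h2 := hρι ⟨_, hrM e⟩
    rw [h2]
    rfl
  let E' : FreeGroup J ≃* N := (MonoidHom.ofInjective hb).trans (MulEquiv.subgroupCongr hbr)
  have hE' : ∀ j, E' (FreeGroup.of j) = ⟨b j, hbN j⟩ := fun j =>
    Subtype.ext FreeGroup.lift_apply_of
  -- `κ` keeps the basis elements satisfying `T` and kills the others. It factors through `ρ`, and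
  -- the induced map on `M` is inverse to `θ` below.
  let κ : N →* FreeGroup {j // T j} := (FreeGroup.lift fun j =>
    if h : T j then FreeGroup.of ⟨j, h⟩ else 1).comp E'.symm.toMonoidHom
  have hκ : ∀ j, κ ⟨b j, hbN j⟩ = if h : T j then FreeGroup.of ⟨j, h⟩ else 1 := by
    intro j
    simp [κ, ← hE']
  have hκz : ∀ z ∈ Z, κ ⟨_, hrN z⟩ = 1 := by
    intro z hz
    obtain ⟨j, -, n, hn, hj⟩ := hbc () z
    have h1 : (⟨b j, hbN j⟩ : N) = ⟨n, hn⟩ * ⟨_, hrN z⟩ * ⟨n, hn⟩⁻¹ := Subtype.ext hj.symm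
    have hz' : ρ ⟨_, hrN z⟩ = 1 := hZ z hz
    have hnT : ¬ T j := by
      rintro ⟨n', hn', e, he⟩
      have h2 : ρ ⟨b j, hbN j⟩ = 1 := by
        rw [h1, map_mul, map_mul, hz', mul_one, ← map_mul, mul_inv_cancel, map_one]
      have h3 := hρconj n' hn' e (he ▸ hbN j)
      have h4 : (⟨_, he ▸ hbN j⟩ : N) = ⟨b j, hbN j⟩ := Subtype.ext he.symm
      rw [h4, h2] at h3
      apply hr
      have h5 := (conj_eq_one_iff).1 h3.symm
      exact conj_eq_one_iff.1 h5
    have h2 := hκ j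
    rw [dif_neg hnT, h1, map_mul, map_mul, map_inv, conj_eq_one_iff] at h2
    exact h2
  -- The two homomorphisms are compared on the generating set supplied by `hgen`.
  have hκρ : ∀ n : N, κ n = κ ⟨ι (ρ n), hιN _ (ρ n).2⟩ := by
    let ιN : M →* N :=
      { toFun := fun m => ⟨ι m, hιN _ m.2⟩
        map_one' := by simp
        map_mul' := fun a b => by simp }
    let L : Subgroup N := MonoidHom.eqLocus κ ((κ.comp ιN).comp ρ)
    have hL : N ≤ L.map N.subtype := by
      refine hgen _ (fun m hm => ⟨⟨_, hιN m hm⟩, ?_, rfl⟩) fun z hz => ⟨⟨_, hrN z⟩, ?_, rfl⟩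
      · exact congrArg (fun x => κ (ιN x)) (hρι ⟨m, hm⟩).symm
      · change κ _ = κ (ιN (ρ _))
        rw [hZ z hz, map_one, map_one, hκz z hz]
    intro n
    obtain ⟨n', hn', h1⟩ := hL n.2
    have h2 : n' = n := Subtype.ext h1
    subst h2
    exact hn'
  let θ : FreeGroup {j // T j} →* M := FreeGroup.lift fun j => ρ ⟨b j, hbN j⟩
  have hθκ : ∀ n, θ (κ n) = ρ n := by
    intro n
    have h1 : (θ.comp κ).comp E'.toMonoidHom = ρ.comp E'.toMonoidHom := by
      ext j
      simp only [MonoidHom.comp_apply, MulEquiv.toMonoidHom_eq_coe, MonoidHom.coe_coe, hE', hκ]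
      by_cases hj : T j
      · simp [hj, θ]
      · simp [hj, hTρ j hj]
    have h2 := DFunLike.congr_fun h1 (E'.symm n)
    simpa using h2
  have hθinj : Function.Injective θ := by
    have h1 : ∀ w, κ ⟨ι (θ w), hιN _ (θ w).2⟩ = w := by
      intro w
      have h2 : ∀ w, κ ⟨ι (θ w), hιN _ (θ w).2⟩ = κ (E' (FreeGroup.map Subtype.val w)) := by
        intro w
        rw [hκρ (E' _), ← hθκ]
        have h3 : κ (E' (FreeGroup.map Subtype.val w)) = w := by
          have : (κ.comp E'.toMonoidHom).comp (FreeGroup.map Subtype.val) = MonoidHom.id _ := by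
            ext j
            simp [hE', hκ, j.2]
          exact DFunLike.congr_fun this w
        simp only [h3]
      rw [h2]
      have : (κ.comp E'.toMonoidHom).comp (FreeGroup.map Subtype.val) = MonoidHom.id _ := by
        ext j
        simp [hE', hκ, j.2]
      exact DFunLike.congr_fun this w
    intro w w' hw
    rw [← h1 w, ← h1 w']
    simp only [hw]
  have hθsurj : Function.Surjective θ := fun m =>
    ⟨κ ⟨ι m, hιN m m.2⟩, by rw [hθκ, hρι]⟩
  let b' : {j // T j} → E := fun j => ρ ⟨b j, hbN j⟩
  have hb' : ∀ w, FreeGroup.lift b' w = θ w := by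
    intro w
    have : FreeGroup.lift b' = M.subtype.comp θ := by
      ext j
      simp [b', θ]
    exact DFunLike.congr_fun this w
  refine ⟨{j // T j}, b', fun _ => (), ?_, ?_, ?_, ?_⟩
  · intro w w' hw
    rw [hb', hb'] at hw
    exact hθinj (Subtype.ext hw)
  · rw [← hM]
    ext m
    constructor
    · rintro ⟨w, rfl⟩
      rw [hb']
      exact (θ w).2
    · intro hm
      obtain ⟨w, hw⟩ := hθsurj ⟨m, hm⟩
      exact ⟨w, by rw [hb', hw]⟩
  · rintro ⟨j, n, hn, e, hj⟩
    refine ⟨ρ ⟨n, hn⟩ * e, ?_⟩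
    have h1 := hρconj n hn e (hj ▸ hbN j)
    have h2 : (⟨_, hj ▸ hbN j⟩ : N) = ⟨b j, hbN j⟩ := Subtype.ext hj.symm
    rw [h2] at h1
    rw [show b' ⟨j, _⟩ = (ρ ⟨b j, hbN j⟩ : E) from rfl, h1]
    group
  · rintro ⟨⟩ e
    obtain ⟨j, -, n, hn, hj⟩ := hbc () (ι e)
    have hj' : b j = n * ι (e * r * e⁻¹) * n⁻¹ := by
      rw [← hj]; simp only [map_mul, map_inv]
    refine ⟨⟨j, n, hn, e, hj'⟩, rfl, ρ ⟨n, hn⟩, hM ▸ (ρ ⟨n, hn⟩).2, ?_⟩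
    have h1 := hρconj n hn e (hj' ▸ hbN j)
    have h2 : (⟨_, hj' ▸ hbN j⟩ : N) = ⟨b j, hbN j⟩ := Subtype.ext hj'.symm
    rw [h2] at h1
    exact h1.symm

namespace StableLetter

open HNNExtension

variable {E F Y H : Type} [Group E] [Group F] [Group H] (D : StableLetter E F Y) {p : E →* H}

/-- If the base relator of an HNN extension is a Cohen-Lyndon family in the total group, then so it
is in the base group. -/
theorem isCohenLyndonFamily_of_ι (hα : Function.Injective (FreeGroup.lift (p ∘ D.a)))
    (hβ : Function.Injective (FreeGroup.lift (p ∘ D.b))) (hp : Function.Surjective p)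
    (hknown : ∀ y, y ∈ D.known) {r : E} (hr : r ≠ 1)
    (hker : p.ker = Subgroup.normalClosure (Set.range fun _ : Unit => r))
    (h : IsCohenLyndonFamily fun _ : Unit => D.ι r) : IsCohenLyndonFamily fun _ : Unit => r := by
  classical
  obtain ⟨S⟩ := D.nonempty_frame hα hβ hp
  obtain ⟨N, hN⟩ : ∃ N, N = (D.proj hα hβ).ker := ⟨_, rfl⟩
  have hNn : N.Normal := hN ▸ MonoidHom.normal_ker _
  have hrker : ∀ e, e * r * e⁻¹ ∈ p.ker := fun e => by
    have : r ∈ p.ker := hker ▸ Subgroup.subset_normalClosure ⟨(), rfl⟩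
    exact (MonoidHom.normal_ker p).conj_mem _ this e
  have hιN : ∀ m ∈ p.ker, D.ι m ∈ N := fun m hm => by
    have : p m = 1 := hm
    simp [hN, MonoidHom.mem_ker, this]
  have hrN : ∀ z, z * D.ι r * z⁻¹ ∈ N := fun z =>
    hNn.conj_mem _ (hιN r (by simpa using hrker 1)) z
  have hσm : ∀ g, ∀ m ∈ p.ker, S.σ g * D.ι m * (S.σ g)⁻¹ ∈ N := fun g m hm =>
    hNn.conj_mem _ (hιN m hm) _
  have hgen : ∀ L : Subgroup F, (∀ g e, S.σ g * D.ι (e * r * e⁻¹) * (S.σ g)⁻¹ ∈ L) → N ≤ L := by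
    intro L hL
    rw [hN]
    refine S.ker_le _ (fun g m hm => ?_) fun g y => by
      rw [D.relator_of_mem_known (hknown y), mul_one, mul_inv_cancel]; exact one_mem _
    rw [hker] at hm
    refine Subgroup.normalClosure_range_induction
      (fun m => S.σ g * D.ι m * (S.σ g)⁻¹ ∈ L) (fun _ e => hL g e) ?_ ?_ ?_ hm
    · rw [map_one, mul_one, mul_inv_cancel]
      exact one_mem _
    · intro a b ha hb
      have := mul_mem ha hb
      rw [map_mul]
      convert this using 1
      group
    · intro a ha
      have := inv_mem ha
      rw [map_inv]
      convert this using 1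
      group
  have hNcl : N = Subgroup.normalClosure (Set.range fun _ : Unit => D.ι r) := by
    have hmem : D.ι r ∈ Subgroup.normalClosure (Set.range fun _ : Unit => D.ι r) :=
      Subgroup.subset_normalClosure ⟨(), rfl⟩
    apply le_antisymm
    · refine hgen _ fun g e => ?_
      have := Subgroup.normalClosure_normal.conj_mem _ hmem (S.σ g * D.ι e)
      convert this using 1
      simp only [map_mul, map_inv]
      group
    · apply Subgroup.normalClosure_le_normal
      rintro _ ⟨_, rfl⟩
      simpa using hrN 1
  -- the retraction onto the kernel of `p`
  let f : D.Quot hα hβ → p.ker →* p.ker := fun g =>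
    if D.proj hα hβ (S.σ g) = 1 then MonoidHom.id _ else 1
  have hf : ∀ g h, f (g * of h) = f g := fun g h => by simp only [f, S.σ_mul_of]
  obtain ⟨Φ, hΦ1, hΦ2, hΦ3, -⟩ := S.exists_wreathLift f hf (fun _ _ => 1) fun _ _ _ => rfl
  let ρ : N →* p.ker :=
    { toFun := fun n => (Φ n).fn 1
      map_one' := by simp
      map_mul' := fun n n' => by
        have : D.proj hα hβ n = 1 := hN.le n.2
        simp [hΦ1, this] }
  have hσ1 : ∀ g, D.proj hα hβ (S.σ g) = 1 → S.σ g = 1 := fun g hg => by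
    rw [← S.σ_proj_σ, hg, S.σ_one]
  have hρσ : ∀ g, D.proj hα hβ (S.σ g) ≠ 1 → ∀ m (hm : m ∈ p.ker), ρ ⟨_, hσm g m hm⟩ = 1 := by
    intro g hg m hm
    change (Φ (S.σ g * D.ι m * (S.σ g)⁻¹)).fn 1 = 1
    have h1 : p m = 1 := hm
    simp only [RightWreath.mul_fn, RightWreath.inv_fn, map_mul, map_inv, hΦ1, hΦ2, hΦ3, proj_ι, h1,
      RightWreath.mul_pt]
    simp [f, S.σ_proj_σ, hg, hΦ2]
  have hz : ∀ z, z * (S.lam (D.proj hα hβ z))⁻¹ ∈ N := fun z => by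
    simp [hN, MonoidHom.mem_ker, S.proj_lam]
  have hz' : ∀ z g, z * D.ι r * z⁻¹ = (z * (S.lam g)⁻¹) * (S.σ g * D.ι (S.l (S.c g) * r *
        (S.l (S.c g))⁻¹) * (S.σ g)⁻¹) * (z * (S.lam g)⁻¹)⁻¹ := fun z g => by
    rw [Frame.lam]; simp only [map_mul, map_inv]; group
  refine IsCohenLyndonFamily.of_retraction D.ι hr hker hNcl hιN hrker hrN ρ ?_
    {z | D.proj hα hβ (S.σ (D.proj hα hβ z)) ≠ 1} ?_ ?_ ?_ h
  · intro m
    change (Φ (D.ι m)).fn 1 = m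
    rw [hΦ3, S.c_one, S.schreier_one_left]
    simp [f, S.σ_one]
  · intro z h1
    set g := D.proj hα hβ z with hg
    have h3 : (⟨_, hrN z⟩ : N) = ⟨_, hz z⟩ * ⟨_, hσm g _ (hrker (S.l (S.c g)))⟩ * ⟨_, hz z⟩⁻¹ :=
      Subtype.ext (hz' z g)
    rw [h3, map_mul, map_mul, hρσ g h1 _ (hrker _), mul_one, ← map_mul, mul_inv_cancel, map_one]
  · intro z h1
    have h1 := not_not.1 h1
    refine ⟨_, hz z, S.l (S.c (D.proj hα hβ z)), ?_⟩
    have h2 := hz' z (D.proj hα hβ z)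
    rw [hσ1 _ h1] at h2
    simpa only [one_mul, inv_one, mul_one] using h2
  · intro L h1 h2
    refine hgen L fun g e => ?_
    by_cases h3 : D.proj hα hβ (S.σ g) = 1
    · rw [hσ1 g h3, one_mul, inv_one, mul_one]
      exact h1 _ (hrker e)
    · have h4 := h2 (S.σ g * D.ι e) (by simpa [S.σ_mul_of, S.σ_proj_σ] using h3)
      convert h4 using 1
      simp only [map_mul, map_inv]
      group

end StableLetter

/-! ### Words in free groups -/

namespace FreeGroup

variable {X : Type*}

theorem mem_closure_of_image_iff {V : Set X} {w : FreeGroup X} :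
    w ∈ Subgroup.closure (of '' V) ↔ ∃ e : FreeGroup V, map Subtype.val e = w := by
  have h := range_map (f := (Subtype.val : V → X))
  rw [Subtype.range_coe] at h
  rw [← h]
  rfl

theorem mk_mem_closure {V : Set X} {L : List (X × Bool)} (h : ∀ l ∈ L, l.1 ∈ V) :
    mk L ∈ Subgroup.closure (of '' V) := by
  have h1 : mk L = (L.map fun x => cond x.2 (of x.1) (of x.1)⁻¹).prod := by
    rw [← lift_mk, lift_of_apply]
  rw [h1]
  refine Subgroup.list_prod_mem _ fun y hy => ?_
  obtain ⟨⟨x, b⟩, hx, rfl⟩ := List.mem_map.1 hy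
  have := Subgroup.subset_closure (Set.mem_image_of_mem of (h _ hx))
  cases b
  · exact inv_mem this
  · exact this

theorem exists_mk_of_mem_closure {V : Set X} {w : FreeGroup X}
    (h : w ∈ Subgroup.closure (of '' V)) : ∃ L, mk L = w ∧ ∀ l ∈ L, l.1 ∈ V := by
  obtain ⟨e, rfl⟩ := mem_closure_of_image_iff.1 h
  obtain ⟨L, rfl⟩ := Quot.exists_rep e
  refine ⟨L.map fun x => (x.1, x.2), (map.mk).symm, fun l hl => ?_⟩
  obtain ⟨x, -, rfl⟩ := List.mem_map.1 hl
  exact x.1.2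

theorem exists_isCyclicallyReduced (L : List (X × Bool)) : ∃ (L' : List (X × Bool)) (g : FreeGroup X),
    mk L = g * mk L' * g⁻¹ ∧ IsCyclicallyReduced L' ∧ L'.Sublist L := by
  classical
  refine ⟨reduceCyclically (reduce L), mk (reduceCyclically.conjugator (reduce L)), ?_, ?_, ?_⟩
  · have h := reduceCyclically.conj_conjugator_reduceCyclically (reduce L)
    rw [← reduce.self, inv_mk, mul_mk, mul_mk, h]
  · exact reduceCyclically.isCyclicallyReduced (isReduced_iff_reduce_eq.2 reduce.idem)
  · refine List.Sublist.trans ?_ reduce.red.sublist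
    refine List.IsInfix.sublist ⟨_, _, reduceCyclically.conj_conjugator_reduceCyclically _⟩

/-- A conjugate of a cyclically reduced word involves every letter of the word. -/
theorem IsCyclicallyReduced.conj_notMem_closure {L : List (X × Bool)} (hL : IsCyclicallyReduced L)
    {l : X × Bool} (hl : l ∈ L) {V : Set X} (hV : l.1 ∉ V) (g : FreeGroup X) :
    g * mk L * g⁻¹ ∉ Subgroup.closure (of '' V) := by
  classical
  intro h
  let cnt : List (X × Bool) → ℕ := fun M => (M.map Prod.fst).count l.1
  have hcnt : ∀ M M' : List (X × Bool), M.Sublist M' → cnt M ≤ cnt M' := fun M M' hM =>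
    (hM.map _).count_le _
  have hpos : 1 ≤ cnt L := List.count_pos_iff.2 (List.mem_map_of_mem hl)
  -- The `n`-th power of `L` is already reduced and contains the chosen letter at least `n` times,
  -- whereas conjugating back a word on `V` can supply it at most `2 * g.toWord.length` times.
  let n := 2 * g.toWord.length + 1
  obtain ⟨M, hM, hMV⟩ := exists_mk_of_mem_closure (pow_mem h n)
  have hM0 : cnt M = 0 := by
    rw [List.count_eq_zero]
    intro hmem
    obtain ⟨m, hm, hm'⟩ := List.mem_map.1 hmem
    exact hV (hm' ▸ hMV m hm)
  have h1 : mk (List.replicate n L).flatten = mk (invRev g.toWord ++ M ++ g.toWord) := by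
    rw [← mul_mk, ← mul_mk, hM, ← inv_mk, mk_toWord, conj_pow, ← pow_mk]
    group
  have h2 : (List.replicate n L).flatten.Sublist (invRev g.toWord ++ M ++ g.toWord) := by
    have h3 := reduce.sound h1
    rw [(hL.flatten_replicate n).isReduced.reduce_eq] at h3
    rw [h3]
    exact reduce.red.sublist
  have h3 := hcnt _ _ h2
  have h4 : cnt (List.replicate n L).flatten = n * cnt L := by
    simp [cnt, List.map_flatten, List.count_flatten]
  have h5 : cnt (invRev g.toWord ++ M ++ g.toWord) ≤ 2 * g.toWord.length := by
    have h6 : ∀ N : List (X × Bool), cnt N ≤ N.length := fun N => by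
      simpa using List.count_le_length (a := l.1) (l := N.map Prod.fst)
    have h7 := h6 (invRev g.toWord)
    have h8 := h6 g.toWord
    rw [invRev_length] at h7
    simp only [cnt, List.map_append, List.count_append] at h7 h8 hM0 ⊢
    omega
  have h6 : n * 1 ≤ n * cnt L := Nat.mul_le_mul_left _ hpos
  omega

/-- A word all of whose letters lie in `S` comes from a word on `S`. -/
theorem exists_word_subtype {S : Set X} {L : List (X × Bool)} (h : ∀ l ∈ L, l.1 ∈ S) :
    ∃ L' : List (S × Bool), L'.map (fun x => (x.1.1, x.2)) = L := by
  induction L with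
  | nil => exact ⟨[], rfl⟩
  | cons a L ih =>
    obtain ⟨L', hL'⟩ := ih fun l hl => h l (List.mem_cons_of_mem _ hl)
    exact ⟨(⟨a.1, h a List.mem_cons_self⟩, a.2) :: L', by simp [hL']⟩

theorem isCyclicallyReduced_map_iff {Z : Type*} {f : Z → X} (hf : Function.Injective f)
    {L : List (Z × Bool)} : IsCyclicallyReduced (L.map fun x => (f x.1, x.2)) ↔
      IsCyclicallyReduced L := by
  rw [isCyclicallyReduced_iff, isCyclicallyReduced_iff]
  refine and_congr ?_ ?_
  · rw [IsReduced, List.isChain_map]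
    simp only [hf.eq_iff, IsReduced]
  · simp only [List.getLast?_map, List.head?_map, Option.mem_def, Option.map_eq_some_iff]
    constructor
    · intro h a ha b hb hab
      exact h _ ⟨a, ha, rfl⟩ _ ⟨b, hb, rfl⟩ (by simp [hab])
    · rintro h _ ⟨a, ha, rfl⟩ _ ⟨b, hb, rfl⟩ hab
      exact h a ha b hb (hf hab)

/-- The endomorphism multiplying each generator by a power of the stable letter `t`, and raising `t`
to a power. -/
noncomputable def twist [DecidableEq X] (t : X) (w : X → ℤ) : FreeGroup X →* FreeGroup X :=
  lift fun x => if x = t then of t ^ w t else of x * of t ^ w x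

/-- The homomorphism from words on `X × ℤ` conjugating the letter `(x, k)` by `t ^ k`. -/
def level (t : X) : FreeGroup (X × ℤ) →* FreeGroup X :=
  lift fun p => of t ^ p.2 * of p.1 * (of t ^ p.2)⁻¹

@[simp] theorem level_of (t : X) (p : X × ℤ) :
    level t (of p) = of t ^ p.2 * of p.1 * (of t ^ p.2)⁻¹ := lift_apply_of

/-- The weighted exponent sum. -/
def expSum (w : X → ℤ) : FreeGroup X →* Multiplicative ℤ := lift fun x => Multiplicative.ofAdd (w x)

@[simp] theorem expSum_of (w : X → ℤ) (x : X) : expSum w (of x) = Multiplicative.ofAdd (w x) :=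
  lift_apply_of

theorem level_shift (t : X) (k : ℤ) (L : List ((X × ℤ) × Bool)) :
    level t (mk (L.map fun l => ((l.1.1, l.1.2 + k), l.2))) =
      of t ^ k * level t (mk L) * (of t ^ k)⁻¹ := by
  have h1 : (level t).comp (map fun p : X × ℤ => (p.1, p.2 + k)) =
      (MulAut.conj (of t ^ k)).toMonoidHom.comp (level t) := by
    ext p
    change level t (map (fun p : X × ℤ => (p.1, p.2 + k)) (of p)) = MulAut.conj (of t ^ k) (level t (of p))
    rw [MulAut.conj_apply, map.of, level_of, level_of, add_comm p.2 k, zpow_add]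
    group
  have h2 := DFunLike.congr_fun h1 (mk L)
  change level t (map (fun p : X × ℤ => (p.1, p.2 + k)) (mk L)) = MulAut.conj (of t ^ k) (level t (mk L)) at h2
  rwa [map.mk, MulAut.conj_apply] at h2

/-- Rewriting the image of a word under `twist` as a word on conjugates by powers of the stable
letter. -/
theorem exists_level_word [DecidableEq X] (t : X) (w : X → ℤ) (L : List (X × Bool)) :
    ∃ L' : List ((X × ℤ) × Bool),
      twist t w (mk L) = level t (mk L') * of t ^ (expSum w (mk L)).toAdd ∧
      L'.length ≤ (L.filter fun l => l.1 ≠ t).length ∧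
      ∀ l ∈ L', l.1.1 ≠ t ∧ ∃ b, (l.1.1, b) ∈ L := by
  induction L with
  | nil => exact ⟨[], by simp [← one_eq_mk], by simp, by simp⟩
  | cons a L ih =>
    obtain ⟨L', h1, h2, h3⟩ := ih
    have hcons : mk (a :: L) = mk [a] * mk L := by rw [mul_mk]; rfl
    have key : ∀ (M : List ((X × ℤ) × Bool)) (k : ℤ), twist t w (mk [a]) =
        level t (mk M) * of t ^ k → (expSum w (mk [a])).toAdd = k →
        twist t w (mk (a :: L)) = level t (mk (M ++ L'.map fun l => ((l.1.1, l.1.2 + k), l.2))) *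
          of t ^ (expSum w (mk (a :: L))).toAdd := by
      intro M k hM hk
      rw [hcons, _root_.map_mul, _root_.map_mul, toAdd_mul, hk, h1, hM, ← mul_mk, _root_.map_mul, level_shift, zpow_add]
      group
    have hmk : mk [a] = if a.2 then of a.1 else (of a.1)⁻¹ := by
      obtain ⟨x, b⟩ := a
      cases b <;> rfl
    have hshift : ∀ (M : List ((X × ℤ) × Bool)) (k : ℤ),
        (∀ l ∈ M, l.1.1 ≠ t ∧ l.1.1 = a.1) →
        ∀ l ∈ M ++ L'.map fun l => ((l.1.1, l.1.2 + k), l.2),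
          l.1.1 ≠ t ∧ ∃ b, (l.1.1, b) ∈ a :: L := by
      intro M k hM l hl
      rcases List.mem_append.1 hl with hl | hl
      · exact ⟨(hM l hl).1, a.2, by rw [(hM l hl).2]; exact List.mem_cons_self⟩
      · obtain ⟨m, hm, rfl⟩ := List.mem_map.1 hl
        obtain ⟨h4, b, h5⟩ := h3 m hm
        exact ⟨h4, b, List.mem_cons_of_mem _ h5⟩
    by_cases hat : a.1 = t
    -- A letter `t` leaves no letter behind; it only shifts the levels of what follows.
    · refine ⟨_, key [] (if a.2 then w t else -w t) ?_ ?_, ?_, hshift [] _ (by simp)⟩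
      · rw [hmk]
        split_ifs <;> simp [twist, hat, ← one_eq_mk]
      · rw [hmk]
        split_ifs <;> simp [hat]
      · simpa [hat] using h2
    · by_cases hb : a.2
      · refine ⟨_, key [((a.1, 0), true)] (w a.1) ?_ ?_, ?_, hshift _ _ (by simp [hat])⟩
        · rw [hmk, if_pos hb]
          change twist t w (of a.1) = level t (of (a.1, 0)) * _
          simp [twist, hat]
        · simp [hmk, hb]
        · simpa [hat] using h2
      -- With `k = w x`, one has `(x tᵏ)⁻¹ = (t⁻ᵏ x⁻¹ tᵏ) t⁻ᵏ`, so an inverse letter starts at level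
      -- `-k` rather than 0.
      · refine ⟨_, key [((a.1, -w a.1), false)] (-w a.1) ?_ ?_, ?_, hshift _ _ (by simp [hat])⟩
        · rw [hmk, if_neg hb]
          change twist t w (of a.1)⁻¹ = level t (of (a.1, -w a.1))⁻¹ * _
          simp [twist, hat, mul_assoc]
        · simp [hmk, hb]
        · simpa [hat] using h2

/-- A word of exponent sum zero is conjugate to a cyclically reduced word on conjugates by powers of
the stable letter. -/
theorem exists_level_cyclicallyReduced [DecidableEq X] (t : X) (w : X → ℤ) (L : List (X × Bool))
    (h0 : expSum w (mk L) = 1) :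
    ∃ (L' : List ((X × ℤ) × Bool)) (g : FreeGroup X), IsCyclicallyReduced L' ∧
      twist t w (mk L) = g * level t (mk L') * g⁻¹ ∧
      L'.length ≤ (L.filter fun l => l.1 ≠ t).length ∧
      ∀ l ∈ L', l.1.1 ≠ t ∧ ∃ b, (l.1.1, b) ∈ L := by
  obtain ⟨L₁, h1, h2, h3⟩ := exists_level_word t w L
  obtain ⟨L₂, g, h4, h5, h6⟩ := exists_isCyclicallyReduced L₁
  refine ⟨L₂, level t g, h5, ?_, h6.length_le.trans h2, fun l hl => h3 l (h6.subset hl)⟩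
  rw [h1, h0, toAdd_one, zpow_zero, mul_one, h4, _root_.map_mul, _root_.map_mul, _root_.map_inv]

theorem lift_unit_injective {G : Type*} [Group G] {g : G} (hg : ∀ n : ℤ, g ^ n = 1 → n = 0) :
    Function.Injective (lift fun _ : Unit => g) := by
  rw [injective_iff_map_eq_one]
  intro w hw
  obtain ⟨n, rfl⟩ : ∃ n : ℤ, w = of () ^ n := by
    have h1 : w ∈ Subgroup.closure (Set.range (of : Unit → FreeGroup Unit)) := by
      rw [closure_range_of]; trivial
    rw [Set.range_unique, Subgroup.mem_closure_singleton] at h1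
    obtain ⟨n, hn⟩ := h1
    exact ⟨n, hn.symm⟩
  rw [map_zpow, lift_apply_of] at hw
  rw [hg n hw, zpow_zero]

end FreeGroup

/-! ### Magnus rewriting -/

section Magnus

open FreeGroup

variable {X : Type}

/-- A set of indices of conjugates of generators by powers of a stable letter `t`, consisting of a
nonempty interval of levels for each generator other than `t`. -/
structure IsLevelSet (t : X) (S : Set (X × ℤ)) : Prop where
  ne : ∀ p ∈ S, p.1 ≠ t
  exists_mem : ∀ x, x ≠ t → ∃ k, (x, k) ∈ S
  convex : ∀ x i j k, (x, i) ∈ S → (x, j) ∈ S → i ≤ k → k ≤ j → (x, k) ∈ S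

/-- The elements of a level set that remain in it when shifted upwards. -/
abbrev LowerPart (S : Set (X × ℤ)) : Type := {p : S // ((p.1.1, p.1.2 + 1) : X × ℤ) ∈ S}

/-- The embedding of words on a level set. -/
def levelι (t : X) (S : Set (X × ℤ)) : FreeGroup S →* FreeGroup X :=
  (level t).comp (FreeGroup.map Subtype.val)

theorem levelι_of (t : X) (S : Set (X × ℤ)) (p : S) :
    levelι t S (of p) = of t ^ p.1.2 * of p.1.1 * (of t ^ p.1.2)⁻¹ := by
  simp [levelι]

/-- Convexity keeps every intermediate level in `S`, so the one-step relations can be composed. -/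
theorem IsLevelSet.conj_eq {t : X} {S : Set (X × ℤ)} (hS : IsLevelSet t S) {W : Type} [Group W]
    (ε : FreeGroup S →* W) (w : W) (h : ∀ p : LowerPart S,
      w * ε (of p.1) * w⁻¹ = ε (of ⟨(p.1.1.1, p.1.1.2 + 1), p.2⟩))
    {x : X} {i j : ℤ} (hi : (x, i) ∈ S) (hj : (x, j) ∈ S) :
    w ^ (j - i) * ε (of ⟨(x, i), hi⟩) * (w ^ (j - i))⁻¹ = ε (of ⟨(x, j), hj⟩) := by
  have key : ∀ (i j : ℤ) (hij : i ≤ j) (hi : (x, i) ∈ S) (hj : (x, j) ∈ S),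
      w ^ (j - i) * ε (of ⟨(x, i), hi⟩) * (w ^ (j - i))⁻¹ = ε (of ⟨(x, j), hj⟩) := by
    intro i j hij hi
    induction j, hij using Int.leInduction with
    | base => intro hj; simp
    | succ k hk ih =>
      intro hj
      have hk' : (x, k) ∈ S := hS.convex x i (k + 1) k hi hj hk (by omega)
      rw [← h ⟨⟨(x, k), hk'⟩, hj⟩, ← ih hk', show k + 1 - i = 1 + (k - i) by ring, zpow_add,
        zpow_one]
      group
  rcases le_total i j with hij | hij
  · exact key i j hij hi hj
  · rw [← key j i hij hj hi, ← neg_sub i j, zpow_neg]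
    group

/-- The free group on `X` as an HNN extension of the free group on a level set, with additional
pairs of elements of the base distinguished. -/
noncomputable def magnusLetter [DecidableEq X] (t : X) {S : Set (X × ℤ)} (hS : IsLevelSet t S) {Z : Type}
    (a' b' : Z → FreeGroup S) : StableLetter (FreeGroup S) (FreeGroup X) (LowerPart S ⊕ Z) where
  ι := levelι t S
  s := of t
  a := Sum.elim (fun p => of p.1) a'
  b := Sum.elim (fun p => of ⟨(p.1.1.1, p.1.1.2 + 1), p.2⟩) b'
  known := Set.range Sum.inl
  conj_a := by
    rintro _ ⟨p, rfl⟩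
    simp only [Sum.elim_inl, levelι_of]
    rw [add_comm, zpow_add, zpow_one]
    group
  exists_lift := by
    intro W _ ε w h
    choose k hk using hS.exists_mem
    -- A generator is recovered from any one of its levels; `conj_eq` shows that the other levels
    -- agree with this choice.
    refine ⟨FreeGroup.lift fun x => if hx : x = t then w else
      (w ^ k x hx)⁻¹ * ε (of ⟨(x, k x hx), hk x hx⟩) * w ^ k x hx, fun e => ?_, by simp⟩
    rw [← MonoidHom.comp_apply]
    congr 1
    ext ⟨⟨x, i⟩, hp⟩
    have hx : x ≠ t := hS.ne _ hp
    simp only [MonoidHom.comp_apply, levelι_of, _root_.map_mul, _root_.map_inv, map_zpow,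
      lift_apply_of, dif_pos, dif_neg hx]
    rw [← hS.conj_eq ε w (fun p => h _ ⟨p, rfl⟩) (hk x hx) hp, zpow_sub]
    group
  closure_eq_top := by
    rw [eq_top_iff, ← closure_range_of, Subgroup.closure_le]
    rintro _ ⟨x, rfl⟩
    have ht : of t ∈ Subgroup.closure (Set.range (levelι t S) ∪ {of t}) :=
      Subgroup.subset_closure (Or.inr rfl)
    by_cases hx : x = t
    · rw [hx]; exact ht
    · obtain ⟨k, hk⟩ := hS.exists_mem x hx
      have h1 : levelι t S (of ⟨(x, k), hk⟩) ∈
          Subgroup.closure (Set.range (levelι t S) ∪ {of t}) :=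
        Subgroup.subset_closure (Or.inl ⟨_, rfl⟩)
      have h2 : of x = (of t ^ k)⁻¹ * levelι t S (of ⟨(x, k), hk⟩) * of t ^ k := by
        rw [levelι_of]; group
      rw [SetLike.mem_coe, h2]
      exact mul_mem (mul_mem (inv_mem (zpow_mem ht _)) h1) (zpow_mem ht _)

/-- Every word on the levels in `S` comes from the free group on `S`. -/
theorem exists_levelι_eq (t : X) {S : Set (X × ℤ)} {L : List ((X × ℤ) × Bool)}
    (h : ∀ l ∈ L, l.1 ∈ S) : ∃ L' : List (S × Bool), L'.map (fun x => (x.1.1, x.2)) = L ∧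
      levelι t S (mk L') = level t (mk L) := by
  obtain ⟨L', rfl⟩ := exists_word_subtype h
  exact ⟨L', rfl, by rw [levelι, MonoidHom.comp_apply, FreeGroup.map.mk]⟩

/-- The Freiheitssatz for an element of a free group: any set of generators, none of whose words is
conjugate to the element, freely generates a subgroup modulo the element. -/
def HasFreiheitssatz {X : Type} (r : FreeGroup X) : Prop :=
  ∀ V : Set X, (∀ g, g * r * g⁻¹ ∉ Subgroup.closure (of '' V)) →
    ∀ w ∈ Subgroup.closure (of '' V),
      w ∈ Subgroup.normalClosure (Set.range fun _ : Unit => r) → w = 1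

/-- The form in which the Freiheitssatz supplies the freeness of associated subgroups. -/
theorem HasFreiheitssatz.lift_injective {X Y H : Type} [Group H] {r : FreeGroup X}
    (hr : HasFreiheitssatz r) {p : FreeGroup X →* H}
    (hp : p.ker = Subgroup.normalClosure (Set.range fun _ : Unit => r)) {f : Y → X}
    (hf : Function.Injective f)
    (h : ∀ g, g * r * g⁻¹ ∉ Subgroup.closure (of '' Set.range f)) :
    Function.Injective (FreeGroup.lift fun y => p (of (f y))) := by
  have h1 : FreeGroup.lift (fun y => p (of (f y))) = p.comp (FreeGroup.map f) := by
    ext y; simp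
  rw [h1, injective_iff_map_eq_one]
  intro w hw
  apply map_injective hf
  rw [_root_.map_one]
  refine hr _ h _ ?_ (hp ▸ hw)
  rw [← range_map]
  exact ⟨w, rfl⟩

theorem Subgroup.normalClosure_conj {G : Type*} [Group G] (g r : G) :
    Subgroup.normalClosure (Set.range fun _ : Unit => g * r * g⁻¹) =
      Subgroup.normalClosure (Set.range fun _ : Unit => r) := by
  have h : ∀ g r : G, Subgroup.normalClosure (Set.range fun _ : Unit => g * r * g⁻¹) ≤
      Subgroup.normalClosure (Set.range fun _ : Unit => r) := by
    intro g r
    apply Subgroup.normalClosure_le_normal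
    rintro _ ⟨_, rfl⟩
    have : r ∈ Subgroup.normalClosure (Set.range fun _ : Unit => r) :=
      Subgroup.subset_normalClosure ⟨(), rfl⟩
    exact Subgroup.normalClosure_normal.conj_mem _ this _
  refine le_antisymm (h g r) ?_
  have h1 := h g⁻¹ (g * r * g⁻¹)
  have h2 : g⁻¹ * (g * r * g⁻¹) * g⁻¹⁻¹ = r := by group
  rwa [h2] at h1

theorem HasFreiheitssatz.conj {X : Type} {r : FreeGroup X} (hr : HasFreiheitssatz r)
    (g : FreeGroup X) : HasFreiheitssatz (g * r * g⁻¹) := by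
  intro V hV w hw hwr
  rw [Subgroup.normalClosure_conj] at hwr
  refine hr V (fun k hk => hV (k * g⁻¹) ?_) w hw hwr
  convert hk using 1
  group

theorem IsCohenLyndonFamily.reindex {F K K' : Type} [Group F] {rel : K → F} {rel' : K' → F}
    (h : IsCohenLyndonFamily rel) (e : K ≃ K') (he : ∀ k, rel' (e k) = rel k) :
    IsCohenLyndonFamily rel' := by
  have hrange : Set.range rel' = Set.range rel := by
    have : rel = rel' ∘ e := funext fun k => (he k).symm
    rw [this, e.surjective.range_comp]
  obtain ⟨I, b, l, h1, h2, h3, h4⟩ := h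
  refine ⟨I, b, fun i => e (l i), h1, by rw [h2, hrange], fun i => by rw [he]; exact h3 i, ?_⟩
  intro k f
  obtain ⟨i, hi, n, hn, hb⟩ := h4 (e.symm k) f
  refine ⟨i, by simp only [hi, e.apply_symm_apply], n, hrange ▸ hn, ?_⟩
  rw [← hb, ← he, e.apply_symm_apply]

theorem IsCohenLyndonFamily.conj {F : Type} [Group F] {r : F}
    (h : IsCohenLyndonFamily fun _ : Unit => r) (g : F) :
    IsCohenLyndonFamily fun _ : Unit => g * r * g⁻¹ := by
  obtain ⟨I, b, l, h1, h2, h3, h4⟩ := h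
  refine ⟨I, b, l, h1, by rw [h2, Subgroup.normalClosure_conj], fun i => ?_, fun k f => ?_⟩
  · obtain ⟨f, hf⟩ := h3 i
    exact ⟨f * g⁻¹, by rw [hf]; group⟩
  · obtain ⟨i, hi, n, hn, hb⟩ := h4 k (f * g)
    refine ⟨i, hi, n, by rwa [Subgroup.normalClosure_conj], ?_⟩
    rw [← hb]
    group

theorem magnus_lower_range {S : Set (X × ℤ)} : Set.range (fun p : LowerPart S => p.1) =
    {p : S | ((p.1.1, p.1.2 + 1) : X × ℤ) ∈ S} := by
  ext p
  simp

theorem magnus_upper_range {S : Set (X × ℤ)} :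
    Set.range (fun p : LowerPart S => (⟨(p.1.1.1, p.1.1.2 + 1), p.2⟩ : S)) =
      {p : S | ((p.1.1, p.1.2 - 1) : X × ℤ) ∈ S} := by
  ext ⟨⟨x, k⟩, hp⟩
  constructor
  · rintro ⟨⟨⟨⟨y, j⟩, hq⟩, hq'⟩, h⟩
    simp only [Subtype.mk.injEq, Prod.mk.injEq] at h
    obtain ⟨rfl, rfl⟩ := h
    simpa using hq
  · intro h
    exact ⟨⟨⟨(x, k - 1), h⟩, by simpa using hp⟩, by simp⟩

/-- Magnus rewriting: a relator on a level set, no conjugate of which avoids the top level or the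
bottom level, gives an HNN extension. -/
theorem IsLevelSet.magnus [DecidableEq X] {t : X} {S : Set (X × ℤ)} (hS : IsLevelSet t S) {r : FreeGroup S}
    (hr : HasFreiheitssatz r)
    (hl : ∀ g, g * r * g⁻¹ ∉
      Subgroup.closure (of '' {p : S | ((p.1.1, p.1.2 + 1) : X × ℤ) ∈ S}))
    (hu : ∀ g, g * r * g⁻¹ ∉
      Subgroup.closure (of '' {p : S | ((p.1.1, p.1.2 - 1) : X × ℤ) ∈ S})) :
    (∀ e, levelι t S e ∈ Subgroup.normalClosure (Set.range fun _ : Unit => levelι t S r) →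
      e ∈ Subgroup.normalClosure (Set.range fun _ : Unit => r)) ∧
    ((IsCohenLyndonFamily fun _ : Unit => r) →
      IsCohenLyndonFamily fun _ : Unit => levelι t S r) ∧
    (r ≠ 1 → (IsCohenLyndonFamily fun _ : Unit => levelι t S r) →
      IsCohenLyndonFamily fun _ : Unit => r) := by
  let D := magnusLetter t hS (Z := Empty) (fun z => z.elim) (fun z => z.elim)
  let p := QuotientGroup.mk' (Subgroup.normalClosure (Set.range fun _ : Unit => r))
  have hp : p.ker = Subgroup.normalClosure (Set.range fun _ : Unit => r) :=
    QuotientGroup.ker_mk' _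
  have hps : Function.Surjective p := QuotientGroup.mk'_surjective _
  have haa : ∀ {f : LowerPart S → S} {g : LowerPart S ⊕ Empty → FreeGroup S},
      (∀ p, g (Sum.inl p) = of (f p)) → Function.Injective f →
      (∀ g, g * r * g⁻¹ ∉ Subgroup.closure (of '' Set.range f)) →
      Function.Injective (FreeGroup.lift (p ∘ g)) := by
    intro f g hfg hf h
    have h1 := hr.lift_injective hp hf h
    have h2 : FreeGroup.lift (p ∘ g) = (FreeGroup.lift fun y => p (of (f y))).comp
        (FreeGroup.freeGroupCongr (Equiv.sumEmpty (LowerPart S) Empty)).toMonoidHom := by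
      ext (y | y)
      · simp [hfg]
      · exact y.elim
    rw [h2]
    exact h1.comp (MulEquiv.injective _)
  have hα : Function.Injective (FreeGroup.lift (p ∘ D.a)) := by
    refine haa (f := fun p => p.1) (fun _ => rfl) Subtype.val_injective ?_
    rwa [magnus_lower_range]
  have hβ : Function.Injective (FreeGroup.lift (p ∘ D.b)) := by
    refine haa (f := fun p => ⟨(p.1.1.1, p.1.1.2 + 1), p.2⟩) (fun _ => rfl) ?_ ?_
    · rintro ⟨⟨⟨x, i⟩, h1⟩, h2⟩ ⟨⟨⟨y, j⟩, h3⟩, h4⟩ h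
      simpa using h
    · rwa [magnus_upper_range]
  have hknown : ∀ y, y ∈ D.known := by
    rintro (y | y)
    · exact ⟨y, rfl⟩
    · exact y.elim
  have hemp : IsEmpty {y // y ∉ D.known} := ⟨fun y => y.2 (hknown y)⟩
  refine ⟨fun e he => ?_, fun h => ?_, fun hr1 h => ?_⟩
  · refine D.mem_of_ι_mem hα hβ hp (Subgroup.normalClosure_mono ?_ he)
    rintro _ ⟨k, rfl⟩
    exact ⟨Sum.inl k, rfl⟩
  · exact (D.isCohenLyndonFamily_relators hα hβ hps hp h).1.reindex (Equiv.sumEmpty _ _)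
      (by rintro (k | y); exacts [rfl, hemp.elim y])
  · exact D.isCohenLyndonFamily_of_ι hα hβ hps hknown hr1 hp h

end Magnus

/-! ### The Freiheitssatz -/

section Freiheitssatz

open FreeGroup

variable {X : Type} [DecidableEq X]

/-- Raising the stable letter to a nonzero power, and multiplying the other generators by powers of
it, is injective. -/
theorem FreeGroup.twist_injective (t : X) (w : X → ℤ) (ht : w t ≠ 0) :
    Function.Injective (twist t w) := by
  let α : FreeGroup Unit →* FreeGroup (Option X) := FreeGroup.lift fun _ => of (some t)
  let β : FreeGroup Unit →* FreeGroup (Option X) := FreeGroup.lift fun _ => of none ^ w t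
  have hof : ∀ (x : Option X) (n : ℤ), (of x : FreeGroup (Option X)) ^ n = 1 → n = 0 := by
    intro x n hn
    have := congrArg (expSum fun _ => 1) hn
    simpa [← ofAdd_zsmul] using this
  have hα : Function.Injective α := lift_unit_injective (hof _)
  have hβ : Function.Injective β := lift_unit_injective fun n hn => by
    rw [← zpow_mul] at hn
    simpa [ht] using hof _ _ hn
  let φ := rangeEquivRange hα hβ
  let s : HNNExtension (FreeGroup (Option X)) _ _ φ := HNNExtension.t
  have hs : s * HNNExtension.of (of (some t)) * s⁻¹ = HNNExtension.of (of none) ^ w t := by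
    have h1 := HNNExtension.t_mul_of (φ := φ) ⟨α (of ()), of (), rfl⟩
    rw [rangeEquivRange_apply] at h1
    simp only [α, β, lift_apply_of, map_zpow] at h1
    rw [mul_inv_eq_iff_eq_mul]
    exact h1
  -- In the HNN extension `s t s⁻¹` is a `w t`-th power. Sending `t` to its root and correcting the
  -- other generators turns `twist` into conjugation by `s`.
  let Ψ : FreeGroup X →* HNNExtension (FreeGroup (Option X)) _ _ φ := FreeGroup.lift fun x =>
    if x = t then HNNExtension.of (of none) else
      s * HNNExtension.of (of (some x)) * s⁻¹ * (HNNExtension.of (of none) ^ w x)⁻¹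
  have hΨ : ∀ f, Ψ (twist t w f) = s * HNNExtension.of (FreeGroup.map some f) * s⁻¹ := by
    intro f
    have : Ψ.comp (twist t w) = (MulAut.conj s).toMonoidHom.comp
        (HNNExtension.of.comp (FreeGroup.map some)) := by
      ext x
      change Ψ (twist t w (of x)) = s * HNNExtension.of (FreeGroup.map some (of x)) * s⁻¹
      by_cases hx : x = t
      · subst hx
        simp [twist, Ψ, hs]
      · simp [twist, Ψ, hx]
    exact DFunLike.congr_fun this f
  intro f g hfg
  have h := congrArg Ψ hfg
  rw [hΨ, hΨ] at h
  apply FreeGroup.map_injective (Option.some_injective X)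
  apply HNNExtension.of_injective (φ := φ)
  exact mul_left_cancel (mul_right_cancel h)

theorem FreeGroup.twist_zero_one (t : X) : twist t (Pi.single t 1) = MonoidHom.id _ := by
  ext x
  by_cases hx : x = t
  · subst hx; simp [twist]
  · simp [twist, hx]

/-- Weights for which the exponent sum of a given element vanishes. -/
def balance (t x : X) (r : FreeGroup X) : X → ℤ :=
  Pi.single t (expSum (Pi.single x 1) r).toAdd - Pi.single x (expSum (Pi.single t 1) r).toAdd

omit [DecidableEq X] in
theorem expSum_sub_smul (m n : ℤ) (v w : X → ℤ) (r : FreeGroup X) :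
    (expSum (m • v - n • w) r).toAdd = m * (expSum v r).toAdd - n * (expSum w r).toAdd := by
  induction r using FreeGroup.induction_on with
  | C1 => simp
  | of x => simp; ring
  | inv_of x ih => simp only [_root_.map_inv, toAdd_inv, ih]; ring
  | mul a b ha hb => simp only [_root_.map_mul, toAdd_mul, ha, hb]; ring

/-- The weight of `t` is the exponent sum of `x` and that of `x` is minus the exponent sum of `t`,
so the two contributions cancel. -/
theorem expSum_balance (t x : X) (r : FreeGroup X) : expSum (balance t x r) r = 1 := by
  have h : balance t x r = (expSum (Pi.single x 1) r).toAdd • Pi.single t (1 : ℤ) -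
      (expSum (Pi.single t 1) r).toAdd • Pi.single x (1 : ℤ) := by
    simp [balance, ← Pi.single_smul]
  apply Multiplicative.toAdd.injective
  rw [h, expSum_sub_smul, toAdd_one]
  ring

omit [DecidableEq X] in
theorem expSum_eq_one_of_mem {v : X → ℤ} {V : Set X} (hv : ∀ x ∈ V, v x = 0) {w : FreeGroup X}
    (hw : w ∈ Subgroup.closure (of '' V)) : expSum v w = 1 := by
  have h : Subgroup.closure (of '' V) ≤ (expSum v).ker := by
    rw [Subgroup.closure_le]
    rintro _ ⟨x, hx, rfl⟩
    simp [MonoidHom.mem_ker, hv x hx]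
  exact h hw

theorem expSum_twist {v : X → ℤ} {t : X} (ht : v t = 0) (w : X → ℤ) (r : FreeGroup X) :
    expSum v (twist t w r) = expSum v r := by
  have : (expSum v).comp (twist t w) = expSum v := by
    ext x
    by_cases hx : x = t
    · subst hx; simp [twist, ht]
    · simp [twist, hx, ht]
  exact DFunLike.congr_fun this r

omit [DecidableEq X] in
theorem expSum_level (v : X → ℤ) (t : X) (r : FreeGroup (X × ℤ)) :
    expSum v (level t r) = expSum (fun p => v p.1) r := by
  have : (expSum v).comp (level t) = expSum fun p => v p.1 := by
    ext p
    simp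
  exact DFunLike.congr_fun this r

omit [DecidableEq X] in
theorem expSum_eq_one_of_mem_normalClosure {v : X → ℤ} {r : FreeGroup X} (hr : expSum v r = 1)
    {w : FreeGroup X} (hw : w ∈ Subgroup.normalClosure (Set.range fun _ : Unit => r)) :
    expSum v w = 1 := by
  have h : Subgroup.normalClosure (Set.range fun _ : Unit => r) ≤ (expSum v).ker := by
    apply Subgroup.normalClosure_le_normal
    rintro _ ⟨_, rfl⟩
    exact hr
  exact h hw

/-- A nonempty list has elements of least and of greatest value. -/
theorem List.exists_min_max {A : Type*} {L : List A} (h : L ≠ []) (f : A → ℤ) :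
    ∃ a ∈ L, ∃ b ∈ L, ∀ c ∈ L, f a ≤ f c ∧ f c ≤ f b := by
  classical
  have h' : L.toFinset.Nonempty := by simpa [List.toFinset_nonempty_iff] using h
  obtain ⟨a, ha, ha'⟩ := L.toFinset.exists_min_image f h'
  obtain ⟨b, hb, hb'⟩ := L.toFinset.exists_max_image f h'
  simp only [List.mem_toFinset] at ha ha' hb hb'
  exact ⟨a, ha, b, hb, fun c hc => ⟨ha' c hc, hb' c hc⟩⟩

theorem List.filter_length_lt {L : List (X × Bool)} {t : X} {b : Bool} (h : (t, b) ∈ L) :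
    (L.filter fun l => l.1 ≠ t).length < L.length := by
  refine lt_of_le_of_ne (List.length_filter_le _ _) fun h1 => ?_
  have := List.length_filter_eq_length_iff.1 h1 _ h
  simp at this

/-- Magnus rewriting for the Freiheitssatz: a consequence of a relator on a level set, omitting one of
its letters, is trivial. -/
theorem IsLevelSet.eq_one_of_mem_normalClosure {t : X} {S : Set (X × ℤ)} (hS : IsLevelSet t S)
    {L : List ((X × ℤ) × Bool)} (hL : IsCyclicallyReduced L) (hLS : ∀ l ∈ L, l.1 ∈ S)
    (hFS : ∀ M : List (S × Bool), IsCyclicallyReduced M → M.length = L.length →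
      HasFreiheitssatz (FreeGroup.mk M))
    (hl : ∃ l ∈ L, ((l.1.1, l.1.2 + 1) : X × ℤ) ∉ S)
    (hu : ∃ l ∈ L, ((l.1.1, l.1.2 - 1) : X × ℤ) ∉ S)
    {V : Set (X × ℤ)} (hVS : V ⊆ S) (hV : ∃ l ∈ L, l.1 ∉ V)
    {w : FreeGroup (X × ℤ)} (hw : w ∈ Subgroup.closure (of '' V))
    (hwr : level t w ∈ Subgroup.normalClosure (Set.range fun _ : Unit => level t (FreeGroup.mk L))) :
    w = 1 := by
  obtain ⟨M, rfl, hM⟩ := exists_levelι_eq t hLS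
  rw [isCyclicallyReduced_map_iff Subtype.val_injective] at hL
  have hFS := hFS M hL (by simp)
  have hnot : ∀ U : Set (X × ℤ), (∃ l ∈ M.map fun x => (x.1.1, x.2), l.1 ∉ U) →
      ∀ g, g * FreeGroup.mk M * g⁻¹ ∉ Subgroup.closure (of '' {p : S | p.1 ∈ U}) := by
    rintro U ⟨l, hl, hlU⟩
    obtain ⟨m, hm, rfl⟩ := List.mem_map.1 hl
    exact hL.conj_notMem_closure hm hlU
  obtain ⟨N, rfl, hN⟩ := exists_mk_of_mem_closure hw
  obtain ⟨N', rfl, hN'⟩ := exists_levelι_eq t fun l hl => hVS (hN l hl)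
  rw [← hM, ← hN'] at hwr
  have h1 := (hS.magnus hFS (hnot {p | (p.1, p.2 + 1) ∈ S} hl) (hnot {p | (p.1, p.2 - 1) ∈ S} hu)).1 _ hwr
  have h2 := hFS _ (hnot V hV) (FreeGroup.mk N')
    (mk_mem_closure fun l hl => hN (l.1.1, l.2) (List.mem_map.2 ⟨l, hl, rfl⟩)) h1
  rw [← FreeGroup.map.mk (f := Subtype.val), h2, _root_.map_one]

/-- The Freiheitssatz when the omitted generator occurs with exponent sum zero. -/
theorem freiheitssatz_of_expSum_eq_zero {L : List (X × Bool)} (hL : IsCyclicallyReduced L)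
    {x : X} {b : Bool} (hx : (x, b) ∈ L) (h0 : expSum (Pi.single x 1) (mk L) = 1)
    (IH : ∀ (Z : Type) (M : List (Z × Bool)), IsCyclicallyReduced M → M.length < L.length →
      HasFreiheitssatz (mk M)) {w : FreeGroup X} (hw : w ∈ Subgroup.closure (of '' {x}ᶜ))
    (hwr : w ∈ Subgroup.normalClosure (Set.range fun _ : Unit => mk L)) : w = 1 := by
  obtain ⟨L', g, h1, h2, h3, h4⟩ := exists_level_cyclicallyReduced x (Pi.single x 1) L h0
  rw [twist_zero_one, MonoidHom.id_apply] at h2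
  have hlen := h3.trans_lt (List.filter_length_lt hx)
  have hnot : ∀ g, g * mk L * g⁻¹ ∉ Subgroup.closure (of '' {x}ᶜ) :=
    hL.conj_notMem_closure hx (by simp)
  have hne : L' ≠ [] := by
    rintro rfl
    apply hnot 1
    rw [h2, ← one_eq_mk]
    simp
  obtain ⟨p, hp, q, hq, hpq⟩ := List.exists_min_max hne fun l => l.1.2
  -- If all letters had the same level, the relator would be conjugate to a word without `x`,
  -- contrary to cyclic reducedness.
  have hlt : p.1.2 < q.1.2 := by
    refine lt_of_le_of_ne (hpq p hp).2 fun heq => ?_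
    have hlev : ∀ l ∈ L', l.1.2 = p.1.2 := fun l hl =>
      le_antisymm (heq ▸ (hpq l hl).2) (hpq l hl).1
    have h5 : mk L' ∈ Subgroup.closure (of '' {l : X × ℤ | l.1 ≠ x ∧ l.2 = p.1.2}) :=
      mk_mem_closure fun l hl => ⟨(h4 l hl).1, hlev l hl⟩
    have h6 : Subgroup.closure (of '' {l : X × ℤ | l.1 ≠ x ∧ l.2 = p.1.2}) ≤
        ((Subgroup.closure (of '' {x}ᶜ)).map (MulAut.conj (of x ^ p.1.2)).toMonoidHom).comap
          (level x) := by
      rw [Subgroup.closure_le]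
      rintro _ ⟨⟨z, k⟩, ⟨hz, hk⟩, rfl⟩
      refine ⟨of z, Subgroup.subset_closure ⟨z, hz, rfl⟩, ?_⟩
      change k = _ at hk
      rw [level_of, hk]
      rfl
    obtain ⟨y, hy, hy'⟩ := h6 h5
    have h7 : of x ^ p.1.2 * y * (of x ^ p.1.2)⁻¹ = level x (mk L') := hy'
    apply hnot ((of x ^ p.1.2)⁻¹ * g⁻¹)
    have h8 : (of x ^ p.1.2)⁻¹ * g⁻¹ * mk L * ((of x ^ p.1.2)⁻¹ * g⁻¹)⁻¹ = y := by
      rw [h2, ← h7]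
      group
    rw [h8]
    exact hy
  let S : Set (X × ℤ) := {l | l.1 ≠ x ∧ p.1.2 ≤ l.2 ∧ l.2 ≤ q.1.2}
  have hS : IsLevelSet x S := ⟨fun l hl => hl.1, fun y hy => ⟨p.1.2, hy, le_rfl, hlt.le⟩,
    fun y i j k hi hj hik hkj => ⟨hi.1, hi.2.1.trans hik, hkj.trans hj.2.2⟩⟩
  -- The word `w` is placed on the bottom level; the rewritten relator has a letter on the strictly
  -- higher top level, so the induction hypothesis applies.
  have h5 : FreeGroup.map (fun y => (y, p.1.2)) w = 1 := by
    refine hS.eq_one_of_mem_normalClosure h1 (fun l hl => ⟨(h4 l hl).1, hpq l hl⟩)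
      (fun M hM hML => IH _ M hM (hML ▸ hlen)) ⟨q, hq, fun h => ?_⟩ ⟨p, hp, fun h => ?_⟩
      (V := {l | l.1 ≠ x ∧ l.2 = p.1.2}) ?_ ⟨q, hq, fun h => hlt.ne' h.2⟩ ?_ ?_
    · have := h.2.2
      simp at this
    · have := h.2.1
      simp at this
    · rintro l ⟨hl, hl'⟩
      exact ⟨hl, hl'.ge, hl'.trans_le hlt.le⟩
    · have h6 : Subgroup.closure (of '' {x}ᶜ) ≤
          (Subgroup.closure (of '' {l : X × ℤ | l.1 ≠ x ∧ l.2 = p.1.2})).comap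
            (FreeGroup.map fun y => (y, p.1.2)) := by
        rw [Subgroup.closure_le]
        rintro _ ⟨y, hy, rfl⟩
        exact Subgroup.subset_closure ⟨(y, p.1.2), ⟨hy, rfl⟩, by simp⟩
      exact h6 hw
    · have h6 : (level x).comp (FreeGroup.map fun y => (y, p.1.2)) =
          (MulAut.conj (of x ^ p.1.2)).toMonoidHom := by
        ext y
        change level x (FreeGroup.map (fun y => (y, p.1.2)) (of y)) =
          MulAut.conj (of x ^ p.1.2) (of y)
        rw [map.of, level_of, MulAut.conj_apply]
      rw [h2, Subgroup.normalClosure_conj] at hwr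
      have h7 : level x (FreeGroup.map (fun y => (y, p.1.2)) w) = MulAut.conj (of x ^ p.1.2) w :=
        DFunLike.congr_fun h6 w
      rw [h7, MulAut.conj_apply]
      exact Subgroup.normalClosure_normal.conj_mem _ hwr _
  refine map_injective (fun a b h => ?_) (h5.trans (_root_.map_one _).symm)
  exact congrArg Prod.fst h

theorem Subgroup.map_mem_normalClosure {G H : Type*} [Group G] [Group H] (f : G →* H) {r w : G}
    (h : w ∈ Subgroup.normalClosure (Set.range fun _ : Unit => r)) :
    f w ∈ Subgroup.normalClosure (Set.range fun _ : Unit => f r) := by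
  have h1 : Subgroup.normalClosure (Set.range fun _ : Unit => r) ≤
      (Subgroup.normalClosure (Set.range fun _ : Unit => f r)).comap f := by
    apply Subgroup.normalClosure_le_normal
    rintro _ ⟨_, rfl⟩
    exact Subgroup.subset_normalClosure ⟨(), rfl⟩
  exact h1 h

/-- The Freiheitssatz when the omitted generator occurs with nonzero exponent sum, together with
another generator. -/
theorem freiheitssatz_of_expSum_ne_zero {L : List (X × Bool)}
    {x t : X} {b : Bool} (ht : (t, b) ∈ L) (hxt : x ≠ t)
    (h0 : expSum (Pi.single x 1) (mk L) ≠ 1)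
    (IH : ∀ (Z : Type) (M : List (Z × Bool)), IsCyclicallyReduced M → M.length < L.length →
      HasFreiheitssatz (mk M)) {w : FreeGroup X} (hw : w ∈ Subgroup.closure (of '' {x}ᶜ))
    (hwr : w ∈ Subgroup.normalClosure (Set.range fun _ : Unit => mk L)) : w = 1 := by
  let v := balance t x (mk L)
  have hv : expSum v (mk L) = 1 := expSum_balance t x _
  have hvt : v t ≠ 0 := by
    intro h
    apply h0
    apply Multiplicative.toAdd.injective
    simpa [v, balance, hxt.symm] using h
  obtain ⟨L', g, h1, h2, h3, h4⟩ := exists_level_cyclicallyReduced t v L hv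
  have hlen := h3.trans_lt (List.filter_length_lt ht)
  have hxL : ∃ l ∈ L', l.1.1 = x := by
    by_contra! hcon
    apply h0
    rw [← expSum_twist (v := Pi.single x 1) (t := t) (by simp [hxt.symm]) v, h2]
    simp only [_root_.map_mul, _root_.map_inv, mul_inv_cancel_comm]
    rw [expSum_level]
    exact expSum_eq_one_of_mem (V := {p : X × ℤ | p.1 ≠ x})
      (fun p hp => Pi.single_eq_of_ne hp _) (mk_mem_closure hcon)
  have hne : L'.filter (fun l => l.1.1 = x) ≠ [] := by
    obtain ⟨l, hl, hl'⟩ := hxL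
    exact List.ne_nil_of_mem (List.mem_filter.2 ⟨hl, by simpa using hl'⟩)
  obtain ⟨p, hp, q, hq, hpq⟩ := List.exists_min_max hne fun l => l.1.2
  simp only [List.mem_filter, decide_eq_true_eq, and_imp] at hp hq hpq
  have hle := (hpq p hp.1 hp.2).2
  -- Only the levels of `x` are bounded: the rewritten `w` omits `x` but may use any level of the
  -- other generators.
  let S : Set (X × ℤ) := {l | l.1 ≠ t ∧ (l.1 = x → p.1.2 ≤ l.2 ∧ l.2 ≤ q.1.2)}
  have hS : IsLevelSet t S := ⟨fun l hl => hl.1, fun y hy => ⟨p.1.2, hy, fun _ => ⟨le_rfl, hle⟩⟩,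
    fun y i j k hi hj hik hkj => ⟨hi.1, fun hy => ⟨(hi.2 hy).1.trans hik, hkj.trans (hj.2 hy).2⟩⟩⟩
  apply twist_injective t v hvt
  rw [_root_.map_one]
  have h5 := Subgroup.map_mem_normalClosure (twist t v) hwr
  obtain ⟨L₀, rfl, hL₀⟩ := exists_mk_of_mem_closure hw
  obtain ⟨M, h6, -, h7⟩ := exists_level_word t v L₀
  -- The relator has exponent sum zero in `t` after twisting, hence so does its consequence `w`, and
  -- the rewriting of `w` has no trailing power of `t`.
  have h8 : expSum (Pi.single t 1) (twist t v (mk L₀)) = 1 := by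
    refine expSum_eq_one_of_mem_normalClosure ?_ h5
    rw [h2]
    simp only [_root_.map_mul, _root_.map_inv, mul_inv_cancel_comm]
    rw [expSum_level]
    exact expSum_eq_one_of_mem (V := {p : X × ℤ | p.1 ≠ t}) (fun p hp => Pi.single_eq_of_ne hp _)
      (mk_mem_closure fun l hl => (h4 l hl).1)
  have h9 : (expSum v (mk L₀)).toAdd = 0 := by
    have h10 : expSum (Pi.single t 1) (level t (mk M)) = 1 := by
      rw [expSum_level]
      exact expSum_eq_one_of_mem (V := {p : X × ℤ | p.1 ≠ t}) (fun p hp => Pi.single_eq_of_ne hp _)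
        (mk_mem_closure fun l hl => (h7 l hl).1)
    rw [h6, _root_.map_mul, h10, one_mul, map_zpow, expSum_of, Pi.single_eq_same, ← ofAdd_zsmul] at h8
    simpa using h8
  rw [h9, zpow_zero, mul_one] at h6
  rw [h6] at h5 ⊢
  rw [h2, Subgroup.normalClosure_conj] at h5
  have hML : ∀ l ∈ M, l.1.1 ≠ t ∧ l.1.1 ≠ x := fun l hl => by
    obtain ⟨h10, c, hc⟩ := h7 l hl
    exact ⟨h10, hL₀ _ hc⟩
  suffices hM : mk M = 1 by rw [hM, _root_.map_one]
  refine hS.eq_one_of_mem_normalClosure h1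
      (fun l hl => ⟨(h4 l hl).1, fun h => hpq l hl h⟩)
      (fun M hM hML => IH _ M hM (hML ▸ hlen)) ⟨q, hq.1, fun h => ?_⟩ ⟨p, hp.1, fun h => ?_⟩
      (V := {l | l.1 ≠ t ∧ l.1 ≠ x}) ?_ ⟨p, hp.1, fun h => h.2 hp.2⟩ (mk_mem_closure hML) h5
  · have := (h.2 hq.2).2
    simp at this
  · have := (h.2 hp.2).1
    simp at this
  · rintro l ⟨hl, hl'⟩
    exact ⟨hl, fun h => absurd h hl'⟩

/-- The induction on length runs over all alphabets at once, because rewriting replaces generators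
by pairs of a generator and a level. It suffices to treat the complement of a single letter `x` of
the relator. -/
theorem freiheitssatz_of_isCyclicallyReduced (n : ℕ) : ∀ (X : Type) (L : List (X × Bool)),
    IsCyclicallyReduced L → L.length = n → HasFreiheitssatz (mk L) := by
  classical
  induction n using Nat.strong_induction_on with
  | h n IH =>
  rintro X L hL rfl V hV w hw hwr
  replace IH : ∀ (Z : Type) (M : List (Z × Bool)), IsCyclicallyReduced M → M.length < L.length →
      HasFreiheitssatz (mk M) := fun Z M hM hML => IH _ hML Z M hM rfl
  obtain ⟨⟨x, b⟩, hx, hxV⟩ : ∃ l ∈ L, l.1 ∉ V := by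
    by_contra! h
    exact hV 1 (by simpa using mk_mem_closure h)
  replace hw : w ∈ Subgroup.closure (of '' {x}ᶜ) := by
    refine Subgroup.closure_mono (Set.image_mono ?_) hw
    rintro y hy rfl
    exact hxV hy
  by_cases h0 : expSum (Pi.single x 1) (mk L) = 1
  · exact freiheitssatz_of_expSum_eq_zero hL hx h0 IH hw hwr
  by_cases ht : ∃ l ∈ L, l.1 ≠ x
  · obtain ⟨⟨t, b'⟩, ht, htx⟩ := ht
    exact freiheitssatz_of_expSum_ne_zero ht (Ne.symm htx) h0 IH hw hwr
  push Not at ht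
  -- Here the relator is a power of `x`; killing `x` kills the relator and fixes `w`.
  let κ : FreeGroup X →* FreeGroup X := FreeGroup.lift fun y => if y = x then 1 else of y
  have h1 : κ (mk L) = 1 := by
    have h2 : Subgroup.closure (of '' {x}) ≤ κ.ker := by
      rw [Subgroup.closure_le]
      rintro _ ⟨y, rfl, rfl⟩
      simp [κ, MonoidHom.mem_ker]
    exact h2 (mk_mem_closure ht)
  have h2 : κ w = w := by
    have h3 : Subgroup.closure (of '' {x}ᶜ) ≤ κ.eqLocus (MonoidHom.id _) := by
      rw [Subgroup.closure_le]
      rintro _ ⟨y, hy, rfl⟩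
      have : y ≠ x := hy
      change κ (of y) = of y
      simp [κ, this]
    exact h3 hw
  have h3 := Subgroup.map_mem_normalClosure κ hwr
  rw [h1, h2] at h3
  have h4 : Subgroup.normalClosure (Set.range fun _ : Unit => (1 : FreeGroup X)) ≤ ⊥ :=
    Subgroup.normalClosure_le_normal (by rintro _ ⟨_, rfl⟩; rfl)
  exact Subgroup.mem_bot.1 (h4 h3)

/-- The Freiheitssatz for one-relator groups. -/
theorem hasFreiheitssatz {X : Type} (r : FreeGroup X) : HasFreiheitssatz r := by
  obtain ⟨L, rfl⟩ := Quot.exists_rep r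
  obtain ⟨L', g, h1, h2, -⟩ := exists_isCyclicallyReduced L
  change HasFreiheitssatz (mk L)
  rw [h1]
  exact (freiheitssatz_of_isCyclicallyReduced _ X L' h2 rfl).conj g

end Freiheitssatz

/-! ### The Cohen-Lyndon theorem for one relator -/

section OneRelator

open FreeGroup

variable {X : Type}

/-- Magnus rewriting for the Cohen-Lyndon property. -/
theorem IsLevelSet.isCohenLyndonFamily_level [DecidableEq X] {t : X} {S : Set (X × ℤ)}
    (hS : IsLevelSet t S) {L : List ((X × ℤ) × Bool)} (hL : IsCyclicallyReduced L)
    (hLS : ∀ l ∈ L, l.1 ∈ S)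
    (hCL : ∀ M : List (S × Bool), IsCyclicallyReduced M → M.length = L.length →
      IsCohenLyndonFamily fun _ : Unit => FreeGroup.mk M)
    (hl : ∃ l ∈ L, ((l.1.1, l.1.2 + 1) : X × ℤ) ∉ S)
    (hu : ∃ l ∈ L, ((l.1.1, l.1.2 - 1) : X × ℤ) ∉ S) :
    IsCohenLyndonFamily fun _ : Unit => level t (FreeGroup.mk L) := by
  obtain ⟨M, rfl, hM⟩ := exists_levelι_eq t hLS
  rw [isCyclicallyReduced_map_iff Subtype.val_injective] at hL
  have hnot : ∀ U : Set (X × ℤ), (∃ l ∈ M.map fun x => (x.1.1, x.2), l.1 ∉ U) →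
      ∀ g, g * FreeGroup.mk M * g⁻¹ ∉ Subgroup.closure (of '' {p : S | p.1 ∈ U}) := by
    rintro U ⟨l, hl, hlU⟩
    obtain ⟨m, hm, rfl⟩ := List.mem_map.1 hl
    exact hL.conj_notMem_closure hm hlU
  rw [← hM]
  exact (hS.magnus (hasFreiheitssatz _) (hnot {p | (p.1, p.2 + 1) ∈ S} hl)
    (hnot {p | (p.1, p.2 - 1) ∈ S} hu)).2.1 (hCL M hL (by simp))

/-- The Cohen-Lyndon property for a word omitting a generator. -/
theorem isCohenLyndonFamily_of_notMem [Finite X] {L : List (X × Bool)} (hL : IsCyclicallyReduced L)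
    (hne : L ≠ []) {t : X} (ht : ∀ l ∈ L, l.1 ≠ t)
    (IH : ∀ (Z : Type) [Finite Z] (M : List (Z × Bool)), IsCyclicallyReduced M →
      M.length = L.length → Nat.card Z < Nat.card X → IsCohenLyndonFamily fun _ : Unit => mk M) :
    IsCohenLyndonFamily fun _ : Unit => mk L := by
  classical
  -- With a single level nothing can be shifted, so the associated subgroups are trivial and the HNN
  -- extension is a free product with the cyclic group on `t`.
  let S : Set (X × ℤ) := {p | p.1 ≠ t ∧ p.2 = 0}
  have hS : IsLevelSet t S := ⟨fun l hl => hl.1, fun y hy => ⟨0, hy, rfl⟩,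
    fun y i j k hi hj hik hkj => ⟨hi.1, by
      have h1 := hi.2
      have h2 := hj.2
      change k = 0
      simp only at h1 h2
      omega⟩⟩
  have hinj : Function.Injective fun z : X => (z, (0 : ℤ)) := fun a b h => congrArg Prod.fst h
  let ν : S → {z // z ≠ t} := fun p => ⟨p.1.1, p.2.1⟩
  have hν : Function.Injective ν := by
    rintro ⟨⟨a, i⟩, h1, h2⟩ ⟨⟨b, j⟩, h3, h4⟩ h
    simp only [ν, Subtype.mk.injEq] at h h2 h4
    simp [h, h2, h4]
  have : Finite S := Finite.of_injective ν hν
  have hcard : Nat.card S < Nat.card X :=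
    (Nat.card_le_card_of_injective ν hν).trans_lt (Finite.card_subtype_lt (x := t) (by simp))
  have h1 : level t (mk (L.map fun l => ((l.1, (0 : ℤ)), l.2))) = mk L := by
    have h2 : (level t).comp (FreeGroup.map fun z : X => (z, (0 : ℤ))) = MonoidHom.id _ := by
      ext z; simp
    have h3 := DFunLike.congr_fun h2 (mk L)
    rwa [MonoidHom.comp_apply, map.mk] at h3
  rw [← h1]
  obtain ⟨l, hl⟩ := List.exists_mem_of_ne_nil L hne
  refine hS.isCohenLyndonFamily_level ((isCyclicallyReduced_map_iff hinj).2 hL) ?_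
    (fun M hM hML => IH S M hM (by simpa using hML) hcard)
    ⟨_, List.mem_map_of_mem hl, fun h => ?_⟩ ⟨_, List.mem_map_of_mem hl, fun h => ?_⟩
  · intro m hm
    obtain ⟨l, hl, rfl⟩ := List.mem_map.1 hm
    exact ⟨ht l hl, rfl⟩
  · have := h.2
    simp at this
  · have := h.2
    simp at this

/-- The Cohen-Lyndon property for the image under `twist` of a word of exponent sum zero. -/
theorem isCohenLyndonFamily_twist [Finite X] [DecidableEq X] {L : List (X × Bool)} {t : X}
    {b : Bool} (ht : (t, b) ∈ L) {v : X → ℤ} (hv : expSum v (mk L) = 1) (hne : twist t v (mk L) ≠ 1)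
    (IH : ∀ (Z : Type) [Finite Z] (M : List (Z × Bool)), IsCyclicallyReduced M → M ≠ [] →
      M.length < L.length → IsCohenLyndonFamily fun _ : Unit => mk M) :
    IsCohenLyndonFamily fun _ : Unit => twist t v (mk L) := by
  obtain ⟨L', g, h1, h2, h3, h4⟩ := exists_level_cyclicallyReduced t v L hv
  have hlen := h3.trans_lt (List.filter_length_lt ht)
  have hne' : L' ≠ [] := by
    rintro rfl
    apply hne
    rw [h2, ← one_eq_mk]
    simp
  rw [h2]
  apply IsCohenLyndonFamily.conj
  obtain ⟨p, hp, q, hq, hpq⟩ := List.exists_min_max hne' fun l => l.1.2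
  -- Bounding the levels of all generators keeps the new alphabet finite, as the inner induction on
  -- the number of generators requires.
  let S : Set (X × ℤ) := {l | l.1 ≠ t ∧ p.1.2 ≤ l.2 ∧ l.2 ≤ q.1.2}
  have hS : IsLevelSet t S := ⟨fun l hl => hl.1, fun y hy => ⟨p.1.2, hy, le_rfl, (hpq p hp).2⟩,
    fun y i j k hi hj hik hkj => ⟨hi.1, hi.2.1.trans hik, hkj.trans hj.2.2⟩⟩
  have : Finite S := (((Set.finite_univ (α := X)).prod (Set.finite_Icc p.1.2 q.1.2)).subset
    fun l hl => ⟨trivial, hl.2.1, hl.2.2⟩).to_subtype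
  refine hS.isCohenLyndonFamily_level h1 (fun l hl => ⟨(h4 l hl).1, hpq l hl⟩)
    (fun M hM hML => IH S M hM ?_ (hML ▸ hlen)) ⟨q, hq, fun h => ?_⟩ ⟨p, hp, fun h => ?_⟩
  · rintro rfl
    exact hne' (List.length_eq_zero_iff.1 hML.symm)
  · have := h.2.2
    simp at this
  · have := h.2.1
    simp at this

/-- The free group on `Option X`, generated by a root of the generator `t`, and a copy of the free
group on `X`, twisted by powers of this root and conjugated by a stable letter. -/
noncomputable def rootLetter [DecidableEq X] (t : X) (v : Option X → ℤ) :
    StableLetter (FreeGroup (Option X)) (FreeGroup (Option X)) Unit where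
  ι := FreeGroup.lift fun x => x.elim (of (some t))
    fun z => (of none)⁻¹ * twist (some t) v (of (some z)) * of none
  s := of none
  a := fun _ => of (some t)
  b := fun _ => of none ^ v (some t)
  known := Set.univ
  conj_a := by
    intro _ _
    simp [twist, mul_assoc]
  exists_lift := by
    intro W _ ε w h
    refine ⟨FreeGroup.lift fun x => x.elim w fun z => if z = t then ε (of none) else
      w * ε (of (some z)) * w⁻¹ * (ε (of none) ^ v (some z))⁻¹, fun e => ?_, by simp⟩
    rw [← MonoidHom.comp_apply]
    congr 1
    have h1 := h () trivial
    ext x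
    cases x with
    | none => simp
    | some z =>
      by_cases hz : z = t
      · subst hz
        simp only [map_zpow] at h1
        simp [twist, ← h1, mul_assoc]
      · simp [twist, hz, mul_assoc]
  closure_eq_top := by
    rw [eq_top_iff, ← closure_range_of, Subgroup.closure_le]
    set ι : FreeGroup (Option X) →* FreeGroup (Option X) := FreeGroup.lift fun x =>
      x.elim (of (some t)) fun z => (of none)⁻¹ * twist (some t) v (of (some z)) * of none with hι
    have hs : of none ∈ Subgroup.closure (Set.range ι ∪ {of none}) :=
      Subgroup.subset_closure (Or.inr rfl)
    have ht : of (some t) ∈ Subgroup.closure (Set.range ι ∪ {of none}) :=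
      Subgroup.subset_closure (Or.inl ⟨of none, by simp [hι]⟩)
    rintro _ ⟨x, rfl⟩
    cases x with
    | none => exact hs
    | some z =>
      by_cases hz : z = t
      · rw [hz]; exact ht
      · have h1 : ι (of (some z)) ∈ Subgroup.closure (Set.range ι ∪ {of none}) :=
          Subgroup.subset_closure (Or.inl ⟨_, rfl⟩)
        have h2 : of (some z) =
            of none * ι (of (some z)) * (of none)⁻¹ * (of (some t) ^ v (some z))⁻¹ := by
          simp [hι, twist, hz, mul_assoc]
        rw [SetLike.mem_coe, h2]
        exact mul_mem (mul_mem (mul_mem hs h1) (inv_mem hs)) (inv_mem (zpow_mem ht _))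

theorem rootLetter_ι_map [DecidableEq X] (t : X) (v : Option X → ℤ) (r : FreeGroup X) :
    (rootLetter t v).ι (FreeGroup.map some r) =
      (of none)⁻¹ * twist (some t) v (FreeGroup.map some r) * (of none)⁻¹⁻¹ := by
  have h1 : (rootLetter t v).ι.comp (FreeGroup.map some) =
      (MulAut.conj (of none)⁻¹).toMonoidHom.comp ((twist (some t) v).comp (FreeGroup.map some)) := by
    ext x
    have h2 : (rootLetter t v).ι (of (some x)) =
        (of none)⁻¹ * twist (some t) v (of (some x)) * of none := lift_apply_of
    simp [h2]
  exact DFunLike.congr_fun h1 r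

/-- The Cohen-Lyndon property descends along a root extension. -/
theorem IsCohenLyndonFamily.of_twist [DecidableEq X] {L : List (X × Bool)}
    (hL : IsCyclicallyReduced L) {t x : X} {b : Bool} (hx : (x, b) ∈ L) (hxt : x ≠ t)
    {v : Option X → ℤ} (hv : v (some t) ≠ 0)
    (h : IsCohenLyndonFamily fun _ : Unit => twist (some t) v (FreeGroup.map some (mk L))) :
    IsCohenLyndonFamily fun _ : Unit => FreeGroup.map some (mk L) := by
  let D := rootLetter t v
  let p := QuotientGroup.mk' (Subgroup.normalClosure
    (Set.range fun _ : Unit => FreeGroup.map some (mk L)))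
  have hp : p.ker = _ := QuotientGroup.ker_mk' _
  have hL' : IsCyclicallyReduced (L.map fun l => (some l.1, l.2)) :=
    (isCyclicallyReduced_map_iff (Option.some_injective X)).2 hL
  have hnot : ∀ V : Set (Option X), some x ∉ V →
      ∀ g, g * FreeGroup.map some (mk L) * g⁻¹ ∉ Subgroup.closure (of '' V) := by
    intro V hV
    rw [map.mk]
    exact hL'.conj_notMem_closure (List.mem_map_of_mem hx) hV
  have hα : Function.Injective (FreeGroup.lift (p ∘ D.a)) :=
    (hasFreiheitssatz (FreeGroup.map some (mk L))).lift_injective (Y := Unit) hp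
      (f := fun _ => some t) (fun _ _ _ => rfl) (hnot _ (by simpa using hxt))
  -- The relator does not involve `none`, so the exponent sum of `none` survives in the quotient and
  -- shows that this power has infinite order.
  have hβ : Function.Injective (FreeGroup.lift (p ∘ D.b)) := by
    refine lift_unit_injective (g := p (of none ^ v (some t))) fun n hn => ?_
    rw [← map_zpow, ← zpow_mul] at hn
    have h1 : of none ^ (v (some t) * n) ∈ p.ker := hn
    rw [hp] at h1
    have h2 := expSum_eq_one_of_mem_normalClosure (v := Pi.single none 1) ?_ h1
    · rw [map_zpow, expSum_of, Pi.single_eq_same, ← ofAdd_zsmul] at h2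
      simpa [hv] using h2
    · refine expSum_eq_one_of_mem (V := Set.range some) ?_ ?_
      · rintro _ ⟨y, rfl⟩; simp
      · rw [← range_map]; exact ⟨_, rfl⟩
  refine D.isCohenLyndonFamily_of_ι hα hβ (QuotientGroup.mk'_surjective _) (fun _ => trivial) ?_ hp ?_
  · intro h1
    apply hnot ∅ (by simp) 1
    rw [h1]
    simp
  · change IsCohenLyndonFamily fun _ : Unit => (rootLetter t v).ι _
    rw [rootLetter_ι_map]
    exact h.conj _

/-- The free group on `Option X` as the free product of the free group on `X` with a cyclic
group. -/
noncomputable def freeLetter (X : Type) :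
    StableLetter (FreeGroup X) (FreeGroup (Option X)) Empty where
  ι := FreeGroup.map some
  s := of none
  a := fun z => z.elim
  b := fun z => z.elim
  known := Set.univ
  conj_a := fun z => z.elim
  exists_lift := by
    intro W _ ε w _
    refine ⟨FreeGroup.lift fun x => x.elim w fun z => ε (of z), fun e => ?_, by simp⟩
    rw [← MonoidHom.comp_apply]
    congr 1
    ext x
    simp
  closure_eq_top := by
    rw [eq_top_iff, ← closure_range_of, Subgroup.closure_le]
    rintro _ ⟨_ | x, rfl⟩
    · exact Subgroup.subset_closure (Or.inr rfl)
    · exact Subgroup.subset_closure (Or.inl ⟨of x, by simp⟩)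

/-- The Cohen-Lyndon property descends along the addition of a generator. -/
theorem IsCohenLyndonFamily.of_map_some {r : FreeGroup X} (hr : r ≠ 1)
    (h : IsCohenLyndonFamily fun _ : Unit => FreeGroup.map some r) :
    IsCohenLyndonFamily fun _ : Unit => r :=
  let p := QuotientGroup.mk' (Subgroup.normalClosure (Set.range fun _ : Unit => r))
  (freeLetter X).isCohenLyndonFamily_of_ι (p := p) (fun _ _ _ => Subsingleton.elim _ _)
    (fun _ _ _ => Subsingleton.elim _ _) (QuotientGroup.mk'_surjective _) (fun _ => trivial) hr
    (QuotientGroup.ker_mk' _) h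

/-- The Cohen-Lyndon property in a cyclic free group. -/
theorem isCohenLyndonFamily_of_subsingleton [Subsingleton X] {r : FreeGroup X} (hr : r ≠ 1) :
    IsCohenLyndonFamily fun _ : Unit => r := by
  have hcomm : ∀ f g : FreeGroup X, f * g * f⁻¹ = g := by
    intro f g
    have h1 : ∀ x, ∀ g : FreeGroup X, Commute (of x) g := by
      intro x g
      have h2 : (⊤ : Subgroup (FreeGroup X)) ≤ Subgroup.centralizer {of x} := by
        rw [← closure_range_of, Subgroup.closure_le]
        rintro _ ⟨y, rfl⟩
        rw [Subsingleton.elim y x]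
        simp [Subgroup.mem_centralizer_iff]
      exact (Subgroup.mem_centralizer_iff.1 (h2 (Subgroup.mem_top g)) _ rfl)
    have h2 : (⊤ : Subgroup (FreeGroup X)) ≤ Subgroup.centralizer {g} := by
      rw [← closure_range_of, Subgroup.closure_le]
      rintro _ ⟨y, rfl⟩
      simpa [Subgroup.mem_centralizer_iff] using (h1 y g).symm.eq
    have h3 := Subgroup.mem_centralizer_iff.1 (h2 (Subgroup.mem_top f)) g rfl
    rw [← h3, mul_inv_cancel_right]
  have hn : ∀ n : ℤ, r ^ n = 1 → n = 0 := by
    intro n hn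
    by_contra h0
    exact hr ((IsMulTorsionFree.zpow_eq_one_iff_left h0).1 hn)
  refine ⟨Unit, fun _ => r, fun _ => (), lift_unit_injective hn, ?_, fun _ => ⟨1, by simp⟩,
    fun k f => ⟨(), rfl, 1, one_mem _, by rw [hcomm f]; simp⟩⟩
  refine le_antisymm ?_ ?_
  · rw [FreeGroup.range_lift_eq_closure]
    exact Subgroup.closure_le_normalClosure
  · rw [FreeGroup.range_lift_eq_closure]
    have : (Subgroup.closure (Set.range fun _ : Unit => r)).Normal :=
      ⟨fun n hn g => by rwa [hcomm]⟩
    exact Subgroup.normalClosure_le_normal Subgroup.subset_closure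

/-- The outer induction is on length and the inner one on the number of generators: rewriting along
a letter that occurs shortens the word, while discarding a generator that does not occur keeps the
length and shrinks the alphabet. -/
theorem isCohenLyndonFamily_of_isCyclicallyReduced (n : ℕ) : ∀ (m : ℕ) (X : Type) [Finite X]
    (L : List (X × Bool)), IsCyclicallyReduced L → L ≠ [] → L.length = n → Nat.card X = m →
      IsCohenLyndonFamily fun _ : Unit => mk L := by
  classical
  induction n using Nat.strong_induction_on with
  | h n IHn =>
  intro m
  induction m using Nat.strong_induction_on with
  | h m IHm =>
  rintro X _ L hL hne rfl rfl
  have IH : ∀ (Z : Type) [Finite Z] (M : List (Z × Bool)), IsCyclicallyReduced M → M ≠ [] →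
      M.length < L.length → IsCohenLyndonFamily fun _ : Unit => mk M :=
    fun Z _ M hM hM' hML => IHn _ hML _ Z M hM hM' rfl rfl
  have hnot : ∀ g, g * mk L * g⁻¹ ∉ Subgroup.closure (of '' (∅ : Set X)) := by
    obtain ⟨l, hl⟩ := List.exists_mem_of_ne_nil L hne
    exact hL.conj_notMem_closure hl (Set.notMem_empty _)
  have hr : mk L ≠ 1 := fun h => hnot 1 (by rw [h]; simp)
  by_cases hall : ∃ t, ∀ l ∈ L, l.1 ≠ t
  · obtain ⟨t, ht⟩ := hall
    refine isCohenLyndonFamily_of_notMem hL hne ht fun Z _ M hM hML hZ => ?_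
    refine IHm _ hZ Z M hM ?_ hML rfl
    rintro rfl
    exact hne (List.length_eq_zero_iff.1 hML.symm)
  push Not at hall
  rcases subsingleton_or_nontrivial X with hX | hX
  · exact isCohenLyndonFamily_of_subsingleton hr
  obtain ⟨x, t, hxt⟩ := exists_pair_ne X
  obtain ⟨b, hx⟩ : ∃ b, (x, b) ∈ L := by
    obtain ⟨⟨_, b⟩, hx, rfl⟩ := hall x
    exact ⟨b, hx⟩
  obtain ⟨b', ht⟩ : ∃ b, (t, b) ∈ L := by
    obtain ⟨⟨_, b⟩, ht, rfl⟩ := hall t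
    exact ⟨b, ht⟩
  by_cases h0 : expSum (Pi.single x 1) (mk L) = 1
  · have h1 := isCohenLyndonFamily_twist hx h0
      (by rwa [twist_zero_one, MonoidHom.id_apply]) IH
    rwa [twist_zero_one] at h1
  -- The spare generator `none` makes room for the root of `t` in the extension of `rootLetter`.
  apply IsCohenLyndonFamily.of_map_some hr
  let v := balance (some t) (some x) (FreeGroup.map some (mk L))
  have hv : v (some t) ≠ 0 := by
    intro h
    apply h0
    apply Multiplicative.toAdd.injective
    have h1 : (expSum (Pi.single x 1) : FreeGroup X →* _) =
        (expSum (Pi.single (some x) 1)).comp (FreeGroup.map some) := by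
      ext z
      by_cases hz : z = x
      · subst hz; simp
      · simp [hz]
    rw [h1]
    simpa [v, balance, hxt.symm] using h
  refine IsCohenLyndonFamily.of_twist hL hx hxt hv ?_
  have hv' : expSum v (mk (L.map fun l => (some l.1, l.2))) = 1 := by
    rw [← map.mk]
    exact expSum_balance _ _ _
  have ht' : (some t, b') ∈ L.map fun l => (some l.1, l.2) := List.mem_map.2 ⟨_, ht, rfl⟩
  rw [map.mk]
  refine isCohenLyndonFamily_twist (v := v) ht' hv' ?_ fun Z _ M hM hM' hML =>
    IH Z M hM hM' (hML.trans_eq (List.length_map _))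
  rw [← map.mk]
  intro h
  apply hr
  apply map_injective (Option.some_injective X)
  apply twist_injective (some t) v hv
  rw [h, _root_.map_one, _root_.map_one]

/-- The Cohen-Lyndon theorem for a single relator. -/
theorem isCohenLyndonFamily_of_ne_one [Finite X] {r : FreeGroup X} (hr : r ≠ 1) :
    IsCohenLyndonFamily fun _ : Unit => r := by
  obtain ⟨L, rfl⟩ := Quot.exists_rep r
  obtain ⟨L', g, h1, h2, -⟩ := exists_isCyclicallyReduced L
  change IsCohenLyndonFamily fun _ : Unit => mk L
  rw [h1]
  suffices h : L' ≠ [] from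
    (isCohenLyndonFamily_of_isCyclicallyReduced L'.length (Nat.card X) X L' h2 h rfl rfl).conj g
  rintro rfl
  apply hr
  change mk L = 1
  rw [h1, ← one_eq_mk]
  simp

end OneRelator

/-! ### Change of relators -/

section ChangeRelators

variable {K F : Type} [Group F] {rel rel' : K → F}

theorem Subgroup.normalClosure_range_congr {ε : K → ℤˣ} {g : K → F}
    (h : ∀ k, rel' k = g k * rel k ^ (ε k : ℤ) * (g k)⁻¹) :
    Subgroup.normalClosure (Set.range rel') = Subgroup.normalClosure (Set.range rel) := by
  have key : ∀ {rel rel' : K → F} {g : K → F},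
      (∀ k, rel' k = g k * rel k ^ (ε k : ℤ) * (g k)⁻¹) →
      Subgroup.normalClosure (Set.range rel') ≤ Subgroup.normalClosure (Set.range rel) := by
    intro rel rel' g h
    apply Subgroup.normalClosure_le_normal
    rintro _ ⟨k, rfl⟩
    rw [h k]
    exact Subgroup.normalClosure_normal.conj_mem _
      (zpow_mem (Subgroup.subset_normalClosure (Set.mem_range_self k)) _) _
  refine le_antisymm (key h) (key (g := fun k => (g k)⁻¹) fun k => ?_)
  rw [h k, conj_zpow, ← zpow_mul, ← Units.val_mul, Int.units_mul_self, Units.val_one, zpow_one]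
  group

/-- The Cohen-Lyndon property is invariant under replacing members of the family by conjugates of
themselves or their inverses. -/
theorem IsCohenLyndonFamily.congr {ε : K → ℤˣ} {g : K → F}
    (h : ∀ k, rel' k = g k * rel k ^ (ε k : ℤ) * (g k)⁻¹) (hrel : IsCohenLyndonFamily rel) :
    IsCohenLyndonFamily rel' := by
  obtain ⟨I, b, l, h1, h2, h3, h4⟩ := hrel
  have hN := Subgroup.normalClosure_range_congr h
  let σ : FreeGroup I →* FreeGroup I := FreeGroup.lift fun i => FreeGroup.of i ^ (ε (l i) : ℤ)
  have hσ : ∀ w, σ (σ w) = w := by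
    intro w
    have : σ.comp σ = MonoidHom.id _ := by
      ext i
      change σ (σ (FreeGroup.of i)) = FreeGroup.of i
      simp only [σ, FreeGroup.lift_apply_of, map_zpow]
      rw [← zpow_mul, ← Units.val_mul, Int.units_mul_self, Units.val_one, zpow_one]
    exact DFunLike.congr_fun this w
  have hb : ∀ w, FreeGroup.lift (fun i => b i ^ (ε (l i) : ℤ)) w = FreeGroup.lift b (σ w) := by
    intro w
    have : FreeGroup.lift (fun i => b i ^ (ε (l i) : ℤ)) = (FreeGroup.lift b).comp σ := by
      ext i
      simp [σ]
    exact DFunLike.congr_fun this w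
  refine ⟨I, fun i => b i ^ (ε (l i) : ℤ), l, ?_, ?_, fun i => ?_, fun k f => ?_⟩
  · intro v w hvw
    rw [hb, hb] at hvw
    rw [← hσ v, h1 hvw, hσ]
  · rw [hN, ← h2]
    ext x
    constructor
    · rintro ⟨w, rfl⟩
      exact ⟨σ w, (hb w).symm⟩
    · rintro ⟨w, rfl⟩
      exact ⟨σ w, by rw [hb, hσ]⟩
  · obtain ⟨f, hf⟩ := h3 i
    refine ⟨f * (g (l i))⁻¹, ?_⟩
    simp only [hf, h, conj_zpow]
    group
  · obtain ⟨i, rfl, n, hn, hi⟩ := h4 k (f * g k)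
    refine ⟨i, rfl, n, hN ▸ hn, ?_⟩
    simp only [← hi, h, conj_zpow]
    group

end ChangeRelators

/-! ### Magnus subgroups -/

section MagnusSubgroup

open FreeGroup

open Classical in
/-- The automorphism of a free group multiplying one generator on the left by a word on the
others. -/
noncomputable def FreeGroup.transvection {X Y : Type} (x : X) (f : Y → X) (hx : ∀ y, f y ≠ x)
    (v : FreeGroup Y) : FreeGroup X ≃* FreeGroup X :=
  have hfix : ∀ v w : FreeGroup Y, FreeGroup.lift (fun z => if z = x then FreeGroup.map f v * of x
      else of z) (FreeGroup.map f w) = FreeGroup.map f w := fun v w => by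
    have : (FreeGroup.lift (fun z => if z = x then FreeGroup.map f v * of x else of z)).comp
        (FreeGroup.map f) = FreeGroup.map f := by
      ext y
      simp [hx]
    exact DFunLike.congr_fun this w
  have hinv : ∀ v : FreeGroup Y,
      (FreeGroup.lift (fun z => if z = x then FreeGroup.map f v * of x else of z)).comp
        (FreeGroup.lift (fun z => if z = x then FreeGroup.map f v⁻¹ * of x else of z)) =
        MonoidHom.id _ := fun v => by
    ext z
    by_cases hz : z = x
    · simp only [MonoidHom.comp_apply, lift_apply_of, hz, if_true, _root_.map_mul, hfix]
      simp
    · simp [hz]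
  MonoidHom.toMulEquiv
    (FreeGroup.lift fun z => if z = x then FreeGroup.map f v * of x else of z)
    (FreeGroup.lift fun z => if z = x then FreeGroup.map f v⁻¹ * of x else of z)
    (by simpa using hinv v⁻¹) (hinv v)

theorem FreeGroup.transvection_of_self {X Y : Type} (x : X) (f : Y → X) (hx : ∀ y, f y ≠ x)
    (v : FreeGroup Y) : transvection x f hx v (of x) = FreeGroup.map f v * of x := by
  simp [transvection]

theorem FreeGroup.transvection_of_ne {X Y : Type} (x : X) (f : Y → X) (hx : ∀ y, f y ≠ x)
    (v : FreeGroup Y) {z : X} (hz : z ≠ x) : transvection x f hx v (of z) = of z := by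
  simp [transvection, hz]

theorem ker_presentedGroup_mk {X : Type} (s : FreeGroup X) : (PresentedGroup.mk {s}).ker =
    Subgroup.normalClosure (Set.range fun _ : Unit => s) := by
  rw [Set.range_const]
  exact QuotientGroup.ker_mk' _

/-- A Magnus subgroup is free on the generators that define it. -/
theorem isMagnusSubgroup_range {X Y : Type} {s : FreeGroup X} {b : FreeGroupBasis X (FreeGroup X)}
    {f : Y → X} (hf : Function.Injective f)
    (h : ∀ g, g * s * g⁻¹ ∉ Subgroup.closure (b '' Set.range f)) {a : Y → FreeGroup X}
    (ha : ∀ y, a y = b (f y)) :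
    Function.Injective (FreeGroup.lift (PresentedGroup.mk {s} ∘ a)) ∧
      IsMagnusSubgroup s b (FreeGroup.lift (PresentedGroup.mk {s} ∘ a)).range := by
  have hb : ∀ x, b.repr.symm (of x) = b x := fun x => rfl
  have hbV : ∀ V : Set X, (Subgroup.closure (of '' V)).map b.repr.symm.toMonoidHom =
      Subgroup.closure (b '' V) := by
    intro V
    rw [MonoidHom.map_closure, Set.image_image]
    rfl
  have ha' : PresentedGroup.mk {s} ∘ a = fun y => PresentedGroup.mk {s} (b (f y)) :=
    funext fun y => congrArg _ (ha y)
  constructor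
  · have hker : ((PresentedGroup.mk {s}).comp b.repr.symm.toMonoidHom).ker =
        Subgroup.normalClosure (Set.range fun _ : Unit => b.repr s) := by
      ext w
      rw [← MonoidHom.comap_ker, ker_presentedGroup_mk, Subgroup.mem_comap]
      constructor
      · intro hw
        simpa using Subgroup.map_mem_normalClosure b.repr.toMonoidHom hw
      · intro hw
        simpa using Subgroup.map_mem_normalClosure b.repr.symm.toMonoidHom hw
    rw [ha']
    refine (hasFreiheitssatz (b.repr s)).lift_injective hker hf fun g hg => h (b.repr.symm g) ?_
    rw [← hbV]
    exact ⟨_, hg, by simp⟩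
  · refine ⟨Set.range f, h, ?_⟩
    rw [FreeGroup.range_lift_eq_closure, MonoidHom.map_closure, ha', ← Set.range_comp,
      ← Set.range_comp]
    rfl

end MagnusSubgroup

/-! ### Hempel presentations -/

namespace Hempel

open FreeGroup

variable {d : ℕ}

/-- The indices of the elements of `X₁` with level at most `m`. -/
def levels (d m : ℕ) : Set (Gen d × ℤ) :=
  {p | p = (.x, 1) ∨ ∃ j, p.1 = .z j ∧ 0 ≤ p.2 ∧ p.2 ≤ m}

theorem isLevelSet_levels (d m : ℕ) : IsLevelSet Gen.y (levels d m) := by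
  refine ⟨?_, ?_, ?_⟩
  · rintro p (rfl | ⟨j, hj, -⟩)
    · simp
    · simp [hj]
  · rintro (_ | _ | j) h
    · exact ⟨1, Or.inl rfl⟩
    · exact absurd rfl h
    · exact ⟨0, Or.inr ⟨j, rfl, le_rfl, Int.natCast_nonneg m⟩⟩
  · rintro a' i j k (hi | ⟨a, ha, hi, hi'⟩) (hj | ⟨b, hb, hj, hj'⟩) hik hkj
    · simp only [Prod.mk.injEq] at hi hj
      refine Or.inl (Prod.ext hi.1 ?_)
      simp only
      omega
    · simp only [Prod.mk.injEq] at hi hb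
      simp [hi.1] at hb
    · simp only [Prod.mk.injEq] at ha hj
      simp [hj.1] at ha
    · exact Or.inr ⟨a, ha, hi.trans hik, hkj.trans hj'⟩

theorem finite_levels (d m : ℕ) : (levels d m).Finite := by
  have : levels d m ⊆ {(Gen.x, 1)} ∪
      Set.range (Gen.z : Fin d → Gen d) ×ˢ Set.Icc (0 : ℤ) m := by
    rintro p (rfl | ⟨j, hj, h⟩)
    · exact Or.inl rfl
    · exact Or.inr ⟨⟨j, hj.symm⟩, h⟩
  exact ((Set.finite_singleton _).union ((Set.finite_range _).prod (Set.finite_Icc _ _))).subset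
    this

/-- The generator and the exponent of the conjugating power of `y`. -/
def Idx.toLevel : Idx d → Gen d × ℤ
  | .x₁ => (.x, 1)
  | .z i j => (.z j, i)

theorem Idx.toLevel_injective : Function.Injective (Idx.toLevel : Idx d → _) := by
  rintro (_ | ⟨i, j⟩) (_ | ⟨i', j'⟩) h <;> simp_all [Idx.toLevel]

theorem level_toLevel (w : FreeGroup (Idx d)) :
    level Gen.y (FreeGroup.map Idx.toLevel w) = subst w := by
  have h : (level Gen.y).comp (FreeGroup.map Idx.toLevel) = (subst : FreeGroup (Idx d) →* _) := by
    ext (_ | ⟨i, j⟩) <;> simp [subst, elt, Idx.toLevel]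
  exact DFunLike.congr_fun h w

/-- `IsHempelRelator.not_conj` concerns conjugators in `⟨X₁⟩`; this makes those coming from bounded
levels admissible. -/
theorem levelι_mem_closure {m : ℕ} (g : FreeGroup (levels d m)) :
    levelι Gen.y (levels d m) g ∈
      Subgroup.closure (Set.range (elt : Idx d → FreeGroup (Gen d))) := by
  have h : (⊤ : Subgroup (FreeGroup (levels d m))) ≤ (Subgroup.closure
      (Set.range (elt : Idx d → FreeGroup (Gen d)))).comap (levelι Gen.y (levels d m)) := by
    rw [← closure_range_of, Subgroup.closure_le]
    rintro _ ⟨⟨⟨a, i⟩, h⟩, rfl⟩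
    refine Subgroup.subset_closure ?_
    rw [levelι_of]
    rcases h with h | ⟨j, h, hi, -⟩
    · simp only [Prod.mk.injEq] at h
      obtain ⟨rfl, rfl⟩ := h
      exact ⟨.x₁, by simp [elt]⟩
    · obtain ⟨i, rfl⟩ := Int.eq_ofNat_of_zero_le hi
      obtain rfl : a = .z j := h
      exact ⟨.z i j, by simp [elt]⟩
  exact h (Subgroup.mem_top g)

/-- The generator `¹x` among the elements of `X₁` of bounded level. -/
def xGen (d m : ℕ) : levels d m := ⟨(.x, 1), Or.inl rfl⟩

/-- The generator `⁰z_j` among the elements of `X₁` of bounded level. -/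
def zGen {d : ℕ} (m : ℕ) (j : Fin d) : levels d m :=
  ⟨(.z j, 0), Or.inr ⟨j, rfl, le_rfl, Int.natCast_nonneg m⟩⟩

theorem zGen_ne (m : ℕ) (j : Fin d) : zGen m j ≠ xGen d m := fun h => by
  have h1 := congrArg (fun p : levels d m => p.1.1) h
  simp [zGen, xGen] at h1

theorem levelι_map_zGen (m : ℕ) (u : FreeGroup (Fin d)) :
    levelι Gen.y (levels d m) (FreeGroup.map (zGen m) u) = inclZ u := by
  have h : (levelι Gen.y (levels d m)).comp (FreeGroup.map (zGen m)) =
      (inclZ : FreeGroup (Fin d) →* _) := by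
    ext j
    simp [levelι_of, zGen, inclZ]
  exact DFunLike.congr_fun h u

theorem levelι_xGen (m : ℕ) : levelι Gen.y (levels d m) (of (xGen d m)) = elt .x₁ := by
  simp [levelι_of, xGen, elt]

theorem exists_max_level {L : List (Idx d × Bool)} (h : ∃ j e, (Idx.z 0 j, e) ∈ L) :
    ∃ m, (∀ l ∈ L, l.1.toLevel ∈ levels d m) ∧ ∃ j e, (Idx.z m j, e) ∈ L := by
  -- Giving `¹x` the value 0 ensures that the maximum is also attained at some `z`-letter: if it is
  -- attained at `¹x`, it is 0, the value of the given `⁰z_j`.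
  let f : Idx d × Bool → ℤ := fun l => match l.1 with
    | .x₁ => 0
    | .z i _ => i
  obtain ⟨j₀, e₀, h₀⟩ := h
  obtain ⟨_, -, q, hq, hmax⟩ := List.exists_min_max (List.ne_nil_of_mem h₀) f
  have key : ∀ m : ℕ, f q = m → ∀ l ∈ L, l.1.toLevel ∈ levels d m := by
    rintro m hm ⟨_ | ⟨i, j⟩, e⟩ hl
    · exact Or.inl rfl
    · exact Or.inr ⟨j, rfl, Int.natCast_nonneg i, hm ▸ (hmax _ hl).2⟩
  rcases q with ⟨_ | ⟨i, j⟩, e⟩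
  · exact ⟨0, key 0 rfl, j₀, e₀, h₀⟩
  · exact ⟨i, key i rfl, j, e, hq⟩

/-- A Hempel relator is a cyclically reduced word on a finite part of `X₁`. -/
theorem IsHempelRelator.exists_word {u : FreeGroup (Fin d)} {r : FreeGroup (Gen d)}
    (hr : IsHempelRelator u r) : ∃ (m : ℕ) (L : List (levels d m × Bool)),
      IsCyclicallyReduced L ∧ levelι Gen.y (levels d m) (FreeGroup.mk L) = r ∧
      (∃ l ∈ L, ∃ j, l.1.1 = (Gen.z j, 0)) ∧ ∃ l ∈ L, ∃ j, l.1.1 = (Gen.z j, (m : ℤ)) := by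
  obtain ⟨w, rfl⟩ : ∃ w, subst w = r := by
    have h := hr.mem
    rwa [← FreeGroup.range_lift_eq_closure] at h
  obtain ⟨m, h1, j, e, h2⟩ := exists_max_level (hr.involves w rfl)
  obtain ⟨j₀, e₀, h3⟩ := hr.involves w rfl
  obtain ⟨L, h4, h5⟩ := exists_levelι_eq Gen.y (S := levels d m)
    (L := w.toWord.map fun l => (l.1.toLevel, l.2)) fun l hl => by
      obtain ⟨l', hl', rfl⟩ := List.mem_map.1 hl
      exact h1 l' hl'
  have hmem : ∀ l ∈ w.toWord, ∃ l' ∈ L, l'.1.1 = l.1.toLevel := by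
    intro l hl
    have h6 : (l.1.toLevel, l.2) ∈ w.toWord.map fun l => (l.1.toLevel, l.2) :=
      List.mem_map_of_mem hl
    rw [← h4] at h6
    obtain ⟨l', hl', h7⟩ := List.mem_map.1 h6
    exact ⟨l', hl', congrArg Prod.fst h7⟩
  refine ⟨m, L, ?_, ?_, ?_, ?_⟩
  · rw [← isCyclicallyReduced_map_iff Subtype.val_injective, h4,
      isCyclicallyReduced_map_iff Idx.toLevel_injective]
    exact hr.cyclicallyReduced w rfl
  · rw [h5, ← map.mk, mk_toWord, level_toLevel]
  · obtain ⟨l, hl, hl'⟩ := hmem _ h3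
    exact ⟨l, hl, j₀, by simpa [Idx.toLevel] using hl'⟩
  · obtain ⟨l, hl, hl'⟩ := hmem _ h2
    exact ⟨l, hl, j, by simpa [Idx.toLevel] using hl'⟩

/-- As `x` has the single level 1, it cannot be shifted; the known relations involve only the
`z`-letters, and `x` enters through the surface relator alone. -/
theorem lowerPart_levels {m : ℕ} (p : LowerPart (levels d m)) :
    ∃ j, p.1.1.1 = .z j ∧ 0 ≤ p.1.1.2 ∧ p.1.1.2 < m := by
  obtain ⟨⟨⟨a, i⟩, h⟩, h'⟩ := p
  rcases h with h | ⟨j, hj, h1, h2⟩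
  · simp only [Prod.mk.injEq] at h
    obtain ⟨rfl, rfl⟩ := h
    rcases h' with h' | ⟨j, hj, -⟩
    · simp at h'
    · simp at hj
  · obtain rfl : a = .z j := hj
    rcases h' with h' | ⟨j', -, -, h3⟩
    · simp at h'
    · exact ⟨j, rfl, h1, by simp only at h3 ⊢; omega⟩

/-- The indices of the basis elements generating the lower associated subgroup. -/
def lowerIdx (d m : ℕ) : LowerPart (levels d m) ⊕ Unit → levels d m :=
  Sum.elim (fun p => p.1) fun _ => xGen d m

/-- The indices of the basis elements generating the upper associated subgroup. -/
def upperIdx (d m : ℕ) : LowerPart (levels d m) ⊕ Unit → levels d m :=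
  Sum.elim (fun p => ⟨(p.1.1.1, p.1.1.2 + 1), p.2⟩) fun _ => xGen d m

theorem lowerIdx_injective (d m : ℕ) : Function.Injective (lowerIdx d m) := by
  refine Function.Injective.sumElim Subtype.val_injective (fun _ _ _ => rfl) fun p _ h => ?_
  obtain ⟨j, hj, -⟩ := lowerPart_levels p
  simp [h, xGen] at hj

theorem upperIdx_injective (d m : ℕ) : Function.Injective (upperIdx d m) := by
  refine Function.Injective.sumElim ?_ (fun _ _ _ => rfl) fun p _ h => ?_
  · rintro ⟨⟨⟨a, i⟩, h1⟩, h2⟩ ⟨⟨⟨b, j⟩, h3⟩, h4⟩ h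
    simpa using h
  · obtain ⟨j, hj, -⟩ := lowerPart_levels p
    have h1 := congrArg (fun p : levels d m => p.1.1) h
    simp only at h1
    rw [hj] at h1
    simp [xGen] at h1

/-- The basis obtained from the elements of `X₁` of bounded level on replacing `¹x` by
`u⁻¹ · ¹x`. -/
noncomputable def lowerBasis (m : ℕ) (u : FreeGroup (Fin d)) :
    FreeGroupBasis (levels d m) (FreeGroup (levels d m)) :=
  (FreeGroupBasis.ofFreeGroup _).map
    (transvection (xGen d m) (zGen m) (zGen_ne m) u⁻¹)

theorem lowerBasis_xGen (m : ℕ) (u : FreeGroup (Fin d)) :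
    lowerBasis m u (xGen d m) = (FreeGroup.map (zGen m) u)⁻¹ * of (xGen d m) := by
  rw [← _root_.map_inv]
  exact transvection_of_self _ _ (zGen_ne m) _

theorem lowerBasis_of_ne {m : ℕ} (u : FreeGroup (Fin d)) {p : levels d m} (hp : p ≠ xGen d m) :
    lowerBasis m u p = of p :=
  transvection_of_ne _ _ (zGen_ne m) _ hp

/-- For `m > 0` the word `u` has level `0 < m`, so the subgroup consists of words without letters
`ᵐz_j`, one of which occurs in `L`. For `m = 0` the subgroup is generated by `u⁻¹·¹x`, and (H2)
applies. -/
theorem IsHempelRelator.conj_notMem_lower {u : FreeGroup (Fin d)} {r : FreeGroup (Gen d)}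
    (hr : IsHempelRelator u r) {m : ℕ} {L : List (levels d m × Bool)} (hL : IsCyclicallyReduced L)
    (hLr : levelι Gen.y (levels d m) (FreeGroup.mk L) = r)
    (hm : ∃ l ∈ L, ∃ j, l.1.1 = (Gen.z j, (m : ℤ))) (g : FreeGroup (levels d m)) :
    g * FreeGroup.mk L * g⁻¹ ∉ Subgroup.closure (lowerBasis m u '' Set.range (lowerIdx d m)) := by
  have hne : ∀ p : LowerPart (levels d m), p.1 ≠ xGen d m := by
    intro p h
    obtain ⟨j, hj, -⟩ := lowerPart_levels p
    simp [h, xGen] at hj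
  intro hg
  rcases Nat.eq_zero_or_pos m with rfl | hpos
  · refine hr.not_conj _ (levelι_mem_closure g) ?_
    have h1 : Subgroup.closure (lowerBasis 0 u '' Set.range (lowerIdx d 0)) ≤
        (Subgroup.zpowers ((inclZ u)⁻¹ * elt .x₁)).comap (levelι Gen.y (levels d 0)) := by
      rw [Subgroup.closure_le]
      rintro _ ⟨_, ⟨p | _, rfl⟩, rfl⟩
      · obtain ⟨j, -, h, h'⟩ := lowerPart_levels p
        simp only [Nat.cast_zero] at h'
        omega
      · change levelι Gen.y _ (lowerBasis 0 u (xGen d 0)) ∈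
          Subgroup.zpowers ((inclZ u)⁻¹ * elt .x₁)
        rw [lowerBasis_xGen, _root_.map_mul, _root_.map_inv, levelι_map_zGen, levelι_xGen]
        exact Subgroup.mem_zpowers _
    have h2 := h1 hg
    rw [Subgroup.mem_comap, _root_.map_mul, _root_.map_mul, _root_.map_inv, hLr] at h2
    exact h2
  · obtain ⟨l, hl, j, hj⟩ := hm
    refine hL.conj_notMem_closure hl (V := {p | p = xGen d m ∨ p.1.2 < m}) ?_ g ?_
    · rintro (h | h)
      · simp [h, xGen] at hj
      · simp [hj] at h
    · refine (Subgroup.closure_le _).2 ?_ hg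
      rintro _ ⟨_, ⟨p | _, rfl⟩, rfl⟩
      · obtain ⟨j, -, -, h⟩ := lowerPart_levels p
        change lowerBasis m u p.1 ∈ _
        rw [lowerBasis_of_ne u (hne p)]
        exact Subgroup.subset_closure ⟨_, Or.inr h, rfl⟩
      · change lowerBasis m u (xGen d m) ∈ _
        rw [lowerBasis_xGen]
        refine mul_mem (inv_mem ?_) (Subgroup.subset_closure ⟨_, Or.inl rfl, rfl⟩)
        have h3 : FreeGroup.map (zGen m) u ∈ (FreeGroup.map (zGen m)).range := ⟨u, rfl⟩
        rw [range_map] at h3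
        refine Subgroup.closure_mono (Set.image_mono ?_) h3
        rintro _ ⟨j, rfl⟩
        exact Or.inr (by simpa [zGen] using hpos)

/-- The upper generators omit every `⁰z_j`, and (H4) puts one of these into the relator. -/
theorem conj_notMem_upper {m : ℕ} {L : List (levels d m × Bool)}
    (hL : IsCyclicallyReduced L) (h0 : ∃ l ∈ L, ∃ j, l.1.1 = (Gen.z j, 0))
    (g : FreeGroup (levels d m)) :
    g * FreeGroup.mk L * g⁻¹ ∉ Subgroup.closure (of '' Set.range (upperIdx d m)) := by
  obtain ⟨l, hl, j, hj⟩ := h0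
  refine hL.conj_notMem_closure hl ?_ g
  rintro ⟨p | _, hp⟩
  · obtain ⟨j, -, h, -⟩ := lowerPart_levels p
    have h1 := congrArg (fun p : levels d m => p.1.2) hp
    simp only [upperIdx, Sum.elim_inl, hj] at h1
    omega
  · have h1 := congrArg (fun p : levels d m => p.1.1) hp
    simp [upperIdx, xGen, hj] at h1

open Classical in
/-- The stable letter `y` of a Hempel presentation. -/
noncomputable def stableLetter (m : ℕ) (u : FreeGroup (Fin d)) :
    StableLetter (FreeGroup (levels d m)) (FreeGroup (Gen d)) (LowerPart (levels d m) ⊕ Unit) :=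
  magnusLetter Gen.y (isLevelSet_levels d m) (fun _ => lowerBasis m u (xGen d m))
    fun _ => of (xGen d m)

theorem stableLetter_a (m : ℕ) (u : FreeGroup (Fin d)) (y : LowerPart (levels d m) ⊕ Unit) :
    (stableLetter m u).a y = lowerBasis m u (lowerIdx d m y) := by
  rcases y with p | _
  · refine (lowerBasis_of_ne u fun h => ?_).symm
    obtain ⟨j, hj, -⟩ := lowerPart_levels p
    have h : p.1 = xGen d m := h
    simp [h, xGen] at hj
  · rfl

theorem stableLetter_b (m : ℕ) (u : FreeGroup (Fin d)) (y : LowerPart (levels d m) ⊕ Unit) :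
    (stableLetter m u).b y = FreeGroupBasis.ofFreeGroup _ (upperIdx d m y) := by
  rcases y with p | _ <;> rfl

/-- The only relator that does not already hold in the free group is, up to conjugation and
inversion, the surface relator. -/
theorem stableLetter_relator (m : ℕ) (u : FreeGroup (Fin d)) :
    (stableLetter m u).relator (Sum.inr ()) = of .y * (surfaceRel u)⁻¹ * (of .y)⁻¹ := by
  change of .y * levelι Gen.y (levels d m) (lowerBasis m u (xGen d m)) * (of .y)⁻¹ *
    (levelι Gen.y (levels d m) (of (xGen d m)))⁻¹ = _
  rw [lowerBasis_xGen, _root_.map_mul, _root_.map_inv, levelι_map_zGen, levelι_xGen, elt, surfaceRel]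
  group

end Hempel

theorem theorem3p6 (d : ℕ) (hd : 1 ≤ d) (u : FreeGroup (Fin d)) (r : FreeGroup (Hempel.Gen d))
    (hr : Hempel.IsHempelRelator u r) :
    IsCohenLyndonAspherical ({Hempel.surfaceRel u, r} : Set (FreeGroup (Hempel.Gen d))) ∧
    ∃ (ι : Type) (s : FreeGroup ι) (b₁ b₂ : FreeGroupBasis ι (FreeGroup ι))
      (A B : Subgroup (PresentedGroup {s})) (φ : A ≃* B),
      IsMagnusSubgroup s b₁ A ∧ IsMagnusSubgroup s b₂ B ∧
      Nonempty (PresentedGroup ({Hempel.surfaceRel u, r} : Set (FreeGroup (Hempel.Gen d))) ≃*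
        HNNExtension (PresentedGroup {s}) A B φ) := by
  obtain ⟨m, L, hL, hLr, h0, hm⟩ := hr.exists_word
  let D := Hempel.stableLetter m u
  let s := FreeGroup.mk L
  obtain ⟨hα, hA⟩ := isMagnusSubgroup_range (Hempel.lowerIdx_injective d m)
    (hr.conj_notMem_lower hL hLr hm) (Hempel.stableLetter_a m u)
  obtain ⟨hβ, hB⟩ := isMagnusSubgroup_range (b := FreeGroupBasis.ofFreeGroup _)
    (Hempel.upperIdx_injective d m) (Hempel.conj_notMem_upper hL h0) (Hempel.stableLetter_b m u)
  have hs : s ≠ 1 := by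
    intro h
    obtain ⟨l, hl, -⟩ := h0
    apply hL.conj_notMem_closure hl (Set.notMem_empty _) 1
    change 1 * s * 1⁻¹ ∈ _
    rw [h]
    simp
  have : Finite (Hempel.levels d m) := Hempel.finite_levels d m
  have hsurj : Function.Surjective (PresentedGroup.mk {s}) := QuotientGroup.mk'_surjective _
  obtain ⟨hCL, hker⟩ := D.isCohenLyndonFamily_relators hα hβ hsurj (ker_presentedGroup_mk s)
    (isCohenLyndonFamily_of_ne_one hs)
  let rel : Unit ⊕ {y // y ∉ D.known} → FreeGroup (Hempel.Gen d) :=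
    Sum.elim (fun _ => r) fun _ => Hempel.surfaceRel u
  -- The HNN relator is `y` times the inverse surface relator times `y⁻¹`; the sign `-1` and the
  -- conjugator `y⁻¹` undo this.
  have hrel : ∀ k, rel k = Sum.elim (fun _ => 1) (fun _ => (FreeGroup.of .y)⁻¹) k *
      D.relators (fun _ : Unit => s) k ^
        ((Sum.elim (fun _ => 1) (fun _ => -1) k : ℤˣ) : ℤ) *
      (Sum.elim (fun _ => 1) (fun _ => (FreeGroup.of .y)⁻¹) k)⁻¹ := by
    rintro (_ | ⟨y | _, hy⟩)
    · change r = 1 * levelι _ _ (FreeGroup.mk L) ^ (1 : ℤ) * 1⁻¹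
      rw [hLr]
      group
    · exact absurd ⟨y, rfl⟩ hy
    · change Hempel.surfaceRel u = (FreeGroup.of .y)⁻¹ *
        (Hempel.stableLetter m u).relator (Sum.inr ()) ^ (-1 : ℤ) * (FreeGroup.of .y)⁻¹⁻¹
      rw [Hempel.stableLetter_relator]
      group
  have hrange : Set.range rel = {Hempel.surfaceRel u, r} := by
    have hne : Nonempty {y // y ∉ D.known} := ⟨Sum.inr (), by rintro ⟨y, hy⟩; cases hy⟩
    simp only [rel, Set.Sum.elim_range, Set.range_const]
    exact Set.union_comm _ _
  rw [← Subgroup.normalClosure_range_congr hrel, hrange] at hker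
  refine ⟨hrange ▸ (hCL.congr hrel).isCohenLyndonAspherical, Hempel.levels d m, s,
    Hempel.lowerBasis m u, FreeGroupBasis.ofFreeGroup _, _, _, rangeEquivRange hα hβ, hA, hB, ⟨?_⟩⟩
  exact (QuotientGroup.quotientMulEquivOfEq hker.symm).trans
    (QuotientGroup.quotientKerEquivOfSurjective _ (D.proj_surjective hα hβ hsurj))
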